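/- Let $N$ be a lattice of rank $r\ge 2$, $N_{\mathbb R}=N\otimes\mathbb R$, and let $\Delta=(n_e)_{e\in E}$ be a finite family of at least three vectors of $N$ with $\sum_e n_e=0$ (zero vectors are allowed and correspond to marked points). A parametrized rational tropical curve of degree $\Delta$ is a metric tree $\Gamma$, all of whose vertices have valency at least $3$, with positive lengths on the bounded edges and unbounded ends labelled by $E$, together with a map $h:\Gamma\to N_{\mathbb R}$ that is affine on every edge with slope in $N$, has outgoing slope $n_e$ on the end $e$, and is balanced (the outgoing slopes at every vertex sum to $0$). Curves are considered up to isometries that respect the labels and commute with the maps. $\Gamma$ is trivalent if all its vertices have valency exactly $3$. For every $e\in E$ let $L_e\subset N/\langle n_e\rangle$ be a sublattice such that $Q_e=(N/\langle n_e\rangle)/L_e$ is torsion-free, and suppose that $\sum_e \operatorname{rk} Q_e=|E|+r-3$. A family of affine constraints with slopes $(L_e)$ is a family $\mathcal L=(\mathcal L_e)_e$ of affine subspaces $\mathcal L_e\subset (N/\langle n_e\rangle)\otimes\mathbb R$ with direction $L_e\otimes\mathbb R$. A curve is a solution for $\mathcal L$ if for every $e$ the image of $h(e)$ in $(N/\langle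 n_e\rangle)\otimes\mathbb R$ lies in $\mathcal L_e$. The curves of a given combinatorial type $C$ (labelled tree without lengths) form a cone, whose linear span carries the lattice $\mathbb Z^{\{\text{bounded edges}\}}\times N$ (lengths of the bounded edges, position of a vertex). Evaluating the ends gives a linear map $\mathrm{ev}_C^{(L_e)}$ from this lattice to $\prod_e Q_e$. For trivalent $C$ the two lattices have the same rank, and the complex multiplicity of a curve $\Gamma$ of type $C$ is $m_\Gamma=|\det \mathrm{ev}_C^{(L_e)}|$, computed in lattice bases. Call $\mathcal L$ generic if every solution for $\mathcal L$ is trivalent and $\mathrm{ev}_C^{(L_e)}$ is injective for its combinatorial type $C$; that is, $\mathcal L$ is neither in the image of a cone that is not top-dimensional nor in the image of a cone on which $\mathrm{ev}^{(L_e)}$ is not injective. Theorem. 1. There are finitely many proper linear subspaces of $\prod_e (N/\langle n_e\rangle)\otimes\mathbb R$ such that, for every point $(p_e)_e$ outside their union, the family $\mathcal L_e=p_e+L_e\otimes\mathbb R$ is generic. 2. For every generic $\mathcal L$ with slopes $(L_e)$ there are only finitely many solutions, and all of them are trivalent. 3. For generic $\mathcal L$ with slopes $(L_e)$, the count $N_\Delta(\mathcal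 L)=\sum_{\Gamma\text{ solution for }\mathcal L} m_\Gamma$ depends only on $\Delta$ and the slopes $(L_e)$: if $\mathcal L$ and $\mathcal L'$ are both generic with slopes $(L_e)$, then $N_\Delta(\mathcal L)=N_\Delta(\mathcal L')$. -/

import Mathlib

open scoped TensorProduct

namespace TropicalCount

/-- The combinatorial type of an abstract rational tropical curve `Γ` whose unbounded ends are
labelled by `E`: the tree formed by the vertices and the bounded edges of `Γ`, together with the
vertex to which each unbounded end is attached. Every vertex has valency at least three, so that
the graph obtained by closing up the ends has no bivalent vertex and its univalent vertices are
exactly the end points of the unbounded ends. The numbering of the vertices is immaterial: curves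
are considered up to isomorphism below. -/
structure RationalGraph (E : Type*) where
  /-- the number of vertices -/
  numVertices : ℕ
  /-- the vertices and the bounded edges -/
  graph : SimpleGraph (Fin numVertices)
  /-- the vertex adjacent to an unbounded end -/
  endVertex : E → Fin numVertices
  isTree : graph.IsTree
  three_le_valency : ∀ v, 3 ≤ (graph.neighborSet v).ncard + {e | endVertex e = v}.ncard

namespace RationalGraph

variable {E : Type*}

/-- The valency of a vertex: the number of bounded edges and unbounded ends adjacent to it. -/
noncomputable def valency (Γ : RationalGraph E) (v : Fin Γ.numVertices) : ℕ :=
  (Γ.graph.neighborSet v).ncard + {e | Γ.endVertex e = v}.ncard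

/-- Every vertex is adjacent to precisely three edges. -/
def IsTrivalent (Γ : RationalGraph E) : Prop := ∀ v, Γ.valency v = 3

/-- The bounded edge that underlies an oriented bounded edge. -/
def edgeOf (Γ : RationalGraph E) (d : Γ.graph.Dart) : Γ.graph.edgeSet := ⟨d.edge, d.edge_mem⟩

end RationalGraph

/-- The combinatorial type of a parametrized rational tropical curve of degree `n`, where `n e` is
the slope of the map on the unbounded end `e` (oriented outwards): the graph, and the slope in `N`
of the map on each oriented bounded edge, subject to the balancing condition at every vertex. -/
structure ParamType {E N : Type*} [Fintype E] [AddCommGroup N] (n : E → N)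
    extends RationalGraph E where
  /-- the slope on an oriented bounded edge -/
  slope : graph.Dart → N
  slope_symm : ∀ d, slope d.symm = - slope d
  balanced : ∀ v, (∑ᶠ d : {d : graph.Dart // d.fst = v}, slope d.1) +
    (∑ e with endVertex e = v, n e) = 0

section Lattices

/-- The absolute value of the determinant of a homomorphism between two lattices of the same rank,
with respect to bases of these lattices (with the convention that it is `0` when the ranks
differ). -/
noncomputable def latticeDet {A B : Type*} [AddCommGroup A] [AddCommGroup B]
    [Module.Free ℤ A] [Module.Finite ℤ A] [Module.Free ℤ B] [Module.Finite ℤ B]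
    (f : A →ₗ[ℤ] B) : ℕ :=
  open Classical in
  if h : Module.finrank ℤ A = Module.finrank ℤ B then
    (LinearMap.toMatrix (Module.finBasisOfFinrankEq ℤ A h) (Module.finBasis ℤ B) f).det.natAbs
  else 0

theorem latticeDet_comp_equiv {A A' B : Type*} [AddCommGroup A] [AddCommGroup A']
    [AddCommGroup B] [Module.Free ℤ A] [Module.Finite ℤ A] [Module.Free ℤ A'] [Module.Finite ℤ A']
    [Module.Free ℤ B] [Module.Finite ℤ B] (f : A →ₗ[ℤ] B) (φ : A' ≃ₗ[ℤ] A) :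
    latticeDet (f ∘ₗ φ.toLinearMap) = latticeDet f := by
  have hr : Module.finrank ℤ A' = Module.finrank ℤ A := φ.finrank_eq
  unfold latticeDet
  by_cases h : Module.finrank ℤ A = Module.finrank ℤ B
  · rw [dif_pos h, dif_pos (hr.trans h),
      LinearMap.toMatrix_comp _ (Module.finBasisOfFinrankEq ℤ A h), Matrix.det_mul,
      Int.natAbs_mul]
    have hu := LinearEquiv.isUnit_det φ (Module.finBasisOfFinrankEq ℤ A' (hr.trans h))
      (Module.finBasisOfFinrankEq ℤ A h)
    rw [Int.isUnit_iff_natAbs_eq.mp hu, mul_one]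
  · rw [dif_neg h, dif_neg (fun h' => h (hr.symm.trans h'))]

theorem one_tmul_injective {N : Type*} [AddCommGroup N] [Module.Free ℤ N] {x y : N}
    (h : (1 : ℝ) ⊗ₜ[ℤ] x = (1 : ℝ) ⊗ₜ[ℤ] y) : x = y := by
  have hinj := Module.Flat.rTensor_preserves_injective_linearMap (M := N)
    (Algebra.linearMap ℤ ℝ) (by intro a b hab; simpa using hab)
  have h2 : (1 : ℤ) ⊗ₜ[ℤ] x = (1 : ℤ) ⊗ₜ[ℤ] y := hinj (by simpa using h)
  simpa using congrArg (TensorProduct.lid ℤ N) h2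

end Lattices

section Curves

variable {E N : Type*} [Fintype E] [AddCommGroup N]

/-- A parametrized rational tropical curve of degree `n` in `N_ℝ = ℝ ⊗ N`. The map `h` from the
metric graph to `N_ℝ` is affine on the edges, hence it is given by the positions of the vertices:
on the bounded edge between `v` and `w` it moves from `h v` to `h w` with its slope in `N`, and on
the unbounded end `e` it is `t ↦ h (endVertex e) + t • n e`. -/
structure Curve (n : E → N) extends ParamType n where
  /-- the lengths of the bounded edges -/
  length : graph.edgeSet → ℝ
  length_pos : ∀ b, 0 < length b
  /-- the images of the vertices -/
  pos : Fin numVertices → ℝ ⊗[ℤ] N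
  pos_sub_pos : ∀ d : graph.Dart,
    pos d.snd - pos d.fst = length (toRationalGraph.edgeOf d) • ((1 : ℝ) ⊗ₜ[ℤ] slope d)

/-- An isomorphism of parametrized tropical curves: an isometry, respecting the labels of the
unbounded ends and commuting with the maps to `N_ℝ`. -/
structure CurveIso {n : E → N} (Γ Γ' : Curve n) where
  /-- the underlying isomorphism of graphs -/
  toIso : Γ.graph ≃g Γ'.graph
  map_endVertex : ∀ e, toIso (Γ.endVertex e) = Γ'.endVertex e
  map_length : ∀ b, Γ'.length (toIso.mapEdgeSet b) = Γ.length b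
  map_pos : ∀ v, Γ'.pos (toIso v) = Γ.pos v

namespace CurveIso

variable {n : E → N} {Γ Γ' Γ'' : Curve n}

/-- The identity isomorphism. -/
def refl (Γ : Curve n) : CurveIso Γ Γ where
  toIso := SimpleGraph.Iso.refl
  map_endVertex _ := rfl
  map_length b := by
    congr 1
    exact Subtype.ext (congrFun Sym2.map_id b.1)
  map_pos _ := rfl

/-- The inverse isomorphism. -/
def symm (φ : CurveIso Γ Γ') : CurveIso Γ' Γ where
  toIso := φ.toIso.symm
  map_endVertex e := by rw [← φ.map_endVertex e]; exact φ.toIso.symm_apply_apply _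
  map_length b := by
    rw [← φ.map_length]
    congr 1
    exact φ.toIso.mapEdgeSet.apply_symm_apply b
  map_pos v := by
    rw [← φ.map_pos]
    congr 1
    exact φ.toIso.apply_symm_apply v

/-- The composition of two isomorphisms. -/
def trans (φ : CurveIso Γ Γ') (ψ : CurveIso Γ' Γ'') : CurveIso Γ Γ'' where
  toIso := φ.toIso.trans ψ.toIso
  map_endVertex e := by rw [← ψ.map_endVertex, ← φ.map_endVertex]; rfl
  map_length b := by
    rw [← φ.map_length, ← ψ.map_length]
    congr 1
    apply Subtype.ext
    exact (Sym2.map_map (g := ψ.toIso) (f := φ.toIso) b.1).symm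
  map_pos v := by rw [← φ.map_pos, ← ψ.map_pos]; rfl

end CurveIso

/-- Two parametrized tropical curves are identified when they are isomorphic. -/
instance curveSetoid (n : E → N) : Setoid (Curve n) where
  r Γ Γ' := Nonempty (CurveIso Γ Γ')
  iseqv := ⟨fun Γ => ⟨CurveIso.refl Γ⟩, fun ⟨φ⟩ => ⟨φ.symm⟩, fun ⟨φ⟩ ⟨ψ⟩ => ⟨φ.trans ψ⟩⟩

/-- The moduli space `M₀(Δ, N_ℝ)` of parametrized rational tropical curves of degree `n`. -/
abbrev Moduli (n : E → N) : Type _ := Quotient (curveSetoid n)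

end Curves

section Constraints

variable {E N : Type*} [Fintype E] [AddCommGroup N]

/-- A choice of a full sublattice `L e` of `N / ⟨n e⟩` (the quotient is without torsion) for every
unbounded end `e`. -/
structure Slopes (n : E → N) where
  /-- the sublattices -/
  L : ∀ e, Submodule ℤ (N ⧸ Submodule.span ℤ {n e})
  isTorsionFree : ∀ e, Module.IsTorsionFree ℤ ((N ⧸ Submodule.span ℤ {n e}) ⧸ L e)

namespace Slopes

variable {n : E → N} (𝒮 : Slopes n)

/-- The lattice `Q e`, the quotient of `N / ⟨n e⟩` by `L e`. -/
abbrev Q (e : E) : Type _ := (N ⧸ Submodule.span ℤ {n e}) ⧸ 𝒮.L e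

instance (e : E) : Module.IsTorsionFree ℤ (𝒮.Q e) := 𝒮.isTorsionFree e

/-- The corank of `L e` in `N / ⟨n e⟩`. -/
noncomputable def corank (e : E) : ℕ := Module.finrank ℤ (𝒮.Q e)

/-- The real vector space spanned by `L e` in `(N / ⟨n e⟩)_ℝ`. -/
noncomputable def realL (e : E) : Submodule ℝ (ℝ ⊗[ℤ] (N ⧸ Submodule.span ℤ {n e})) :=
  LinearMap.range ((𝒮.L e).subtype.baseChange ℝ)

end Slopes

/-- A family of affine constraints: an affine subspace of `(N / ⟨n e⟩)_ℝ` for every unbounded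
end `e`. -/
abbrev Constraints (n : E → N) : Type _ :=
  ∀ e, AffineSubspace ℝ (ℝ ⊗[ℤ] (N ⧸ Submodule.span ℤ {n e}))

/-- The (non-empty) affine subspaces have the given slopes. -/
def Constraints.HasSlopes {n : E → N} (𝓛 : Constraints n) (𝒮 : Slopes n) : Prop :=
  ∀ e, (𝓛 e : Set (ℝ ⊗[ℤ] (N ⧸ Submodule.span ℤ {n e}))).Nonempty ∧ (𝓛 e).direction = 𝒮.realL e

/-- The affine constraints with the given slopes through the points `p e`. -/
noncomputable def Slopes.through {n : E → N} (𝒮 : Slopes n)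
    (p : ∀ e, ℝ ⊗[ℤ] (N ⧸ Submodule.span ℤ {n e})) : Constraints n :=
  fun e => AffineSubspace.mk' (p e) (𝒮.realL e)

/-- The evaluation map at the unbounded end `e`: the image in `(N / ⟨n e⟩)_ℝ` of (any point of) the
unbounded end. -/
noncomputable def Curve.ev {n : E → N} (Γ : Curve n) (e : E) :
    ℝ ⊗[ℤ] (N ⧸ Submodule.span ℤ {n e}) :=
  (Submodule.span ℤ {n e}).mkQ.baseChange ℝ (Γ.pos (Γ.endVertex e))

/-- The curve is a solution: every unbounded end satisfies its constraint. -/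
def Curve.Solves {n : E → N} (Γ : Curve n) (𝓛 : Constraints n) : Prop := ∀ e, Γ.ev e ∈ 𝓛 e

/-- The solutions, as points of the moduli space. -/
def solutions {n : E → N} (𝓛 : Constraints n) : Set (Moduli n) :=
  {x | ∃ Γ : Curve n, ⟦Γ⟧ = x ∧ Γ.Solves 𝓛}

end Constraints

section Multiplicity

variable {E N : Type*} [Fintype E] [AddCommGroup N]

/-- The lattice of the cone of a combinatorial type. The linear span of the cone consists of the
pairs `(ℓ, h)` of (not necessarily positive) lengths of the bounded edges and positions of the
vertices satisfying `h w - h v = ℓ(vw) • slope(vw)`; its lattice consists of the pairs with integral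
lengths and with positions in `N`. By `(ℓ, h) ↦ (ℓ, h v₀)`, for any vertex `v₀`, it is identified
with `ℤ^{bounded edges} × N`. -/
def ParamType.coneLattice {n : E → N} (C : ParamType n) :
    Submodule ℤ ((C.graph.edgeSet → ℤ) × (Fin C.numVertices → N)) where
  carrier := {x | ∀ d : C.graph.Dart, x.2 d.snd - x.2 d.fst = x.1 (C.edgeOf d) • C.slope d}
  add_mem' {x y} hx hy d := by
    have h1 := hx d
    have h2 := hy d
    simp only [Prod.snd_add, Prod.fst_add, Pi.add_apply, add_smul, ← h1, ← h2]
    abel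
  zero_mem' d := by simp
  smul_mem' c x hx d := by
    have h1 := hx d
    simp only [Prod.smul_snd, Prod.smul_fst, Pi.smul_apply, ← smul_sub, h1, smul_assoc]

/-- The composed evaluation map on the cone of a combinatorial type, as a homomorphism of
lattices. -/
def ParamType.ev {n : E → N} (C : ParamType n) (𝒮 : Slopes n) :
    C.coneLattice →ₗ[ℤ] (∀ e, 𝒮.Q e) :=
  LinearMap.pi fun e =>
    (𝒮.L e).mkQ ∘ₗ (Submodule.span ℤ {n e}).mkQ ∘ₗ LinearMap.proj (C.endVertex e) ∘ₗ
      LinearMap.snd ℤ (C.graph.edgeSet → ℤ) (Fin C.numVertices → N) ∘ₗ C.coneLattice.subtype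

variable [Module.Free ℤ N]

namespace CurveIso

variable {n : E → N} {Γ Γ' : Curve n}

theorem map_slope (φ : CurveIso Γ Γ') (d : Γ.graph.Dart) :
    Γ'.slope (φ.toIso.toHom.mapDart d) = Γ.slope d := by
  have h1 := Γ.pos_sub_pos d
  have h2 := Γ'.pos_sub_pos (φ.toIso.toHom.mapDart d)
  have h3 : Γ'.length (Γ'.edgeOf (φ.toIso.toHom.mapDart d)) = Γ.length (Γ.edgeOf d) := by
    rw [← φ.map_length]
    rfl
  have h4 : Γ'.pos (φ.toIso.toHom.mapDart d).snd = Γ.pos d.snd := φ.map_pos _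
  have h5 : Γ'.pos (φ.toIso.toHom.mapDart d).fst = Γ.pos d.fst := φ.map_pos _
  rw [h3, h4, h5, h1] at h2
  exact (one_tmul_injective (smul_right_injective _ (Γ.length_pos _).ne' h2)).symm

/-- The homomorphism between the lattices of the cones induced by an isomorphism of curves. -/
def pull (φ : CurveIso Γ Γ') :
    Γ'.toParamType.coneLattice →ₗ[ℤ] Γ.toParamType.coneLattice where
  toFun x := ⟨(fun b => x.1.1 (φ.toIso.mapEdgeSet b), fun v => x.1.2 (φ.toIso v)), fun d => by
    have h := x.2 (φ.toIso.toHom.mapDart d)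
    rw [φ.map_slope d] at h
    exact h⟩
  map_add' _ _ := rfl
  map_smul' _ _ := rfl

/-- The isomorphism between the lattices of the cones induced by an isomorphism of curves. -/
def pullEquiv (φ : CurveIso Γ Γ') :
    Γ'.toParamType.coneLattice ≃ₗ[ℤ] Γ.toParamType.coneLattice where
  toLinearMap := φ.pull
  invFun := φ.symm.pull
  left_inv x := Subtype.ext (Prod.ext
    (funext fun b => congrArg x.1.1 (φ.toIso.mapEdgeSet.apply_symm_apply b))
    (funext fun v => congrArg x.1.2 (φ.toIso.apply_symm_apply v)))
  right_inv x := Subtype.ext (Prod.ext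
    (funext fun b => congrArg x.1.1 (φ.toIso.mapEdgeSet.symm_apply_apply b))
    (funext fun v => congrArg x.1.2 (φ.toIso.symm_apply_apply v)))

end CurveIso

variable [Module.Finite ℤ N]

/-- The complex multiplicity: the absolute value of the determinant of the composed evaluation map
on the cone of the combinatorial type, in bases of the two lattices. -/
noncomputable def ParamType.mult {n : E → N} (C : ParamType n) (𝒮 : Slopes n) : ℕ :=
  latticeDet (C.ev 𝒮)

theorem CurveIso.mult_eq {n : E → N} {Γ Γ' : Curve n} (φ : CurveIso Γ Γ') (𝒮 : Slopes n) :
    Γ.toParamType.mult 𝒮 = Γ'.toParamType.mult 𝒮 := by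
  unfold ParamType.mult
  rw [← latticeDet_comp_equiv (Γ.toParamType.ev 𝒮) φ.pullEquiv]
  congr 1
  refine LinearMap.ext fun x => funext fun e => ?_
  have h : x.1.2 (φ.toIso (Γ.endVertex e)) = x.1.2 (Γ'.endVertex e) := by
    rw [φ.map_endVertex]
  exact congrArg (fun y => (𝒮.L e).mkQ ((Submodule.span ℤ {n e}).mkQ y)) h

/-- The complex multiplicity of a point of the moduli space. -/
noncomputable def Moduli.mult {n : E → N} (𝒮 : Slopes n) (x : Moduli n) : ℕ :=
  Quotient.lift (fun Γ : Curve n => Γ.toParamType.mult 𝒮)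
    (fun _ _ h => Nonempty.elim h fun φ => φ.mult_eq 𝒮) x

/-- The constraints are generic: they are neither in the image of a cone of the moduli space that is
not top-dimensional (whose curves are not trivalent), nor in the image of a cone on which the
composed evaluation map is not injective. (Linear maps of lattices are injective if and only if
their real extensions are.) -/
def Constraints.IsGeneric {n : E → N} (𝓛 : Constraints n) (𝒮 : Slopes n) : Prop :=
  ∀ Γ : Curve n, Γ.Solves 𝓛 → Γ.IsTrivalent ∧ Function.Injective (Γ.toParamType.ev 𝒮)

/-- The count of the solutions with their complex multiplicities. -/
noncomputable def count {n : E → N} (𝒮 : Slopes n) (𝓛 : Constraints n) : ℕ :=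
  ∑ᶠ x ∈ solutions 𝓛, Moduli.mult 𝒮 x

end Multiplicity

end TropicalCount

open TropicalCount

/-!
The proof identifies the moduli space of parametrized rational tropical curves with a fan of
laminar families, and the count with the degree of a linear map on this balanced fan.

Fix an end `e₀` and root every tree at the vertex of `e₀`. A bounded edge then has a *cluster*: the
set `A` of the ends beyond the edge. The clusters of a tree form a laminar family (any two are nested
or disjoint), and conversely every laminar family of proper subsets of `E \ {e₀}` with at least two
elements is the family of clusters of exactly one tree (`Rooting.isLaminar_clusters`,
`IsLaminar.exists_tree`). By the balancing condition the slope of an edge with cluster `A` is the sum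
of the `n e` with `e ∈ A`. So a curve is the same as a laminar family with positive lengths and a
position of the root (`EncodedBy`, `EncodedBy.nonempty_iso`, `EncodedBy.eq_of_iso`,
`IsLaminar.exists_curve`), and its evaluations are the image of the root position plus
`∑ ℓ A • w A`, where `w A` has the component `∑ e ∈ A, n e` at the ends in `A` and `0` at the others
(`EncodedBy.reduce_ev`). A curve is trivalent if and only if its family has `|E| - 3` members, the
maximal number, and its multiplicity is then, up to sign, the determinant of the matrix with the columns `w A`
and the images of a basis of `N` (`ParamType.mult_eq_weight`).

There are finitely many laminar families, and a family whose cone has a span different from the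
whole evaluation space gives a proper subspace; outside of these finitely many subspaces constraints
are generic (`isGeneric_through`). For generic constraints each family carries at most one solution,
as its columns are independent; so there are finitely many solutions (`finite_solutions`).

For the invariance, pass to the quotient of the evaluation space by the image of the translations.
The count is the number of cones through a generic point, weighted by determinants
(`count_eq_degreeAt`). After a small change of one of two generic points, the line through them
crosses the cones of codimension one transversally and avoids those of higher codimension. The count
is locally constant off the walls, and at a wall `τ` it does not jump provided that the vectors
`w A`, over all clusters `A` by
which `τ` can be enlarged, sum to an element of the span of `τ` (`eventually_degreeAt_wall`,
`degreeAt_eq`). This balancing condition holds (`IsLaminar.balancing`): the tree of `τ` has one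
four-valent vertex, with branches `b₁`, `b₂`, `b₃` away from the root, the possible `A` are the
unions of two of them (`IsLaminar.exists_three_resolutions`), and
`w (b₂ ∪ b₃) + w (b₁ ∪ b₃) + w (b₁ ∪ b₂) = w (b₁ ∪ b₂ ∪ b₃) + w b₁ + w b₂ + w b₃`.
A branch that is a single end `e` contributes `0`, since `n e` vanishes in `Q e`; and if
`b₁ ∪ b₂ ∪ b₃` consists of all ends but `e₀`, its vector is the effect of the translation by
`- n e₀`.
-/

namespace TropicalCount

/-! ### Degrees of balanced weighted fans under a linear map -/

section Fan

open Filter Topology Module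

variable {K X : Type*} [AddCommGroup X] [Module ℝ X]

/-- The point `x` lies in the relative interior of the cone spanned by the vectors `u A`, `A ∈ F`
(in the image of the open orthant, without asking the vectors to be independent). -/
def OpenCone (u : K → X) (F : Finset K) (x : X) : Prop :=
  ∃ c : K → ℝ, (∀ A ∈ F, 0 < c A) ∧ ∑ A ∈ F, c A • u A = x

/-- The vectors `u A`, `A ∈ F`, form a basis. -/
def IsBase (u : K → X) (F : Finset K) : Prop :=
  LinearIndepOn ℝ u (F : Set K) ∧ F.card = finrank ℝ X

/-- The point `x` only lies on cones that are spanned by a basis. -/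
def FanGeneric (u : K → X) (𝒯 : Finset (Finset K)) (x : X) : Prop :=
  ∀ F ∈ 𝒯, OpenCone u F x → IsBase u F

open Classical in
/-- The number of full-dimensional cones of the fan `𝒯` that contain `x`, with the weights `d`. -/
noncomputable def degreeAt (u : K → X) (𝒯 : Finset (Finset K)) (d : Finset K → ℝ) (x : X) : ℝ :=
  ∑ F ∈ 𝒯 with IsBase u F, if OpenCone u F x then d F else 0

theorem coeff_eq_of_linearIndepOn {u : K → X} {F : Finset K}
    (h : LinearIndepOn ℝ u (F : Set K)) {c c' : K → ℝ}
    (hc : ∑ A ∈ F, c A • u A = ∑ A ∈ F, c' A • u A) : ∀ A ∈ F, c A = c' A := by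
  intro A hA
  rw [linearIndepOn_finset_iff] at h
  have := h (fun A => c A - c' A) (by
    simp only [sub_smul, Finset.sum_sub_distrib, hc, sub_self]) A hA
  linarith

theorem IsBase.exists_coord [FiniteDimensional ℝ X] {u : K → X} {F : Finset K}
    (h : IsBase u F) : ∃ κ : X →ₗ[ℝ] (K → ℝ), ∀ x, ∑ A ∈ F, κ x A • u A = x := by
  classical
  obtain ⟨hli, hcard⟩ := h
  have hspan : ⊤ ≤ Submodule.span ℝ (Set.range fun A : F => u A) := by
    rw [LinearIndependent.span_eq_top_of_card_eq_finrank' (b := fun A : F => u A) hli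
      (by simpa using hcard)]
  let b := Basis.mk (v := fun A : F => u A) hli hspan
  refine ⟨LinearMap.pi fun A => if hA : A ∈ F then b.coord ⟨A, hA⟩ else 0, fun x => ?_⟩
  conv_rhs => rw [← b.sum_repr x]
  rw [← Finset.sum_coe_sort F]
  refine Finset.sum_congr rfl fun A _ => ?_
  have hb : b A = u A := Basis.mk_apply hli hspan A
  rw [hb]
  simp [b]

theorem IsBase.openCone_iff {u : K → X} {F : Finset K} (h : IsBase u F)
    {κ : X →ₗ[ℝ] (K → ℝ)} (hκ : ∀ x, ∑ A ∈ F, κ x A • u A = x) (x : X) :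
    OpenCone u F x ↔ ∀ A ∈ F, 0 < κ x A := by
  constructor
  · rintro ⟨c, hc, hx⟩ A hA
    rw [coeff_eq_of_linearIndepOn h.1 ((hκ x).trans hx.symm) A hA]
    exact hc A hA
  · exact fun hx => ⟨κ x, hx, hκ x⟩

/-- A non-negative combination lies in the relative interior of the face spanned by the vectors
with positive coefficients. -/
theorem openCone_filter_pos {u : K → X} {F : Finset K} {x : X} {c : K → ℝ}
    (hc : ∀ A ∈ F, 0 ≤ c A) (hx : ∑ A ∈ F, c A • u A = x) :
    OpenCone u (F.filter fun A => 0 < c A) x := by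
  refine ⟨c, fun A hA => (Finset.mem_filter.1 hA).2, ?_⟩
  rw [← hx, Finset.sum_filter]
  refine Finset.sum_congr rfl fun A hA => ?_
  split_ifs with h
  · rfl
  · rw [le_antisymm (not_lt.1 h) (hc A hA), zero_smul]

theorem eventually_pos_add_mul_nhds (a b : ℝ) (ha : a ≠ 0) :
    ∀ᶠ s in 𝓝 (0 : ℝ), (0 < a + s * b ↔ 0 < a) := by
  have hcont : Tendsto (fun s : ℝ => a + s * b) (𝓝 0) (𝓝 a) := by
    have : Continuous fun s : ℝ => a + s * b := by fun_prop
    simpa using this.tendsto 0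
  rcases ha.lt_or_gt with h | h
  · filter_upwards [hcont.eventually_lt_const h] with s hs
    exact ⟨fun h' => absurd h' hs.not_gt, fun h' => absurd h' h.not_gt⟩
  · filter_upwards [hcont.eventually_const_lt h] with s hs
    exact ⟨fun _ => h, fun _ => hs⟩

theorem eventually_pos_add_mul_nhdsGT (a b : ℝ) :
    ∀ᶠ s in 𝓝[>] (0 : ℝ), (0 < a + s * b ↔ 0 < a ∨ (a = 0 ∧ 0 < b)) := by
  rcases eq_or_ne a 0 with rfl | ha
  · filter_upwards [self_mem_nhdsWithin] with s hs
    simp [mul_pos_iff_of_pos_left (Set.mem_Ioi.1 hs)]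
  · filter_upwards [nhdsWithin_le_nhds (eventually_pos_add_mul_nhds a b ha)] with s hs
    simp [hs, ha]

/-- A function on the line that is constant on a punctured neighbourhood of every point takes the
same value at any two points near which it is constant. -/
theorem eq_of_eventually_const {f : ℝ → ℝ} (hf : ∀ t, ∃ c, ∀ᶠ s in 𝓝[≠] t, f s = c) {a b : ℝ}
    (ha : ∀ᶠ s in 𝓝 a, f s = f a) (hb : ∀ᶠ s in 𝓝 b, f s = f b) : f a = f b := by
  choose c hc using hf
  have hloc : IsLocallyConstant c := by
    rw [IsLocallyConstant.iff_eventually_eq]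
    intro t
    have h := eventually_eventually_nhds.2 (eventually_nhdsWithin_iff.1 (hc t))
    filter_upwards [h] with s hs
    by_cases hst : s = t
    · rw [hst]
    · have h1 : ∀ᶠ r in 𝓝 s, f r = c t := by
        filter_upwards [hs, isOpen_compl_singleton.mem_nhds hst] with r hr hrt using hr hrt
      obtain ⟨r, h5, h6⟩ := ((h1.filter_mono nhdsWithin_le_nhds).and (hc s)).exists
      exact h6.symm.trans h5
  have hval : ∀ t, (∀ᶠ s in 𝓝 t, f s = f t) → f t = c t := by
    intro t ht
    obtain ⟨r, h5, h6⟩ := ((ht.filter_mono nhdsWithin_le_nhds).and (hc t)).exists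
    exact h5.symm.trans h6
  rw [hval a ha, hval b hb]
  exact hloc.apply_eq_of_isPreconnected isPreconnected_univ (Set.mem_univ a) (Set.mem_univ b)

theorem OpenCone.mem_span {u : K → X} {F : Finset K} {x : X} (h : OpenCone u F x) :
    x ∈ Submodule.span ℝ (u '' F) := by
  obtain ⟨c, -, rfl⟩ := h
  exact Submodule.sum_mem _ fun A hA => Submodule.smul_mem _ _ (Submodule.subset_span ⟨A, hA, rfl⟩)

theorem finrank_span_image_le (u : K → X) (F : Finset K) :
    finrank ℝ (Submodule.span ℝ (u '' F)) ≤ F.card := by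
  classical
  rw [← Finset.coe_image]
  exact (finrank_span_finset_le_card _).trans Finset.card_image_le

theorem isBase_of_span_eq_top {u : K → X} {F : Finset K} (hc : F.card ≤ finrank ℝ X)
    (hs : Submodule.span ℝ (u '' F) = ⊤) : IsBase u F := by
  classical
  have hr : Set.range (fun A : F => u A) = u '' F := by
    ext; simp
  have hle : finrank ℝ X ≤ F.card := by
    rw [← finrank_top ℝ X, ← hs, ← hr]
    exact (finrank_range_le_card (R := ℝ) (fun A : F => u A)).trans_eq (Fintype.card_coe F)
  have hcard := le_antisymm hc hle
  refine ⟨?_, hcard⟩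
  exact linearIndependent_of_top_le_span_of_card_eq_finrank (b := fun A : F => u A)
    (by rw [hr, hs]) (by simpa using hcard)

variable [FiniteDimensional ℝ X]

/-- The weighted count is constant near a generic point, along every line. -/
theorem FanGeneric.eventually_degreeAt_eq {u : K → X} {𝒯 : Finset (Finset K)}
    (hdown : ∀ F ∈ 𝒯, ∀ τ ⊆ F, τ ∈ 𝒯) (d : Finset K → ℝ) {x : X} (hx : FanGeneric u 𝒯 x)
    (v : X) : ∀ᶠ s in 𝓝 (0 : ℝ), degreeAt u 𝒯 d (x + s • v) = degreeAt u 𝒯 d x := by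
  classical
  have key : ∀ F ∈ 𝒯.filter (IsBase u ·),
      ∀ᶠ s in 𝓝 (0 : ℝ), (OpenCone u F (x + s • v) ↔ OpenCone u F x) := by
    intro F hF
    obtain ⟨hF𝒯, hF⟩ := Finset.mem_filter.1 hF
    obtain ⟨κ, hκ⟩ := hF.exists_coord
    simp only [hF.openCone_iff hκ, map_add, map_smul, Pi.add_apply, Pi.smul_apply, smul_eq_mul]
    by_cases hz : ∀ A ∈ F, κ x A ≠ 0
    · have := (Finset.eventually_all F).2 fun A hA =>
        eventually_pos_add_mul_nhds (κ x A) (κ v A) (hz A hA)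
      filter_upwards [this] with s hs
      exact forall₂_congr hs
    · push Not at hz
      obtain ⟨A₀, hA₀, hz⟩ := hz
      -- a vanishing coordinate forces a negative one, as `x` avoids the smaller faces
      have hneg : ∃ A ∈ F, κ x A < 0 := by
        by_contra! hnn
        have hoc := openCone_filter_pos hnn (hκ x)
        have hb := hx _ (hdown F hF𝒯 _ (Finset.filter_subset _ _)) hoc
        have heq := Finset.eq_of_subset_of_card_le (Finset.filter_subset (fun A => 0 < κ x A) F)
          (hF.2.trans hb.2.symm).le
        rw [← heq] at hA₀
        exact (Finset.mem_filter.1 hA₀).2.ne' hz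
      obtain ⟨A, hA, hneg⟩ := hneg
      filter_upwards [eventually_pos_add_mul_nhds (κ x A) (κ v A) hneg.ne] with s hs
      exact ⟨fun h => absurd (hs.1 (h A hA)) hneg.not_gt, fun h => absurd (h A hA) hneg.not_gt⟩
  filter_upwards [(Finset.eventually_all _).2 key] with s hs
  exact Finset.sum_congr rfl fun F hF => by simp only [hs F hF]

/-- Wall crossing: near a point of a line that meets walls only transversally and avoids the cones
of higher codimension, the weighted count is the same on the two sides.

Only the basis cones `F = insert A τ` with a wall `τ` through `x` matter. With the linear form `φ`
of `τ`, the coordinate of `v` at `A` is `φ v / φ (u A)`, so that its sign tells on which side of `x`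
the line lies in the cone of `F`. As the weight of `F` is `|φ (u A)|`, the difference of the two
sides is the sum of the `± φ (u A)` with a common sign, which vanishes by the balancing condition
`∑ φ (u A) = 0`. -/
theorem eventually_degreeAt_wall [DecidableEq K] [Fintype K] {u : K → X} {𝒯 : Finset (Finset K)}
    (hdown : ∀ F ∈ 𝒯, ∀ τ ⊆ F, τ ∈ 𝒯) {d : Finset K → ℝ}
    (hbal : ∀ τ ∈ 𝒯, τ.card + 1 = finrank ℝ X → ∃ φ : X →ₗ[ℝ] ℝ, (∀ B ∈ τ, φ (u B) = 0) ∧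
      (∀ A ∉ τ, insert A τ ∈ 𝒯 → |φ (u A)| = d (insert A τ)) ∧
      ∑ A with A ∉ τ ∧ insert A τ ∈ 𝒯, φ (u A) = 0)
    {x v : X} (hx : ∀ τ ∈ 𝒯, LinearIndepOn ℝ u (τ : Set K) → τ.card < finrank ℝ X →
      OpenCone u τ x → τ.card + 1 = finrank ℝ X ∧ v ∉ Submodule.span ℝ (u '' τ)) :
    ∃ c, ∀ᶠ s in 𝓝[≠] (0 : ℝ), degreeAt u 𝒯 d (x + s • v) = c := by
  classical
  choose! κ hκ using fun F (hF : IsBase u F) => hF.exists_coord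
  choose! φ hφ0 hφd hφs using hbal
  -- the germs of the line on the two sides that lie in a cone
  let P : ℝ → Finset K → Prop := fun σ F =>
    ∀ A ∈ F, 0 < κ F x A ∨ (κ F x A = 0 ∧ 0 < σ * κ F v A)
  let f : ℝ → ℝ := fun σ => ∑ F ∈ 𝒯 with IsBase u F, if P σ F then d F else 0
  have hside : ∀ σ : ℝ, ∀ᶠ s in 𝓝[>] (0 : ℝ),
      degreeAt u 𝒯 d (x + s • σ • v) = f σ := by
    intro σ
    have key : ∀ F ∈ 𝒯.filter (IsBase u ·),
        ∀ᶠ s in 𝓝[>] (0 : ℝ), (OpenCone u F (x + s • σ • v) ↔ P σ F) := by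
      intro F hF
      obtain ⟨hF𝒯, hF⟩ := Finset.mem_filter.1 hF
      simp only [hF.openCone_iff (hκ F hF), map_add, map_smul, Pi.add_apply, Pi.smul_apply,
        smul_eq_mul, P]
      have := (Finset.eventually_all F).2 fun A hA =>
        eventually_pos_add_mul_nhdsGT (κ F x A) (σ * κ F v A)
      filter_upwards [this] with s hs
      exact forall₂_congr hs
    filter_upwards [(Finset.eventually_all _).2 key] with s hs
    exact Finset.sum_congr rfl fun F hF => by simp only [hs F hF]
  -- the cones of codimension one through `x`, and the contribution of `insert A τ` to the jump
  let Wall : Finset K → Prop := fun τ => LinearIndepOn ℝ u (τ : Set K) ∧ OpenCone u τ x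
  let g : Finset K → K → ℝ := fun τ A =>
    if Wall τ then (SignType.sign (φ τ v) : ℝ) * φ τ (u A) else 0
  have hlocal : ∀ F ∈ 𝒯, IsBase u F →
      ((if P 1 F then d F else 0) - (if P (-1) F then d F else 0)) =
        ∑ A ∈ F, g (F.erase A) A := by
    intro F hF𝒯 hF
    -- a basis cone has at most one face that is a wall, opposite to its only zero coordinate
    have hcoef : ∀ A ∈ F, Wall (F.erase A) → κ F x A = 0 ∧ ∀ B ∈ F, B ≠ A → 0 < κ F x B := by
      rintro A hA ⟨-, c, hc, hcx⟩
      have hE : ∑ B ∈ F, κ F x B • u B = ∑ B ∈ F, (if B = A then 0 else c B) • u B := by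
        rw [hκ F hF, ← hcx, ← Finset.add_sum_erase F _ hA]
        simp only [if_true, zero_smul, zero_add]
        exact Finset.sum_congr rfl fun B hB => by rw [if_neg (Finset.ne_of_mem_erase hB)]
      have := coeff_eq_of_linearIndepOn hF.1 hE
      refine ⟨by simpa using this A hA, fun B hB hBA => ?_⟩
      rw [this B hB, if_neg hBA]
      exact hc B (Finset.mem_erase.2 ⟨hBA, hB⟩)
    by_cases hw : ∃ A ∈ F, Wall (F.erase A)
    · obtain ⟨A, hA, hAw⟩ := hw
      obtain ⟨hA0, hpos⟩ := hcoef A hA hAw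
      have hτ𝒯 := hdown F hF𝒯 _ (Finset.erase_subset A F)
      have hcard : (F.erase A).card + 1 = finrank ℝ X := by
        rw [Finset.card_erase_add_one hA, hF.2]
      have hvn := (hx _ hτ𝒯 hAw.1 (by omega) hAw.2).2
      have hP : ∀ σ, P σ F ↔ 0 < σ * κ F v A := by
        refine fun σ => ⟨fun h => ?_, fun h B hB => ?_⟩
        · rcases h A hA with h | h
          · exact absurd hA0 h.ne'
          · exact h.2
        · by_cases hBA : B = A
          · subst hBA
            exact Or.inr ⟨hA0, h⟩
          · exact Or.inl (hpos B hB hBA)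
      rw [Finset.sum_eq_single_of_mem A hA]
      swap
      · intro B hB hBA
        refine if_neg fun h => ?_
        exact (hpos B hB hBA).ne' (hcoef B hB h).1
      have hφv : φ (F.erase A) v = κ F v A * φ (F.erase A) (u A) := by
        conv_lhs => rw [← hκ F hF v, ← Finset.add_sum_erase F _ hA]
        rw [map_add, map_sum, map_smul, smul_eq_mul, Finset.sum_eq_zero, add_zero]
        intro B hB
        rw [map_smul, hφ0 _ hτ𝒯 hcard B hB, smul_zero]
      have hd : |φ (F.erase A) (u A)| = d F := by
        have := hφd _ hτ𝒯 hcard A (Finset.notMem_erase A F)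
        rw [Finset.insert_erase hA] at this
        exact this hF𝒯
      have hb : κ F v A ≠ 0 := by
        intro hb
        apply hvn
        rw [← hκ F hF v, ← Finset.add_sum_erase F _ hA, hb, zero_smul, zero_add]
        exact Submodule.sum_mem _ fun B hB => Submodule.smul_mem _ _
          (Submodule.subset_span ⟨B, hB, rfl⟩)
      simp only [g, hP]
      rw [if_pos hAw, hφv, sign_mul, SignType.coe_mul, mul_assoc, sign_mul_self, hd]
      rcases hb.lt_or_gt with h | h
      · simp [h, h.not_gt]
      · simp [h, h.not_gt]
    · push Not at hw
      rw [Finset.sum_eq_zero fun A hA => if_neg (hw A hA)]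
      -- without a wall among the faces, a cone met on one side contains `x` in its interior
      have hP : ∀ σ, P σ F → ∀ A ∈ F, 0 < κ F x A := by
        intro σ h
        by_contra! hcon
        obtain ⟨A, hA, hle⟩ := hcon
        have hnn : ∀ A ∈ F, 0 ≤ κ F x A := fun B hB => by
          rcases h B hB with h | h
          · exact h.le
          · exact h.1.ge
        have hoc := openCone_filter_pos hnn (hκ F hF x)
        set τ := F.filter fun A => 0 < κ F x A with hτ
        have hτF : τ ⊆ F := Finset.filter_subset _ _
        have hli : LinearIndepOn ℝ u (τ : Set K) := hF.1.mono (by exact_mod_cast hτF)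
        have hτA : τ ⊆ F.erase A := fun B hB => Finset.mem_erase.2
          ⟨fun hBA => hle.not_gt (hBA ▸ (Finset.mem_filter.1 hB).2), hτF hB⟩
        have hle' := Finset.card_le_card hτA
        have hcardA := Finset.card_erase_add_one hA
        have hFc := hF.2
        have := (hx τ (hdown F hF𝒯 τ hτF) hli (by omega) hoc).1
        have heq : τ = F.erase A := Finset.eq_of_subset_of_card_le hτA (by omega)
        exact hw A hA (heq ▸ ⟨hli, hoc⟩)
      have hP' : P 1 F ↔ P (-1) F :=
        ⟨fun h A hA => Or.inl (hP _ h A hA), fun h A hA => Or.inl (hP _ h A hA)⟩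
      simp only [hP', sub_self]
  have hzero : f 1 - f (-1) = 0 := by
    have h1 : f 1 - f (-1) = ∑ F ∈ 𝒯 with F.card = finrank ℝ X, ∑ A ∈ F, g (F.erase A) A := by
      simp only [f, ← Finset.sum_sub_distrib]
      rw [Finset.sum_filter, Finset.sum_filter]
      refine Finset.sum_congr rfl fun F hF => ?_
      by_cases hb : IsBase u F
      · rw [if_pos hb, if_pos hb.2, hlocal F hF hb]
      · rw [if_neg hb]
        split_ifs with hc
        · refine (Finset.sum_eq_zero fun A hA => ?_).symm
          by_cases hw : Wall (F.erase A)
          · -- if `F` is not a basis, then `u A` is in the span of the wall, where `φ` vanishes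
            have hmem : u A ∈ Submodule.span ℝ (u '' ((F.erase A : Finset K) : Set K)) := by
              by_contra hmem
              have := hw.1.insert hmem
              rw [← Finset.coe_insert, Finset.insert_erase hA] at this
              exact hb ⟨this, hc⟩
            have hle : Submodule.span ℝ (u '' ((F.erase A : Finset K) : Set K)) ≤
                LinearMap.ker (φ (F.erase A)) := by
              rw [Submodule.span_le]
              rintro _ ⟨B, hB, rfl⟩
              exact hφ0 _ (hdown F hF _ (Finset.erase_subset A F))
                (by rw [Finset.card_erase_add_one hA, hc]) B hB
            have h0 : φ (F.erase A) (u A) = 0 := hle hmem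
            simp only [g, h0, mul_zero, ite_self]
          · exact if_neg hw
        · rfl
    -- collect the pairs `A ∈ F` by the face `τ = F.erase A`
    have h2 : ∑ F ∈ 𝒯 with F.card = finrank ℝ X, ∑ A ∈ F, g (F.erase A) A =
        ∑ τ ∈ 𝒯 with τ.card + 1 = finrank ℝ X, ∑ A with A ∉ τ ∧ insert A τ ∈ 𝒯, g τ A := by
      rw [Finset.sum_sigma', Finset.sum_sigma']
      refine Finset.sum_bij' (fun a _ => ⟨a.1.erase a.2, a.2⟩) (fun a _ => ⟨insert a.2 a.1, a.2⟩)
        ?_ ?_ ?_ ?_ ?_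
      · rintro ⟨F, A⟩ h
        simp only [Finset.mem_sigma, Finset.mem_filter, Finset.mem_univ, true_and] at h ⊢
        refine ⟨⟨hdown F h.1.1 _ (Finset.erase_subset A F), ?_⟩, Finset.notMem_erase A F, ?_⟩
        · rw [Finset.card_erase_add_one h.2, h.1.2]
        · rw [Finset.insert_erase h.2]
          exact h.1.1
      · rintro ⟨τ, A⟩ h
        simp only [Finset.mem_sigma, Finset.mem_filter, Finset.mem_univ, true_and] at h ⊢
        exact ⟨⟨h.2.2, by rw [Finset.card_insert_of_notMem h.2.1, h.1.2]⟩,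
          Finset.mem_insert_self _ _⟩
      · rintro ⟨F, A⟩ h
        simp only [Finset.mem_sigma, Finset.mem_filter] at h
        simp [Finset.insert_erase h.2]
      · rintro ⟨τ, A⟩ h
        simp only [Finset.mem_sigma, Finset.mem_filter, Finset.mem_univ, true_and] at h
        simp [Finset.erase_insert h.2.1]
      · rintro ⟨F, A⟩ h
        rfl
    rw [h1, h2]
    refine Finset.sum_eq_zero fun τ hτ => ?_
    obtain ⟨hτ, hc⟩ := Finset.mem_filter.1 hτ
    by_cases hw : Wall τ
    · simp only [g, if_pos hw, ← Finset.mul_sum, hφs τ hτ hc, mul_zero]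
    · simp only [g, if_neg hw, Finset.sum_const_zero]
  refine ⟨f 1, ?_⟩
  rw [← nhdsLT_sup_nhdsGT, eventually_sup]
  constructor
  · have hneg : Tendsto (fun s : ℝ => -s) (𝓝[<] 0) (𝓝[>] 0) := by
      simpa using tendsto_neg_nhdsLT (a := (0 : ℝ))
    filter_upwards [hneg.eventually (hside (-1))] with s hs
    rw [sub_eq_zero.1 hzero, ← hs, neg_one_smul, smul_neg, neg_smul, neg_neg]
  · filter_upwards [hside 1] with s hs
    rw [← hs, one_smul]

/-- The weighted number of cones through a generic point of a balanced fan does not depend on the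
point. The point `y` is moved to a nearby point `y'` such that the segment from `x` to `y'` meets
the cones of codimension one transversally and avoids those of higher codimension. -/
theorem degreeAt_eq [DecidableEq K] [Fintype K] {u : K → X} {𝒯 : Finset (Finset K)}
    (hdown : ∀ F ∈ 𝒯, ∀ τ ⊆ F, τ ∈ 𝒯) (hcard : ∀ F ∈ 𝒯, F.card ≤ finrank ℝ X)
    {d : Finset K → ℝ}
    (hbal : ∀ τ ∈ 𝒯, τ.card + 1 = finrank ℝ X → ∃ φ : X →ₗ[ℝ] ℝ, (∀ B ∈ τ, φ (u B) = 0) ∧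
      (∀ A ∉ τ, insert A τ ∈ 𝒯 → |φ (u A)| = d (insert A τ)) ∧
      ∑ A with A ∉ τ ∧ insert A τ ∈ 𝒯, φ (u A) = 0)
    {x y : X} (hx : FanGeneric u 𝒯 x) (hy : FanGeneric u 𝒯 y) :
    degreeAt u 𝒯 d x = degreeAt u 𝒯 d y := by
  classical
  let S₀ : Finset K → Submodule ℝ X := fun τ => Submodule.span ℝ (u '' τ)
  let S₁ : Finset K → Submodule ℝ X := fun τ => S₀ τ ⊔ Submodule.span ℝ {x}
  let bad : Finset (Submodule ℝ X) := (𝒯.image S₀ ∪ 𝒯.image S₁).filter (· ≠ ⊤)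
  have hne : ⋃ W ∈ bad, (W : Set X) ≠ Set.univ :=
    Subspace.biUnion_ne_univ_of_top_notMem (by simp [bad])
  obtain ⟨z, hz⟩ := (Set.ne_univ_iff_exists_notMem _).1 hne
  simp only [Set.mem_iUnion, SetLike.mem_coe, not_exists] at hz
  have havoid : ∀ W ∈ bad, ∀ᶠ s in 𝓝[≠] (0 : ℝ), y + s • z ∉ W := by
    intro W hW
    -- two points of the line in `W` would force `z ∈ W`
    by_cases h : ∃ s₀ : ℝ, s₀ ≠ 0 ∧ y + s₀ • z ∈ W
    · obtain ⟨s₀, h0, hs₀⟩ := h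
      filter_upwards [nhdsWithin_le_nhds (isOpen_compl_singleton.mem_nhds h0.symm)] with s hs hmem
      have hdiff : (s - s₀) • z ∈ W := by
        have := W.sub_mem hmem hs₀
        rwa [add_sub_add_left_eq_sub, ← sub_smul] at this
      exact hz W hW ((W.smul_mem_iff (sub_ne_zero.2 hs)).1 hdiff)
    · push Not at h
      filter_upwards [self_mem_nhdsWithin] with s hs using h s hs
  obtain ⟨s, hs, hys⟩ := (((Finset.eventually_all bad).2 havoid).and
    ((hy.eventually_degreeAt_eq hdown d z).filter_mono nhdsWithin_le_nhds)).exists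
  rw [← hys]
  set y' := y + s • z
  have htop : ∀ W ∈ 𝒯.image S₀ ∪ 𝒯.image S₁, y' ∈ W → W = ⊤ := by
    intro W hW hmem
    by_contra hW'
    exact hs W (Finset.mem_filter.2 ⟨hW, hW'⟩) hmem
  have htop₀ : ∀ τ ∈ 𝒯, y' ∈ S₀ τ → S₀ τ = ⊤ := fun τ hτ =>
    htop _ (Finset.mem_union_left _ (Finset.mem_image_of_mem _ hτ))
  have htop₁ : ∀ τ ∈ 𝒯, y' ∈ S₁ τ → S₁ τ = ⊤ := fun τ hτ =>
    htop _ (Finset.mem_union_right _ (Finset.mem_image_of_mem _ hτ))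
  have hy' : FanGeneric u 𝒯 y' := fun F hF hoc =>
    isBase_of_span_eq_top (hcard F hF) (htop₀ F hF hoc.mem_span)
  have key := eq_of_eventually_const (f := fun t => degreeAt u 𝒯 d (x + t • (y' - x)))
    (a := 0) (b := 1) ?_ ?_ ?_
  · simpa using key
  · intro t
    have hwall := eventually_degreeAt_wall (x := x + t • (y' - x)) (v := y' - x) hdown hbal ?_
    · obtain ⟨c, hc⟩ := hwall
      refine ⟨c, ?_⟩
      have hsub : Tendsto (fun r : ℝ => r - t) (𝓝[≠] t) (𝓝[≠] 0) := by
        refine tendsto_nhdsWithin_iff.2 ⟨?_, ?_⟩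
        · have : Continuous fun r : ℝ => r - t := by fun_prop
          exact (by simpa using this.tendsto t : Tendsto (fun r : ℝ => r - t) (𝓝 t) (𝓝 0)).mono_left
            nhdsWithin_le_nhds
        · filter_upwards [self_mem_nhdsWithin] with r hr using sub_ne_zero.2 hr
      filter_upwards [hsub.eventually hc] with r hr
      rw [← hr, add_assoc, ← add_smul, add_sub_cancel]
    · intro τ hτ hli hlt hoc
      have hmem := hoc.mem_span
      by_cases ht : t = 0
      · subst ht
        rw [zero_smul, add_zero] at hoc
        exact absurd (hx τ hτ hoc).2 hlt.ne
      have h0 : S₀ τ ≠ ⊤ := by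
        intro h
        have := finrank_span_image_le u τ
        rw [show Submodule.span ℝ (u '' τ) = ⊤ from h, finrank_top] at this
        omega
      constructor
      · have hmem' : y' ∈ S₁ τ := by
          rw [← Submodule.smul_mem_iff _ ht]
          have : t • y' = (x + t • (y' - x)) + (t - 1) • x := by module
          rw [this]
          exact Submodule.add_mem_sup hmem
            (Submodule.smul_mem _ _ (Submodule.mem_span_singleton_self x))
        have h1 : finrank ℝ (S₁ τ) ≤ τ.card + 1 :=
          (Submodule.finrank_add_le_finrank_add_finrank _ _).trans
            (add_le_add (finrank_span_image_le u τ) (finrank_span_le_card {x} |>.trans (by simp)))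
        rw [htop₁ τ hτ hmem', finrank_top] at h1
        omega
      · intro hv
        apply h0
        apply htop₀ τ hτ
        have : y' = (x + t • (y' - x)) + (1 - t) • (y' - x) := by module
        rw [this]
        exact Submodule.add_mem _ hmem (Submodule.smul_mem _ _ hv)
  · have h := hx.eventually_degreeAt_eq hdown d (y' - x)
    simpa using h
  · have h := hy'.eventually_degreeAt_eq hdown d (y' - x)
    have hsub : Tendsto (fun r : ℝ => r - 1) (𝓝 1) (𝓝 0) := by
      have : Continuous fun r : ℝ => r - 1 := by fun_prop
      simpa using this.tendsto 1
    filter_upwards [hsub.eventually h] with r hr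
    have h1 : x + r • (y' - x) = y' + (r - 1) • (y' - x) := by module
    rw [h1, hr, one_smul, add_sub_cancel]

end Fan

/-! ### Rooted trees -/

section Rooted

variable {V : Type*} {G : SimpleGraph V} {ρ : V} {p : V → V} {δ : V → ℕ}

/-- The graph `G` is a tree with root `ρ`, in which `p` maps every vertex other than the root to its
parent, and `δ` is the depth (only its growth matters). -/
structure Rooting (G : SimpleGraph V) (ρ : V) (p : V → V) (δ : V → ℕ) : Prop where
  root : p ρ = ρ
  adj_iff : ∀ v w, G.Adj v w ↔ (v ≠ ρ ∧ p v = w) ∨ (w ≠ ρ ∧ p w = v)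
  depth : ∀ v, v ≠ ρ → δ (p v) < δ v

/-- The vertex `v` lies on the path from `w` to the root. -/
def Ancestor (p : V → V) (v w : V) : Prop := ∃ i, p^[i] w = v

theorem Ancestor.refl (p : V → V) (v : V) : Ancestor p v v := ⟨0, rfl⟩

theorem Ancestor.trans {u v w : V} (h : Ancestor p u v) (h' : Ancestor p v w) :
    Ancestor p u w := by
  obtain ⟨i, rfl⟩ := h
  obtain ⟨j, rfl⟩ := h'
  exact ⟨i + j, Function.iterate_add_apply p i j w⟩

theorem Ancestor.parent (p : V → V) (v : V) : Ancestor p (p v) v := ⟨1, rfl⟩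

theorem Ancestor.comparable {u v w : V} (h : Ancestor p u w) (h' : Ancestor p v w) :
    Ancestor p u v ∨ Ancestor p v u := by
  obtain ⟨i, rfl⟩ := h
  obtain ⟨j, rfl⟩ := h'
  rcases le_total i j with hij | hij
  · right
    exact ⟨j - i, by rw [← Function.iterate_add_apply, Nat.sub_add_cancel hij]⟩
  · left
    exact ⟨i - j, by rw [← Function.iterate_add_apply, Nat.sub_add_cancel hij]⟩

theorem Ancestor.eq_or_parent {v w : V} (h : Ancestor p v w) : v = w ∨ Ancestor p v (p w) := by
  obtain ⟨i, rfl⟩ := h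
  cases i with
  | zero => exact Or.inl rfl
  | succ i => exact Or.inr ⟨i, rfl⟩

namespace Rooting

variable (R : Rooting G ρ p δ)
include R

theorem induction_down {P : V → Prop} (h0 : P ρ) (hs : ∀ v, v ≠ ρ → P (p v) → P v) (v : V) :
    P v := by
  induction hk : δ v using Nat.strong_induction_on generalizing v with
  | _ k ih =>
    by_cases hv : v = ρ
    · exact hv ▸ h0
    · exact hs v hv (ih _ (hk ▸ R.depth v hv) _ rfl)

theorem induction_up [Finite V] {P : V → Prop}
    (h : ∀ v, (∀ w, w ≠ ρ → p w = v → P w) → P v) (v : V) : P v := by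
  obtain ⟨D, hD⟩ := (Set.finite_range δ).bddAbove
  induction hk : D - δ v using Nat.strong_induction_on generalizing v with
  | _ k ih =>
    refine h v fun w hw hwv => ih _ ?_ w rfl
    have h1 : δ w ≤ D := hD ⟨w, rfl⟩
    have h2 := R.depth w hw
    rw [hwv] at h2
    omega

theorem depth_le (v : V) : δ (p v) ≤ δ v := by
  by_cases hv : v = ρ
  · rw [hv, R.root]
  · exact (R.depth v hv).le

theorem _root_.TropicalCount.Ancestor.depth_le {v w : V} (h : Ancestor p v w) : δ v ≤ δ w := by
  obtain ⟨i, rfl⟩ := h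
  induction i with
  | zero => rfl
  | succ i ih =>
    rw [Function.iterate_succ_apply']
    exact (R.depth_le _).trans ih

theorem ne_root {v w : V} (h : Ancestor p v w) (hne : v ≠ w) : w ≠ ρ := by
  rintro rfl
  obtain ⟨i, rfl⟩ := h
  exact hne (Function.iterate_fixed R.root i)

theorem parent_ne {v : V} (hv : v ≠ ρ) : p v ≠ v := fun h => by
  have := R.depth v hv
  rw [h] at this
  exact lt_irrefl _ this

theorem depth_lt {v w : V} (h : Ancestor p v w) (hne : v ≠ w) : δ v < δ w :=
  lt_of_le_of_lt (Ancestor.depth_le R (h.eq_or_parent.resolve_left hne))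
    (R.depth w (R.ne_root h hne))

theorem antisymm {v w : V} (h : Ancestor p v w) (h' : Ancestor p w v) : v = w := by
  by_contra hne
  exact (R.depth_lt h hne).not_ge (Ancestor.depth_le R h')

theorem root_ancestor (v : V) : Ancestor p ρ v := by
  induction v using R.induction_down with
  | h0 => exact Ancestor.refl p ρ
  | hs v hv ih => exact ih.trans (Ancestor.parent p v)

theorem exists_child {v w : V} (h : Ancestor p v w) (hne : v ≠ w) :
    ∃ c, c ≠ ρ ∧ p c = v ∧ Ancestor p c w := by
  induction w using R.induction_down with
  | h0 => exact absurd rfl (R.ne_root h hne)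
  | hs w hw ih =>
    by_cases hvw : v = p w
    · exact ⟨w, hw, hvw.symm, Ancestor.refl p w⟩
    · obtain ⟨c, h1, h2, h3⟩ := ih (h.eq_or_parent.resolve_left hne) hvw
      exact ⟨c, h1, h2, h3.trans (Ancestor.parent p w)⟩

theorem adj_parent {v : V} (hv : v ≠ ρ) : G.Adj v (p v) := (R.adj_iff _ _).2 (Or.inl ⟨hv, rfl⟩)

/-- The parents only depend on the tree and the root. -/
theorem parent_unique {p' : V → V} {δ' : V → ℕ} (R' : Rooting G ρ p' δ') (v : V) : p v = p' v := by
  induction v using R.induction_down with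
  | h0 => rw [R.root, R'.root]
  | hs v hv ih =>
    rcases (R'.adj_iff _ _).1 (R.adj_parent hv) with ⟨-, h⟩ | ⟨hne, h⟩
    · exact h.symm
    · rw [← ih] at h
      have h1 := R.depth _ hne
      have h2 := R.depth _ hv
      rw [h] at h1
      omega

theorem edge_bijective : Function.Bijective
    (fun v : {v // v ≠ ρ} => (⟨s(v.1, p v.1), R.adj_parent v.2⟩ : G.edgeSet)) := by
  constructor
  · rintro ⟨v, hv⟩ ⟨w, hw⟩ h
    rcases Sym2.eq_iff.1 (congrArg Subtype.val h) with ⟨h, -⟩ | ⟨h1, h2⟩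
    · exact Subtype.ext h
    · have h3 := R.depth v hv
      have h4 := R.depth w hw
      rw [h2] at h3
      rw [← h1] at h4
      exact absurd h3 h4.not_gt
  · rintro ⟨e, he⟩
    induction e using Sym2.ind with
    | _ v w =>
      rcases (R.adj_iff v w).1 he with ⟨h1, rfl⟩ | ⟨h1, rfl⟩
      · exact ⟨⟨v, h1⟩, rfl⟩
      · exact ⟨⟨w, h1⟩, Subtype.ext Sym2.eq_swap⟩

theorem card_edgeSet [Finite V] : Nat.card G.edgeSet + 1 = Nat.card V := by
  classical
  rw [← Nat.card_congr (Equiv.ofBijective _ R.edge_bijective)]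
  have := Fintype.ofFinite V
  rw [Nat.card_eq_fintype_card, Nat.card_eq_fintype_card, Fintype.card_subtype_compl,
    Fintype.card_subtype_eq]
  have : 0 < Fintype.card V := Fintype.card_pos_iff.2 ⟨ρ⟩
  omega

theorem isTree [Finite V] : G.IsTree := by
  rw [SimpleGraph.isTree_iff_connected_and_card]
  refine ⟨?_, R.card_edgeSet⟩
  have hr : ∀ v, G.Reachable v ρ := fun v => by
    induction v using R.induction_down with
    | h0 => exact SimpleGraph.Reachable.refl _
    | hs v hv ih => exact (R.adj_parent hv).reachable.trans ih
  exact { preconnected := fun v w => (hr v).trans (hr w).symm, nonempty := ⟨ρ⟩ }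

end Rooting

/-- Every finite tree can be rooted at any vertex. A vertex other than the root has a neighbour
closer to the root; as a tree has one edge less than vertices, all edges arise in this way. -/
theorem exists_rooting [Finite V] (hG : G.IsTree) (ρ : V) : ∃ p δ, Rooting G ρ p δ := by
  classical
  have := Fintype.ofFinite V
  have hp : ∀ v, ∃ w, (v = ρ → w = ρ) ∧ (v ≠ ρ → G.Adj v w ∧ G.dist ρ w < G.dist ρ v) := by
    intro v
    by_cases hv : v = ρ
    · exact ⟨ρ, fun _ => rfl, fun h => absurd hv h⟩
    · obtain ⟨q, hq⟩ := hG.1.exists_walk_length_eq_dist v ρ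
      cases q with
      | nil => exact absurd rfl hv
      | cons h q =>
        rename_i w
        refine ⟨w, fun h => absurd h hv, fun _ => ⟨h, ?_⟩⟩
        rw [G.dist_comm, G.dist_comm (u := ρ), ← hq, SimpleGraph.Walk.length_cons]
        exact Nat.lt_succ_of_le (SimpleGraph.dist_le q)
  choose p hp0 hp1 using hp
  refine ⟨p, G.dist ρ, hp0 ρ rfl, fun v w => ⟨fun h => ?_, ?_⟩, fun v hv => (hp1 v hv).2⟩
  · let f : {v // v ≠ ρ} → G.edgeSet := fun v => ⟨s(v.1, p v.1), (hp1 v.1 v.2).1⟩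
    have hinj : Function.Injective f := by
      rintro ⟨v, hv⟩ ⟨w, hw⟩ h
      rcases Sym2.eq_iff.1 (congrArg Subtype.val h) with ⟨h, -⟩ | ⟨h1, h2⟩
      · exact Subtype.ext h
      · have h3 := (hp1 v hv).2
        have h4 := (hp1 w hw).2
        rw [h2] at h3
        rw [← h1] at h4
        exact absurd h3 h4.not_gt
    have hbij : Function.Bijective f := by
      rw [Fintype.bijective_iff_injective_and_card]
      refine ⟨hinj, ?_⟩
      have h1 := hG.card_edgeFinset
      rw [← SimpleGraph.edgeFinset_card, Fintype.card_subtype_compl, Fintype.card_subtype_eq]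
      omega
    obtain ⟨⟨x, hx⟩, hxe⟩ := hbij.2 ⟨s(v, w), h⟩
    rcases Sym2.eq_iff.1 (congrArg Subtype.val hxe) with ⟨rfl, h'⟩ | ⟨rfl, h'⟩
    · exact Or.inl ⟨hx, h'⟩
    · exact Or.inr ⟨hx, h'⟩
  · rintro (⟨hv, rfl⟩ | ⟨hw, rfl⟩)
    · exact (hp1 v hv).1
    · exact (hp1 w hw).1.symm

end Rooted

/-! ### Clusters of a rooted tree with labelled ends -/

section Cluster

set_option linter.unusedSectionVars false

variable {V E : Type*} [Fintype V] [Fintype E] [DecidableEq V] [DecidableEq E]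
  {G : SimpleGraph V} {ρ : V} {p : V → V} {δ : V → ℕ} {ε : E → V} {e₀ : E}

open Classical in
/-- The cluster of a vertex: the ends, other than the end `e₀` at the root, that lie beyond the
vertex when seen from the root. -/
noncomputable def cluster (p : V → V) (ε : E → V) (e₀ : E) (v : V) : Finset E :=
  Finset.univ.filter fun e => e ≠ e₀ ∧ Ancestor p v (ε e)

/-- The children of a vertex. -/
def children (ρ : V) (p : V → V) (v : V) : Finset V :=
  Finset.univ.filter fun w => w ≠ ρ ∧ p w = v

/-- The ends, other than the end `e₀` at the root, that are attached to a vertex. -/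
def directEnds (ε : E → V) (e₀ : E) (v : V) : Finset E :=
  Finset.univ.filter fun e => e ≠ e₀ ∧ ε e = v

@[simp] theorem mem_cluster {v : V} {e : E} :
    e ∈ cluster p ε e₀ v ↔ e ≠ e₀ ∧ Ancestor p v (ε e) := by
  simp [cluster]

@[simp] theorem mem_children {v w : V} : w ∈ children ρ p v ↔ w ≠ ρ ∧ p w = v := by
  simp [children]

@[simp] theorem mem_directEnds {v : V} {e : E} :
    e ∈ directEnds ε e₀ v ↔ e ≠ e₀ ∧ ε e = v := by
  simp [directEnds]

namespace Rooting

variable (R : Rooting G ρ p δ)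
include R

theorem disjoint_of_children {v w w' : V} (hw : w ∈ children ρ p v) (hw' : w' ∈ children ρ p v)
    (hne : w ≠ w') : Disjoint (cluster p ε e₀ w) (cluster p ε e₀ w') := by
  have key : ∀ w w', w ∈ children ρ p v → w' ∈ children ρ p v → w ≠ w' →
      ¬ Ancestor p w w' := by
    intro w w' hw hw' hne h
    have h1 := Ancestor.depth_le R (h.eq_or_parent.resolve_left hne)
    have h2 := R.depth w (mem_children.1 hw).1
    rw [(mem_children.1 hw').2, ← (mem_children.1 hw).2] at h1
    omega
  rw [Finset.disjoint_left]
  intro e he he'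
  rcases (mem_cluster.1 he).2.comparable (mem_cluster.1 he').2 with h | h
  · exact key w w' hw hw' hne h
  · exact key w' w hw' hw hne.symm h

theorem disjoint_directEnds {v w : V} (hw : w ∈ children ρ p v) :
    Disjoint (directEnds ε e₀ v) (cluster p ε e₀ w) := by
  rw [Finset.disjoint_left]
  intro e he he'
  have h1 := Ancestor.depth_le R (mem_cluster.1 he').2
  have h2 := R.depth w (mem_children.1 hw).1
  rw [(mem_directEnds.1 he).2] at h1
  rw [(mem_children.1 hw).2] at h2
  omega

theorem cluster_eq (v : V) : cluster p ε e₀ v =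
    directEnds ε e₀ v ∪ (children ρ p v).biUnion (cluster p ε e₀) := by
  ext e
  simp only [mem_cluster, Finset.mem_union, mem_directEnds, Finset.mem_biUnion, mem_children]
  constructor
  · rintro ⟨he, h⟩
    by_cases hv : v = ε e
    · exact Or.inl ⟨he, hv.symm⟩
    · obtain ⟨c, h1, h2, h3⟩ := R.exists_child h hv
      exact Or.inr ⟨c, ⟨h1, h2⟩, he, h3⟩
  · rintro (⟨he, h⟩ | ⟨c, ⟨hc, rfl⟩, he, h⟩)
    · exact ⟨he, h ▸ Ancestor.refl p _⟩
    · exact ⟨he, (Ancestor.parent p c).trans h⟩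

theorem sum_cluster {M : Type*} [AddCommMonoid M] (f : E → M) (v : V) :
    ∑ e ∈ cluster p ε e₀ v, f e =
      ∑ e ∈ directEnds ε e₀ v, f e + ∑ w ∈ children ρ p v, ∑ e ∈ cluster p ε e₀ w, f e := by
  rw [R.cluster_eq, Finset.sum_union, Finset.sum_biUnion]
  · exact fun w hw w' hw' hne => R.disjoint_of_children hw hw' hne
  · rw [Finset.disjoint_biUnion_right]
    exact fun w hw => R.disjoint_directEnds hw

theorem card_cluster (v : V) : (cluster p ε e₀ v).card =
    (directEnds ε e₀ v).card + ∑ w ∈ children ρ p v, (cluster p ε e₀ w).card := by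
  simp only [Finset.card_eq_sum_ones]
  exact R.sum_cluster _ v

/-- A vertex has one adjacent edge or end in the direction of the end `e₀`. -/
theorem valency_eq (hε : ε e₀ = ρ) (v : V) :
    (G.neighborSet v).ncard + {e | ε e = v}.ncard =
      (children ρ p v).card + (directEnds ε e₀ v).card + 1 := by
  by_cases hv : v = ρ
  · have h1 : G.neighborSet v = children ρ p v := by
      ext w
      simp [R.adj_iff, hv]
    have h2 : {e | ε e = v} = insert e₀ (directEnds ε e₀ v : Set E) := by
      ext e
      by_cases he : e = e₀ <;> simp [he, hε, hv]
    rw [h1, h2, Set.ncard_coe_finset, Set.ncard_insert_of_notMem (by simp),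
      Set.ncard_coe_finset]
    ring
  · have h1 : G.neighborSet v = insert (p v) (children ρ p v : Set V) := by
      ext w
      simp [R.adj_iff, hv, eq_comm]
    have h2 : {e | ε e = v} = (directEnds ε e₀ v : Set E) := by
      ext e
      by_cases he : e = e₀
      · simp [he, hε, Ne.symm hv]
      · simp [he]
    rw [h1, h2, Set.ncard_coe_finset, Set.ncard_insert_of_notMem, Set.ncard_coe_finset]
    · ring
    · simp only [Finset.mem_coe, mem_children, not_and]
      intro hp hpp
      have h3 := R.depth v hv
      have h4 := R.depth _ hp
      rw [hpp] at h4
      omega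

/-- Every vertex other than the root is a child once, and every end other than `e₀` is attached
once. -/
theorem sum_branches :
    ∑ v, ((children ρ p v).card + (directEnds ε e₀ v).card) + 2 =
      Fintype.card V + Fintype.card E := by
  have h1 : ∑ v, (children ρ p v).card = (Finset.univ.erase ρ).card := by
    rw [Finset.card_eq_sum_card_fiberwise (f := p) (t := Finset.univ) (by simp)]
    refine Finset.sum_congr rfl fun v _ => congrArg _ ?_
    ext w
    simp
  have h2 : ∑ v, (directEnds ε e₀ v).card = (Finset.univ.erase e₀).card := by
    rw [Finset.card_eq_sum_card_fiberwise (f := ε) (t := Finset.univ) (by simp)]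
    refine Finset.sum_congr rfl fun v _ => congrArg _ ?_
    ext w
    simp
  rw [Finset.sum_add_distrib, h1, h2, Finset.card_erase_of_mem (Finset.mem_univ _),
    Finset.card_erase_of_mem (Finset.mem_univ _), Finset.card_univ, Finset.card_univ]
  have h3 : 0 < Fintype.card V := Fintype.card_pos_iff.2 ⟨ρ⟩
  have h4 : 0 < Fintype.card E := Fintype.card_pos_iff.2 ⟨e₀⟩
  omega

theorem cluster_root : cluster p ε e₀ ρ = Finset.univ.erase e₀ := by
  ext e
  simp [R.root_ancestor]

omit R in
theorem cluster_subset_of_ancestor {v w : V} (h : Ancestor p v w) :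
    cluster p ε e₀ w ⊆ cluster p ε e₀ v := by
  intro e he
  rw [mem_cluster] at he ⊢
  exact ⟨he.1, h.trans he.2⟩

variable (hval : ∀ v, 2 ≤ (children ρ p v).card + (directEnds ε e₀ v).card)
include hval

theorem two_le_card_cluster (v : V) : 2 ≤ (cluster p ε e₀ v).card := by
  induction v using R.induction_up with
  | h v ih =>
    rw [R.card_cluster]
    have h1 : (children ρ p v).card ≤ ∑ w ∈ children ρ p v, (cluster p ε e₀ w).card := by
      rw [Finset.card_eq_sum_ones]
      refine Finset.sum_le_sum fun w hw => ?_
      have := ih w (mem_children.1 hw).1 (mem_children.1 hw).2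
      omega
    have := hval v
    omega

theorem cluster_nonempty (v : V) : (cluster p ε e₀ v).Nonempty := by
  rw [← Finset.card_pos]
  have := R.two_le_card_cluster hval v
  omega

theorem card_cluster_lt_of_child {v w : V} (hw : w ∈ children ρ p v) :
    (cluster p ε e₀ w).card < (cluster p ε e₀ v).card := by
  rw [R.card_cluster v, ← Finset.add_sum_erase _ _ hw]
  have h1 : ((children ρ p v).erase w).card ≤
      ∑ w ∈ (children ρ p v).erase w, (cluster p ε e₀ w).card := by
    rw [Finset.card_eq_sum_ones]
    refine Finset.sum_le_sum fun w _ => ?_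
    have := R.two_le_card_cluster hval w
    omega
  have h2 := hval v
  have h3 := Finset.card_erase_add_one hw
  omega

theorem cluster_ssubset {v w : V} (h : Ancestor p v w) (hne : v ≠ w) :
    cluster p ε e₀ w ⊂ cluster p ε e₀ v := by
  refine (cluster_subset_of_ancestor h).ssubset_of_ne fun heq => ?_
  obtain ⟨c, h1, h2, h3⟩ := R.exists_child h hne
  have h4 := R.card_cluster_lt_of_child hval (mem_children.2 ⟨h1, h2⟩)
  have h5 := Finset.card_le_card (cluster_subset_of_ancestor (ε := ε) (e₀ := e₀) h3)
  rw [heq] at h5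
  omega

theorem ancestor_of_mem {v w : V} {e : E} (hv : e ∈ cluster p ε e₀ v)
    (hw : e ∈ cluster p ε e₀ w) : Ancestor p v w ∨ Ancestor p w v :=
  (mem_cluster.1 hv).2.comparable (mem_cluster.1 hw).2

theorem ancestor_iff_subset {v w : V} :
    Ancestor p v w ↔ cluster p ε e₀ w ⊆ cluster p ε e₀ v := by
  refine ⟨cluster_subset_of_ancestor, fun h => ?_⟩
  obtain ⟨e, he⟩ := R.cluster_nonempty hval w
  rcases R.ancestor_of_mem hval (h he) he with h1 | h1
  · exact h1
  · by_cases hne : w = v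
    · exact hne ▸ Ancestor.refl p w
    · exact absurd h (R.cluster_ssubset hval h1 hne).not_subset

theorem cluster_injective : Function.Injective (cluster p ε e₀) := fun _ _ h =>
  R.antisymm ((R.ancestor_iff_subset hval).2 h.ge) ((R.ancestor_iff_subset hval).2 h.le)

theorem cluster_laminar (v w : V) : cluster p ε e₀ v ⊆ cluster p ε e₀ w ∨
    cluster p ε e₀ w ⊆ cluster p ε e₀ v ∨ Disjoint (cluster p ε e₀ v) (cluster p ε e₀ w) := by
  by_cases h : Disjoint (cluster p ε e₀ v) (cluster p ε e₀ w)
  · exact Or.inr (Or.inr h)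
  · obtain ⟨e, he, he'⟩ := Finset.not_disjoint_iff.1 h
    rcases R.ancestor_of_mem hval he he' with h | h
    · exact Or.inr (Or.inl (cluster_subset_of_ancestor h))
    · exact Or.inl (cluster_subset_of_ancestor h)

end Rooting

/-- The clusters that occur as clusters of vertices other than the root. -/
def IsCluster (e₀ : E) (A : Finset E) : Prop := 2 ≤ A.card ∧ A ⊂ Finset.univ.erase e₀

/-- A laminar family of clusters: any two members are nested or disjoint. -/
def IsLaminar (e₀ : E) (F : Finset (Finset E)) : Prop :=
  (∀ A ∈ F, IsCluster e₀ A) ∧ ∀ A ∈ F, ∀ B ∈ F, A ⊆ B ∨ B ⊆ A ∨ Disjoint A B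

theorem IsLaminar.mono {F F' : Finset (Finset E)} (h : IsLaminar e₀ F) (hF : F' ⊆ F) :
    IsLaminar e₀ F' :=
  ⟨fun A hA => h.1 A (hF hA), fun A hA B hB => h.2 A (hF hA) B (hF hB)⟩

/-- The clusters of the vertices other than the root. They correspond to the bounded edges. -/
noncomputable def clusters (ρ : V) (p : V → V) (ε : E → V) (e₀ : E) : Finset (Finset E) :=
  (Finset.univ.erase ρ).image (cluster p ε e₀)

theorem mem_clusters {A : Finset E} :
    A ∈ clusters ρ p ε e₀ ↔ ∃ v, v ≠ ρ ∧ cluster p ε e₀ v = A := by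
  simp [clusters]

namespace Rooting

variable (R : Rooting G ρ p δ)
  (hval : ∀ v, 2 ≤ (children ρ p v).card + (directEnds ε e₀ v).card)
include R hval

theorem isLaminar_clusters : IsLaminar e₀ (clusters ρ p ε e₀) := by
  constructor
  · intro A hA
    obtain ⟨v, hv, rfl⟩ := mem_clusters.1 hA
    refine ⟨R.two_le_card_cluster hval v, ?_⟩
    rw [← R.cluster_root]
    exact R.cluster_ssubset hval (R.root_ancestor v) (Ne.symm hv)
  · intro A hA B hB
    obtain ⟨v, hv, rfl⟩ := mem_clusters.1 hA
    obtain ⟨w, hw, rfl⟩ := mem_clusters.1 hB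
    exact R.cluster_laminar hval v w

theorem card_clusters : (clusters ρ p ε e₀).card + 1 = Fintype.card V := by
  rw [clusters, Finset.card_image_of_injective _ (R.cluster_injective hval),
    Finset.card_erase_add_one (Finset.mem_univ _), Finset.card_univ]

theorem card_clusters_le : (clusters ρ p ε e₀).card + 3 ≤ Fintype.card E := by
  have h1 := R.card_clusters hval
  have h2 := R.sum_branches (ε := ε) (e₀ := e₀)
  have h3 : ∑ _v : V, 2 ≤ ∑ v, ((children ρ p v).card + (directEnds ε e₀ v).card) :=
    Finset.sum_le_sum fun v _ => hval v
  rw [Finset.sum_const, Finset.card_univ, smul_eq_mul] at h3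
  omega

theorem trivalent_iff : (∀ v, (children ρ p v).card + (directEnds ε e₀ v).card = 2) ↔
    (clusters ρ p ε e₀).card + 3 = Fintype.card E := by
  have h1 := R.card_clusters hval
  have h2 := R.sum_branches (ε := ε) (e₀ := e₀)
  have h3 := Finset.sum_eq_sum_iff_of_le (s := Finset.univ)
    (f := fun _ : V => 2) (fun v _ => hval v)
  rw [Finset.sum_const, Finset.card_univ, smul_eq_mul] at h3
  simp only [Finset.mem_univ, true_imp_iff] at h3
  constructor
  · intro h
    have := h3.2 fun v => (h v).symm
    omega
  · intro h v
    exact (h3.1 (by omega) v).symm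

end Rooting

end Cluster

/-! ### Sums over the edges of a rooted tree -/

section RootedSums

variable {V E M : Type*} {G : SimpleGraph V} {ρ : V} {p : V → V} {δ : V → ℕ} {ε : E → V} {e₀ : E}
  [AddCommGroup M]

namespace Rooting

/-- The edges correspond to the vertices other than the root: every such vertex is the lower end
point of the edge that joins it to its parent. -/
noncomputable def edgeEquiv (R : Rooting G ρ p δ) : {v // v ≠ ρ} ≃ G.edgeSet :=
  Equiv.ofBijective (fun v => ⟨s(v.1, p v.1), R.adj_parent v.2⟩) R.edge_bijective

/-- The oriented edge from the parent of a vertex to the vertex. -/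
def dart (R : Rooting G ρ p δ) (v : {v // v ≠ ρ}) : G.Dart :=
  ⟨(p v.1, v.1), (R.adj_parent v.2).symm⟩

variable (R : Rooting G ρ p δ)
include R

theorem dart_edge (v : {v // v ≠ ρ}) :
    (⟨(R.dart v).edge, (R.dart v).edge_mem⟩ : G.edgeSet) = R.edgeEquiv v :=
  Subtype.ext Sym2.eq_swap

theorem dart_or_symm (d : G.Dart) : ∃ v, d = R.dart v ∨ d = (R.dart v).symm := by
  rcases (R.adj_iff _ _).1 d.adj with ⟨h1, h2⟩ | ⟨h1, h2⟩
  · exact ⟨⟨d.fst, h1⟩, Or.inr (SimpleGraph.Dart.ext _ _ (Prod.ext rfl h2.symm))⟩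
  · exact ⟨⟨d.snd, h1⟩, Or.inl (SimpleGraph.Dart.ext _ _ (Prod.ext h2.symm rfl))⟩

theorem forall_dart {P : G.Dart → Prop} (h : ∀ v, P (R.dart v)) (hs : ∀ d, P d → P d.symm)
    (d : G.Dart) : P d := by
  obtain ⟨v, rfl | rfl⟩ := R.dart_or_symm d
  · exact h v
  · exact hs _ (h v)

variable [Fintype V] [DecidableEq V]

/-- The sum of an antisymmetric function over the oriented edges that start at a vertex. -/
theorem finsum_dart {f : G.Dart → M} (hf : ∀ d, f d.symm = - f d) {a : V → M}
    (ha : ∀ v, f (R.dart v) = a v.1) (v : V) :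
    ∑ᶠ d : {d : G.Dart // d.fst = v}, f d.1 =
      (∑ w ∈ children ρ p v, a w) - if v = ρ then 0 else a v := by
  classical
  let S : Finset V := Finset.univ.filter (G.Adj v)
  let e : {d : G.Dart // d.fst = v} ≃ {w // w ∈ S} :=
    { toFun := fun d => ⟨d.1.snd, by
        have := d.1.adj
        rw [d.2] at this
        simpa [S] using this⟩
      invFun := fun w => ⟨⟨(v, w.1), (Finset.mem_filter.1 w.2).2⟩, rfl⟩
      left_inv := by
        rintro ⟨⟨⟨x, y⟩, h⟩, rfl⟩
        rfl
      right_inv := fun w => rfl }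
  let g : V → M := fun w => if w ∈ children ρ p v then a w else - a v
  have h1 : ∑ᶠ d : {d : G.Dart // d.fst = v}, f d.1 = ∑ᶠ w : {w // w ∈ S}, g w.1 := by
    refine finsum_eq_of_bijective e e.bijective ?_
    rintro ⟨d, rfl⟩
    obtain ⟨v, rfl | rfl⟩ := R.dart_or_symm d
    · have : v.1 ∈ children ρ p (R.dart v).fst := mem_children.2 ⟨v.2, rfl⟩
      exact (ha v).trans (if_pos this).symm
    · have : p v.1 ∉ children ρ p v.1 := by
        rw [mem_children]
        rintro ⟨h2, h3⟩
        have h4 := R.depth v.1 v.2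
        have h5 := R.depth _ h2
        rw [h3] at h5
        exact h4.not_gt h5
      rw [hf, ha]
      exact (if_neg this).symm
  rw [h1, finsum_eq_sum_of_fintype, Finset.sum_coe_sort S g]
  have hsub : children ρ p v ⊆ S := by
    intro w hw
    obtain ⟨h1, h2⟩ := mem_children.1 hw
    simpa [S, R.adj_iff] using Or.inr ⟨h1, h2⟩
  rw [← Finset.sum_sdiff hsub, add_comm]
  have h2 : ∑ w ∈ children ρ p v, g w = ∑ w ∈ children ρ p v, a w :=
    Finset.sum_congr rfl fun w hw => if_pos hw
  have h3 : ∑ w ∈ S \ children ρ p v, g w = ∑ w ∈ S \ children ρ p v, - a v :=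
    Finset.sum_congr rfl fun w hw => if_neg (Finset.mem_sdiff.1 hw).2
  rw [h2, h3, sub_eq_add_neg]
  congr 1
  by_cases hv : v = ρ
  · have : S \ children ρ p v = ∅ := by
      ext w
      simp only [S, Finset.mem_sdiff, Finset.mem_filter, Finset.mem_univ, true_and, R.adj_iff,
        mem_children, Finset.notMem_empty, iff_false]
      tauto
    rw [this, if_pos hv, Finset.sum_empty, neg_zero]
  · have : S \ children ρ p v = {p v} := by
      ext w
      simp only [S, Finset.mem_sdiff, Finset.mem_filter, Finset.mem_univ, true_and, R.adj_iff,
        mem_children, Finset.mem_singleton]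
      constructor
      · tauto
      · rintro rfl
        refine ⟨Or.inl ⟨hv, rfl⟩, fun ⟨h2, h3⟩ => ?_⟩
        have h4 := R.depth v hv
        have h5 := R.depth _ h2
        rw [h3] at h5
        exact h4.not_gt h5
    rw [this, if_neg hv, Finset.sum_singleton]

variable [Fintype E] [DecidableEq E]

omit R in
theorem sum_ends (hε : ε e₀ = ρ) (f : E → M) (v : V) :
    ∑ e with ε e = v, f e = (∑ e ∈ directEnds ε e₀ v, f e) + if v = ρ then f e₀ else 0 := by
  by_cases hv : v = ρ
  · have : Finset.univ.filter (fun e => ε e = v) = insert e₀ (directEnds ε e₀ v) := by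
      ext e
      by_cases he : e = e₀ <;> simp [he, hε, hv]
    rw [this, Finset.sum_insert (by simp), if_pos hv, add_comm]
  · have : Finset.univ.filter (fun e => ε e = v) = directEnds ε e₀ v := by
      ext e
      by_cases he : e = e₀
      · simp [he, hε, Ne.symm hv]
      · simp [he]
    rw [this, if_neg hv, add_zero]

variable (hval : ∀ v, 2 ≤ (children ρ p v).card + (directEnds ε e₀ v).card)
include hval

theorem sum_filter_cluster (s : Finset E → M) {v : V} (hv : v ≠ ρ) :
    ∑ A ∈ clusters ρ p ε e₀ with cluster p ε e₀ v ⊆ A, s A =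
      (∑ A ∈ clusters ρ p ε e₀ with cluster p ε e₀ (p v) ⊆ A, s A) + s (cluster p ε e₀ v) := by
  have h1 : (clusters ρ p ε e₀).filter (cluster p ε e₀ v ⊆ ·) =
      insert (cluster p ε e₀ v) ((clusters ρ p ε e₀).filter (cluster p ε e₀ (p v) ⊆ ·)) := by
    ext A
    simp only [Finset.mem_filter, Finset.mem_insert]
    constructor
    · rintro ⟨hA, h⟩
      obtain ⟨w, hw, rfl⟩ := mem_clusters.1 hA
      rcases ((R.ancestor_iff_subset hval).2 h).eq_or_parent with rfl | h2
      · exact Or.inl rfl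
      · exact Or.inr ⟨hA, (R.ancestor_iff_subset hval).1 h2⟩
    · rintro (rfl | ⟨hA, h⟩)
      · exact ⟨mem_clusters.2 ⟨v, hv, rfl⟩, Finset.Subset.refl _⟩
      · exact ⟨hA, (cluster_subset_of_ancestor (Ancestor.parent p v)).trans h⟩
  rw [h1, Finset.sum_insert, add_comm]
  simp only [Finset.mem_filter, not_and]
  exact fun _ => (R.cluster_ssubset hval (Ancestor.parent p v) (R.parent_ne hv)).not_subset

theorem sum_filter_cluster_root (s : Finset E → M) :
    ∑ A ∈ clusters ρ p ε e₀ with cluster p ε e₀ ρ ⊆ A, s A = 0 := by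
  refine Finset.sum_eq_zero fun A hA => ?_
  obtain ⟨hA, h⟩ := Finset.mem_filter.1 hA
  rw [R.cluster_root] at h
  exact absurd h ((R.isLaminar_clusters hval).1 A hA).2.not_subset

/-- A function on the vertices is the sum of its increments along the edges. -/
theorem eq_add_sum {h : V → M} {s : Finset E → M}
    (hs : ∀ v, v ≠ ρ → h v = h (p v) + s (cluster p ε e₀ v)) (v : V) :
    h v = h ρ + ∑ A ∈ clusters ρ p ε e₀ with cluster p ε e₀ v ⊆ A, s A := by
  induction v using R.induction_down with
  | h0 => rw [R.sum_filter_cluster_root hval, add_zero]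
  | hs v hv ih => rw [hs v hv, ih, R.sum_filter_cluster hval s hv, add_assoc]

theorem sum_filter_end (hε : ε e₀ = ρ) (s : Finset E → M) (e : E) :
    ∑ A ∈ clusters ρ p ε e₀ with cluster p ε e₀ (ε e) ⊆ A, s A =
      ∑ A ∈ clusters ρ p ε e₀ with e ∈ A, s A := by
  by_cases he : e = e₀
  · rw [he, hε, R.sum_filter_cluster_root hval, Finset.sum_eq_zero]
    intro A hA
    obtain ⟨hA, h⟩ := Finset.mem_filter.1 hA
    obtain ⟨w, hw, rfl⟩ := mem_clusters.1 hA
    exact absurd rfl (mem_cluster.1 h).1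
  · congr 1
    refine Finset.filter_congr fun A hA => ?_
    obtain ⟨w, hw, rfl⟩ := mem_clusters.1 hA
    rw [← R.ancestor_iff_subset hval, mem_cluster]
    simp [he]

end Rooting

end RootedSums

/-! ### Curves in terms of laminar families -/

section Encoding

variable {E N : Type*} [Fintype E] [DecidableEq E] [AddCommGroup N] {n : E → N} {e₀ : E}

theorem RationalGraph.two_le_branches (Γ : RationalGraph E) {p : Fin Γ.numVertices → _} {δ}
    (R : Rooting Γ.graph (Γ.endVertex e₀) p δ) (v : Fin Γ.numVertices) :
    2 ≤ (children (Γ.endVertex e₀) p v).card + (directEnds Γ.endVertex e₀ v).card := by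
  have h1 := Γ.three_le_valency v
  rw [R.valency_eq rfl] at h1
  omega

theorem RationalGraph.isTrivalent_iff (Γ : RationalGraph E) {p : Fin Γ.numVertices → _} {δ}
    (R : Rooting Γ.graph (Γ.endVertex e₀) p δ) :
    Γ.IsTrivalent ↔ (clusters (Γ.endVertex e₀) p Γ.endVertex e₀).card + 3 = Fintype.card E := by
  rw [← R.trivalent_iff (Γ.two_le_branches R)]
  refine forall_congr' fun v => ?_
  rw [RationalGraph.valency, R.valency_eq rfl]
  omega

/-- By the balancing condition, the slope on an edge pointing away from the root is the sum of the
slopes of the ends beyond the edge. -/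
theorem ParamType.slope_dart (C : ParamType n) {p : Fin C.numVertices → _} {δ}
    (R : Rooting C.graph (C.endVertex e₀) p δ) (v : {v // v ≠ C.endVertex e₀}) :
    C.slope (R.dart v) = ∑ e ∈ cluster p C.endVertex e₀ v.1, n e := by
  obtain ⟨v, hv⟩ := v
  induction v using R.induction_up with
  | h v ih =>
    let a : Fin C.numVertices → N := fun w =>
      if hw : w ≠ C.endVertex e₀ then C.slope (R.dart ⟨w, hw⟩) else 0
    have ha : ∀ w, C.slope (R.dart w) = a w.1 := fun w => by
      simp only [a]
      rw [dif_pos w.2]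
    have h1 := C.balanced v
    rw [R.finsum_dart (a := a) C.slope_symm ha v, if_neg hv,
      Rooting.sum_ends rfl n v, if_neg hv, add_zero] at h1
    have h2 : ∑ w ∈ children (C.endVertex e₀) p v, a w =
        ∑ w ∈ children (C.endVertex e₀) p v, ∑ e ∈ cluster p C.endVertex e₀ w, n e := by
      refine Finset.sum_congr rfl fun w hw => ?_
      obtain ⟨hw, hwv⟩ := mem_children.1 hw
      rw [← ih w hw hwv hw]
      exact dif_pos hw
    have h3 : a v = C.slope (R.dart ⟨v, hv⟩) := dif_pos hv
    rw [R.sum_cluster, ← h3, ← h2, ← sub_eq_zero, ← neg_eq_zero, ← h1]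
    abel

/-- The curve `Γ`, rooted at the end `e₀` by means of the parent function `p`, has the lengths `ℓ A`
on the edge with cluster `A`, and its root is mapped to `h₀`. -/
structure EncodedBy (Γ : Curve n) (e₀ : E) (p : Fin Γ.numVertices → Fin Γ.numVertices)
    (δ : Fin Γ.numVertices → ℕ) (ℓ : Finset E → ℝ) (h₀ : ℝ ⊗[ℤ] N) : Prop where
  rooting : Rooting Γ.graph (Γ.endVertex e₀) p δ
  length_eq : ∀ v, Γ.length (rooting.edgeEquiv v) = ℓ (cluster p Γ.endVertex e₀ v.1)
  eq_zero : ∀ A, A ∉ clusters (Γ.endVertex e₀) p Γ.endVertex e₀ → ℓ A = 0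
  pos_root : Γ.pos (Γ.endVertex e₀) = h₀

theorem exists_encodedBy (Γ : Curve n) (e₀ : E) : ∃ p δ ℓ h₀, EncodedBy Γ e₀ p δ ℓ h₀ := by
  classical
  obtain ⟨p, δ, R⟩ := exists_rooting Γ.isTree (Γ.endVertex e₀)
  let ℓ : Finset E → ℝ := fun A =>
    if h : ∃ v : {v // v ≠ Γ.endVertex e₀}, cluster p Γ.endVertex e₀ v.1 = A then
      Γ.length (R.edgeEquiv h.choose) else 0
  refine ⟨p, δ, ℓ, _, R, fun v => ?_, fun A hA => dif_neg fun h => hA ?_, rfl⟩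
  · have h : ∃ w : {v // v ≠ Γ.endVertex e₀},
        cluster p Γ.endVertex e₀ w.1 = cluster p Γ.endVertex e₀ v.1 := ⟨v, rfl⟩
    have h1 : h.choose = v :=
      Subtype.ext (R.cluster_injective (Γ.two_le_branches R) h.choose_spec)
    simp only [ℓ]
    rw [dif_pos h, h1]
  · obtain ⟨v, hv⟩ := h
    exact mem_clusters.2 ⟨v.1, v.2, hv⟩

/-- The contribution of an edge with cluster `A` and length `t` to the displacement. -/
noncomputable def displacement (n : E → N) (t : ℝ) (A : Finset E) : ℝ ⊗[ℤ] N :=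
  t • ((1 : ℝ) ⊗ₜ[ℤ] ∑ e ∈ A, n e)

namespace EncodedBy

variable {Γ : Curve n} {p : Fin Γ.numVertices → Fin Γ.numVertices} {δ : Fin Γ.numVertices → ℕ}
  {ℓ : Finset E → ℝ} {h₀ : ℝ ⊗[ℤ] N} (h : EncodedBy Γ e₀ p δ ℓ h₀)
include h

theorem branches (v : Fin Γ.numVertices) :
    2 ≤ (children (Γ.endVertex e₀) p v).card + (directEnds Γ.endVertex e₀ v).card :=
  Γ.two_le_branches h.rooting v

theorem pos_of_mem {A : Finset E} (hA : A ∈ clusters (Γ.endVertex e₀) p Γ.endVertex e₀) :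
    0 < ℓ A := by
  obtain ⟨v, hv, rfl⟩ := mem_clusters.1 hA
  rw [← h.length_eq ⟨v, hv⟩]
  exact Γ.length_pos _

theorem mem_clusters_iff {A : Finset E} :
    A ∈ clusters (Γ.endVertex e₀) p Γ.endVertex e₀ ↔ ℓ A ≠ 0 :=
  ⟨fun hA => (h.pos_of_mem hA).ne', fun hA => by_contra fun hA' => hA (h.eq_zero A hA')⟩

theorem pos_eq (v : Fin Γ.numVertices) : Γ.pos v = h₀ +
    ∑ A ∈ clusters (Γ.endVertex e₀) p Γ.endVertex e₀ with cluster p Γ.endVertex e₀ v ⊆ A,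
      displacement n (ℓ A) A := by
  rw [← h.pos_root]
  refine h.rooting.eq_add_sum h.branches (s := fun A => displacement n (ℓ A) A) (fun v hv => ?_) v
  have h1 := Γ.pos_sub_pos (h.rooting.dart ⟨v, hv⟩)
  have h2 : Γ.length (Γ.edgeOf (h.rooting.dart ⟨v, hv⟩)) = ℓ (cluster p Γ.endVertex e₀ v) := by
    rw [← h.length_eq ⟨v, hv⟩, ← h.rooting.dart_edge]
    rfl
  rw [h2, Γ.slope_dart h.rooting] at h1
  rw [displacement, ← h1]
  simp [Rooting.dart]

theorem pos_endVertex (e : E) : Γ.pos (Γ.endVertex e) = h₀ +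
    ∑ A ∈ clusters (Γ.endVertex e₀) p Γ.endVertex e₀ with e ∈ A, displacement n (ℓ A) A := by
  rw [h.pos_eq, h.rooting.sum_filter_end h.branches rfl]

end EncodedBy

theorem EncodedBy.ancestor_iff {Γ Γ' : Curve n} {p δ p' δ'} {ℓ : Finset E → ℝ} {h₀ : ℝ ⊗[ℤ] N}
    (h : EncodedBy Γ e₀ p δ ℓ h₀) (h' : EncodedBy Γ' e₀ p' δ' ℓ h₀)
    {v w : Fin Γ.numVertices} {v' w' : Fin Γ'.numVertices}
    (hv : cluster p' Γ'.endVertex e₀ v' = cluster p Γ.endVertex e₀ v)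
    (hw : cluster p' Γ'.endVertex e₀ w' = cluster p Γ.endVertex e₀ w) :
    Ancestor p' v' w' ↔ Ancestor p v w := by
  rw [h.rooting.ancestor_iff_subset h.branches, h'.rooting.ancestor_iff_subset h'.branches, hv, hw]

theorem EncodedBy.exists_cluster_eq {Γ Γ' : Curve n} {p δ p' δ'} {ℓ : Finset E → ℝ}
    {h₀ : ℝ ⊗[ℤ] N} (h : EncodedBy Γ e₀ p δ ℓ h₀) (h' : EncodedBy Γ' e₀ p' δ' ℓ h₀)
    (v : Fin Γ.numVertices) :
    ∃ v', cluster p' Γ'.endVertex e₀ v' = cluster p Γ.endVertex e₀ v := by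
  by_cases hv : v = Γ.endVertex e₀
  · exact ⟨Γ'.endVertex e₀, by rw [hv, h.rooting.cluster_root, h'.rooting.cluster_root]⟩
  · have := h'.mem_clusters_iff.2 (h.mem_clusters_iff.1 (mem_clusters.2 ⟨v, hv, rfl⟩))
    obtain ⟨v', -, hv'⟩ := mem_clusters.1 this
    exact ⟨v', hv'⟩

/-- A curve is determined up to isomorphism by its encoding: vertices are matched by their
clusters, and the tree structure can be read off from the inclusions of clusters. -/
theorem EncodedBy.nonempty_iso {Γ Γ' : Curve n} {p δ p' δ'} {ℓ : Finset E → ℝ}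
    {h₀ : ℝ ⊗[ℤ] N} (h : EncodedBy Γ e₀ p δ ℓ h₀) (h' : EncodedBy Γ' e₀ p' δ' ℓ h₀) :
    Nonempty (CurveIso Γ Γ') := by
  have R := h.rooting
  have R' := h'.rooting
  choose f hf using h.exists_cluster_eq h'
  have hinj := R.cluster_injective h.branches
  have hinj' := R'.cluster_injective h'.branches
  have hbij : Function.Bijective f := by
    constructor
    · intro v w hvw
      apply hinj
      rw [← hf, ← hf, hvw]
    · intro v'
      obtain ⟨v, hv⟩ := h'.exists_cluster_eq h v'
      exact ⟨v, hinj' ((hf v).trans hv)⟩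
  have hroot : f (Γ.endVertex e₀) = Γ'.endVertex e₀ :=
    hinj' (by rw [hf, R.cluster_root, R'.cluster_root])
  have hanc : ∀ v w, Ancestor p' (f v) (f w) ↔ Ancestor p v w := fun v w =>
    h.ancestor_iff h' (hf v) (hf w)
  have hne : ∀ v, f v ≠ Γ'.endVertex e₀ ↔ v ≠ Γ.endVertex e₀ := fun v => by
    rw [← hroot, hbij.1.ne_iff]
  have hparent : ∀ v, v ≠ Γ.endVertex e₀ → f (p v) = p' (f v) := by
    intro v hv
    apply R'.antisymm
    · have h1 := (hanc (p v) v).2 (Ancestor.parent p v)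
      exact h1.eq_or_parent.resolve_left fun h2 => R.parent_ne hv (hbij.1 h2)
    · obtain ⟨u, hu⟩ := hbij.2 (p' (f v))
      rw [← hu, hanc]
      have h1 : Ancestor p' (f u) (f v) := hu ▸ Ancestor.parent p' (f v)
      refine ((hanc u v).1 h1).eq_or_parent.resolve_left fun h2 => ?_
      rw [h2] at hu
      exact R'.parent_ne ((hne v).2 hv) hu.symm
  let φ : Γ.graph ≃g Γ'.graph :=
    { toEquiv := Equiv.ofBijective f hbij
      map_rel_iff' := by
        intro v w
        change Γ'.graph.Adj (f v) (f w) ↔ Γ.graph.Adj v w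
        rw [R.adj_iff, R'.adj_iff, hne, hne]
        refine or_congr (and_congr_right fun hv => ?_) (and_congr_right fun hw => ?_)
        · rw [← hparent v hv, hbij.1.eq_iff]
        · rw [← hparent w hw, hbij.1.eq_iff] }
  refine ⟨⟨φ, fun e => ?_, fun b => ?_, fun v => ?_⟩⟩
  · change f (Γ.endVertex e) = Γ'.endVertex e
    by_cases he : e = e₀
    · rw [he, hroot]
    · apply R'.antisymm
      · have h1 : e ∈ cluster p Γ.endVertex e₀ (Γ.endVertex e) :=
          mem_cluster.2 ⟨he, Ancestor.refl _ _⟩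
        rw [← hf] at h1
        exact (mem_cluster.1 h1).2
      · obtain ⟨u, hu⟩ := hbij.2 (Γ'.endVertex e)
        have h1 : e ∈ cluster p' Γ'.endVertex e₀ (f u) :=
          mem_cluster.2 ⟨he, hu ▸ Ancestor.refl _ _⟩
        rw [hf] at h1
        rw [← hu, hanc]
        exact (mem_cluster.1 h1).2
  · obtain ⟨v, rfl⟩ := R.edgeEquiv.surjective b
    have h1 : φ.mapEdgeSet (R.edgeEquiv v) = R'.edgeEquiv ⟨f v.1, (hne v.1).2 v.2⟩ := by
      apply Subtype.ext
      change Sym2.map f s(v.1, p v.1) = s(f v.1, p' (f v.1))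
      rw [Sym2.map_mk, hparent v.1 v.2]
    rw [h1, h'.length_eq, h.length_eq, hf]
  · change Γ'.pos (f v) = Γ.pos v
    rw [h.pos_eq, h'.pos_eq, hf]
    congr 2
    ext A
    rw [Finset.mem_filter, Finset.mem_filter, h.mem_clusters_iff, h'.mem_clusters_iff]

/-- Isomorphic curves have the same encoding. -/
theorem EncodedBy.eq_of_iso {Γ Γ' : Curve n} {p δ p' δ'} {ℓ ℓ' : Finset E → ℝ}
    {h₀ h₀' : ℝ ⊗[ℤ] N} (h : EncodedBy Γ e₀ p δ ℓ h₀) (h' : EncodedBy Γ' e₀ p' δ' ℓ' h₀')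
    (φ : CurveIso Γ Γ') : ℓ = ℓ' ∧ h₀ = h₀' := by
  have R := h.rooting
  have R' := h'.rooting
  have hroot := φ.map_endVertex e₀
  have hne : ∀ v, φ.toIso v ≠ Γ'.endVertex e₀ ↔ v ≠ Γ.endVertex e₀ := fun v => by
    rw [← hroot, φ.toIso.injective.ne_iff]
  have Rback : Rooting Γ.graph (Γ.endVertex e₀) (fun v => φ.toIso.symm (p' (φ.toIso v)))
      (fun v => δ' (φ.toIso v)) := by
    refine ⟨?_, fun v w => ?_, fun v hv => ?_⟩
    · rw [hroot, R'.root, ← hroot, RelIso.symm_apply_apply]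
    · rw [← φ.toIso.map_adj_iff, R'.adj_iff, hne, hne]
      refine or_congr (and_congr_right fun _ => ?_) (and_congr_right fun _ => ?_)
      · rw [RelIso.symm_apply_eq]
      · rw [RelIso.symm_apply_eq]
    · simpa using R'.depth _ ((hne v).2 hv)
  have hparent : ∀ v, φ.toIso (p v) = p' (φ.toIso v) := fun v => by
    rw [R.parent_unique Rback v, RelIso.apply_symm_apply]
  have hiter : ∀ i v, φ.toIso (p^[i] v) = p'^[i] (φ.toIso v) := fun i v =>
    Function.Semiconj.iterate_right (f := φ.toIso) hparent i v
  have hcl : ∀ v, cluster p' Γ'.endVertex e₀ (φ.toIso v) = cluster p Γ.endVertex e₀ v := by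
    intro v
    ext e
    rw [mem_cluster, mem_cluster]
    refine and_congr_right fun _ => exists_congr fun i => ?_
    rw [← φ.map_endVertex, ← hiter, φ.toIso.injective.eq_iff]
  constructor
  · funext A
    have hclusters : clusters (Γ'.endVertex e₀) p' Γ'.endVertex e₀ =
        clusters (Γ.endVertex e₀) p Γ.endVertex e₀ := by
      ext A
      rw [mem_clusters, mem_clusters, φ.toIso.surjective.exists]
      simp only [hne, hcl]
    by_cases hA : A ∈ clusters (Γ.endVertex e₀) p Γ.endVertex e₀
    · obtain ⟨v, hv, rfl⟩ := mem_clusters.1 hA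
      rw [← h.length_eq ⟨v, hv⟩, ← φ.map_length]
      have h1 : φ.toIso.mapEdgeSet (R.edgeEquiv ⟨v, hv⟩) =
          R'.edgeEquiv ⟨φ.toIso v, (hne v).2 hv⟩ := by
        apply Subtype.ext
        change Sym2.map φ.toIso s(v, p v) = s(φ.toIso v, p' (φ.toIso v))
        rw [Sym2.map_mk, hparent]
      rw [h1, h'.length_eq, hcl]
    · rw [h.eq_zero A hA, h'.eq_zero A (hclusters ▸ hA)]
  · rw [← h.pos_root, ← h'.pos_root, ← hroot, φ.map_pos]

end Encoding

/-! ### Realization of laminar families by trees -/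

section Realization

variable {E : Type*} [Fintype E] [DecidableEq E] {e₀ : E}

theorem IsLaminar.insert_root {F : Finset (Finset E)} (hF : IsLaminar e₀ F) :
    ∀ A ∈ insert (Finset.univ.erase e₀) F, ∀ B ∈ insert (Finset.univ.erase e₀) F,
      A ⊆ B ∨ B ⊆ A ∨ Disjoint A B := by
  intro A hA B hB
  rcases Finset.mem_insert.1 hA with rfl | hA <;> rcases Finset.mem_insert.1 hB with rfl | hB
  · exact Or.inl (Finset.Subset.refl _)
  · exact Or.inr (Or.inl (hF.1 B hB).2.subset)
  · exact Or.inl (hF.1 A hA).2.subset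
  · exact hF.2 A hA B hB

/-- Every laminar family is the family of clusters of a rooted tree with labelled ends. The vertices
are the members of the family and the set of all ends other than `e₀`; the parent of a vertex is the
smallest member that properly contains it. -/
theorem IsLaminar.exists_tree (hE : 3 ≤ Fintype.card E) {F : Finset (Finset E)}
    (hF : IsLaminar e₀ F) :
    ∃ (k : ℕ) (G : SimpleGraph (Fin k)) (ε : E → Fin k) (p : Fin k → Fin k) (δ : Fin k → ℕ),
      Rooting G (ε e₀) p δ ∧
      (∀ v, 2 ≤ (children (ε e₀) p v).card + (directEnds ε e₀ v).card) ∧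
      clusters (ε e₀) p ε e₀ = F := by
  classical
  set E' : Finset E := Finset.univ.erase e₀ with hE'
  set 𝒱 := insert E' F with h𝒱
  let σ : Fin 𝒱.card ≃ 𝒱 := (𝒱.equivFin).symm
  let c : Fin 𝒱.card → Finset E := fun v => (σ v).1
  have hcinj : Function.Injective c := fun v w h => σ.injective (Subtype.ext h)
  have hcmem : ∀ v, c v ∈ 𝒱 := fun v => (σ v).2
  have hcsurj : ∀ A ∈ 𝒱, ∃ v, c v = A := fun A hA => ⟨σ.symm ⟨A, hA⟩, by simp [c]⟩
  obtain ⟨ρ, hρ⟩ := hcsurj E' (Finset.mem_insert_self _ _)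
  have hlam : ∀ v w, c v ⊆ c w ∨ c w ⊆ c v ∨ Disjoint (c v) (c w) := fun v w =>
    hF.insert_root _ (hcmem v) _ (hcmem w)
  have hcF : ∀ v, v ≠ ρ → c v ∈ F := fun v hv =>
    (Finset.mem_insert.1 (hcmem v)).resolve_left fun h => hv (hcinj (h.trans hρ.symm))
  have hcard : ∀ v, 2 ≤ (c v).card := by
    intro v
    by_cases hv : v = ρ
    · rw [hv, hρ, hE', Finset.card_erase_of_mem (Finset.mem_univ _), Finset.card_univ]
      omega
    · exact (hF.1 _ (hcF v hv)).1
  have hsub : ∀ v, c v ⊆ c ρ := by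
    intro v
    by_cases hv : v = ρ
    · rw [hv]
    · rw [hρ]
      exact (hF.1 _ (hcF v hv)).2.subset
  have hssub : ∀ v, v ≠ ρ → c v ⊂ c ρ := fun v hv =>
    (hsub v).ssubset_of_ne fun h => hv (hcinj h)
  -- members that meet are nested, so the smaller one is contained in the larger one
  have hle : ∀ v w e, e ∈ c v → e ∈ c w → (c v).card ≤ (c w).card → c v ⊆ c w := by
    intro v w e hv hw hvw
    rcases hlam v w with h | h | h
    · exact h
    · exact (Finset.eq_of_subset_of_card_le h hvw).ge
    · exact absurd hw (Finset.disjoint_left.1 h hv)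
  have hparent : ∀ v, ∃ w, (v = ρ → w = ρ) ∧
      (v ≠ ρ → c v ⊂ c w ∧ ∀ u, c v ⊂ c u → c w ⊆ c u) := by
    intro v
    by_cases hv : v = ρ
    · exact ⟨ρ, fun _ => rfl, fun h => absurd hv h⟩
    · obtain ⟨w, hw, hmin⟩ := Finset.exists_min_image (Finset.univ.filter fun w => c v ⊂ c w)
        (fun w => (c w).card) ⟨ρ, by simpa using hssub v hv⟩
      simp only [Finset.mem_filter, Finset.mem_univ, true_and] at hw hmin
      refine ⟨w, fun h => absurd h hv, fun _ => ⟨hw, fun u hu => ?_⟩⟩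
      obtain ⟨e, he⟩ := Finset.card_pos.1 (by have := hcard v; omega : 0 < (c v).card)
      exact hle w u e (hw.subset he) (hu.subset he) (hmin u hu)
  choose p hp0 hp1 using hparent
  have hend : ∀ e, ∃ w, (e = e₀ → w = ρ) ∧
      (e ≠ e₀ → e ∈ c w ∧ ∀ u, e ∈ c u → c w ⊆ c u) := by
    intro e
    by_cases he : e = e₀
    · exact ⟨ρ, fun _ => rfl, fun h => absurd he h⟩
    · obtain ⟨w, hw, hmin⟩ := Finset.exists_min_image (Finset.univ.filter fun w => e ∈ c w)
        (fun w => (c w).card) ⟨ρ, by simpa [hρ, hE'] using he⟩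
      simp only [Finset.mem_filter, Finset.mem_univ, true_and] at hw hmin
      exact ⟨w, fun h => absurd h he, fun _ => ⟨hw, fun u hu => hle w u e hw hu (hmin u hu)⟩⟩
  choose ε hε0 hε1 using hend
  have hεr : ε e₀ = ρ := hε0 e₀ rfl
  have hpne : ∀ v, v ≠ ρ → p v ≠ v := fun v hv h => by
    have := (hp1 v hv).1
    rw [h] at this
    exact this.ne rfl
  let G : SimpleGraph (Fin 𝒱.card) :=
    { Adj := fun v w => (v ≠ ρ ∧ p v = w) ∨ (w ≠ ρ ∧ p w = v)
      symm := ⟨fun v w h => h.symm⟩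
      loopless := ⟨fun v h => by
        rcases h with ⟨h1, h2⟩ | ⟨h1, h2⟩ <;> exact hpne v h1 h2⟩ }
  have R : Rooting G ρ p (fun v => Fintype.card E - (c v).card) := by
    refine ⟨hp0 ρ rfl, fun v w => Iff.rfl, fun v hv => ?_⟩
    have h1 := Finset.card_lt_card (hp1 v hv).1
    have h2 := Finset.card_le_univ (c (p v))
    omega
  have hanc1 : ∀ v w, Ancestor p v w → c w ⊆ c v := by
    rintro v w ⟨i, rfl⟩
    induction i with
    | zero => exact Finset.Subset.refl _
    | succ i ih =>
      rw [Function.iterate_succ_apply']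
      refine ih.trans ?_
      by_cases h : p^[i] w = ρ
      · rw [h, hp0 ρ rfl]
      · exact (hp1 _ h).1.subset
  have hanc2 : ∀ v w, c w ⊆ c v → Ancestor p v w := by
    intro v w
    induction w using R.induction_down with
    | h0 =>
      intro h
      rw [hcinj ((hsub v).antisymm h)]
      exact Ancestor.refl p ρ
    | hs w hw ih =>
      intro h
      by_cases hvw : w = v
      · exact hvw ▸ Ancestor.refl p w
      · exact (ih ((hp1 w hw).2 v (h.ssubset_of_ne fun h' => hvw (hcinj h')))).trans
          (Ancestor.parent p w)
  have hcl : ∀ v, cluster p ε e₀ v = c v := by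
    intro v
    ext e
    rw [mem_cluster]
    constructor
    · rintro ⟨he, h⟩
      exact hanc1 _ _ h (hε1 e he).1
    · intro h
      have he : e ≠ e₀ := by
        have := hsub v h
        rw [hρ] at this
        exact Finset.ne_of_mem_erase this
      exact ⟨he, hanc2 _ _ ((hε1 e he).2 v h)⟩
  refine ⟨𝒱.card, G, ε, p, _, hεr ▸ R, ?_, ?_⟩
  · intro v
    rw [hεr]
    by_contra! hlt
    have h1 := R.card_cluster (ε := ε) (e₀ := e₀) v
    simp only [hcl] at h1
    have h2 := hcard v
    rcases Nat.eq_zero_or_pos (children ρ p v).card with h0 | h0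
    · rw [Finset.card_eq_zero.1 h0, Finset.sum_empty] at h1
      omega
    · obtain ⟨w, hw⟩ := Finset.card_eq_one.1 (by omega : (children ρ p v).card = 1)
      rw [hw, Finset.sum_singleton] at h1
      obtain ⟨h3, rfl⟩ := mem_children.1 (hw ▸ Finset.mem_singleton_self w)
      have h4 := Finset.card_lt_card (hp1 w h3).1
      omega
  · ext A
    rw [mem_clusters, hεr]
    simp only [hcl]
    constructor
    · rintro ⟨v, hv, rfl⟩
      exact hcF v hv
    · intro hA
      obtain ⟨v, rfl⟩ := hcsurj A (Finset.mem_insert_of_mem hA)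
      refine ⟨v, ?_, rfl⟩
      rintro rfl
      exact (hF.1 _ hA).2.ne hρ

variable {N : Type*} [AddCommGroup N] {n : E → N}

/-- Every rooted tree with labelled ends, positive lengths of its edges and a position of its root
comes from a parametrized tropical curve: the slopes are forced by the balancing condition. -/
theorem exists_curve_of_rooting (hn : ∑ e, n e = 0) {k : ℕ} {G : SimpleGraph (Fin k)}
    {ε : E → Fin k} {p : Fin k → Fin k} {δ : Fin k → ℕ} (R : Rooting G (ε e₀) p δ)
    (hval : ∀ v, 2 ≤ (children (ε e₀) p v).card + (directEnds ε e₀ v).card)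
    {ℓ : Finset E → ℝ} (hpos : ∀ A ∈ clusters (ε e₀) p ε e₀, 0 < ℓ A)
    (hzero : ∀ A, A ∉ clusters (ε e₀) p ε e₀ → ℓ A = 0) (h₀ : ℝ ⊗[ℤ] N) :
    ∃ (Γ : Curve n) (p : _) (δ : _), EncodedBy Γ e₀ p δ ℓ h₀ := by
  classical
  let sl : G.Dart → N := fun d => if d.snd ≠ ε e₀ ∧ p d.snd = d.fst then
    ∑ e ∈ cluster p ε e₀ d.snd, n e else - ∑ e ∈ cluster p ε e₀ d.fst, n e
  have hdown : ∀ v, sl (R.dart v) = ∑ e ∈ cluster p ε e₀ v.1, n e := fun v =>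
    if_pos ⟨v.2, rfl⟩
  have hup : ∀ v, sl (R.dart v).symm = - ∑ e ∈ cluster p ε e₀ v.1, n e := by
    intro v
    refine if_neg ?_
    rintro ⟨h1, h2⟩
    have h3 := R.depth _ h1
    rw [h2] at h3
    exact h3.not_gt (R.depth _ v.2)
  have hsymm : ∀ d, sl d.symm = - sl d := by
    intro d
    obtain ⟨v, rfl | rfl⟩ := R.dart_or_symm d
    · rw [hup, hdown]
    · rw [SimpleGraph.Dart.symm_symm, hup, hdown, neg_neg]
  let C : ParamType n :=
    { numVertices := k
      graph := G
      endVertex := ε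
      isTree := R.isTree
      three_le_valency := fun v => by
        rw [R.valency_eq rfl]
        have := hval v
        omega
      slope := sl
      slope_symm := hsymm
      balanced := fun v => by
        rw [R.finsum_dart (a := fun v => ∑ e ∈ cluster p ε e₀ v, n e) hsymm hdown,
          Rooting.sum_ends rfl]
        have h1 := R.sum_cluster (ε := ε) (e₀ := e₀) n v
        by_cases hv : v = ε e₀
        · rw [if_pos hv, if_pos hv]
          rw [← hv] at h1 ⊢
          have h2 := R.cluster_root (ε := ε) (e₀ := e₀)
          rw [← hv] at h2
          have h3 := Finset.sum_erase_add Finset.univ n (Finset.mem_univ e₀)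
          rw [← h2, hn, h1] at h3
          refine Eq.trans ?_ h3
          rw [sub_zero]
          abel
        · rw [if_neg hv, if_neg hv, h1]
          abel }
  let pos : Fin k → ℝ ⊗[ℤ] N := fun v => h₀ +
    ∑ A ∈ clusters (ε e₀) p ε e₀ with cluster p ε e₀ v ⊆ A, displacement n (ℓ A) A
  let len : G.edgeSet → ℝ := fun b => ℓ (cluster p ε e₀ (R.edgeEquiv.symm b).1)
  have hlen : ∀ v, len (C.edgeOf (R.dart v)) = ℓ (cluster p ε e₀ v.1) := by
    intro v
    change len ⟨(R.dart v).edge, (R.dart v).edge_mem⟩ = _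
    rw [R.dart_edge]
    simp [len]
  let Γ : Curve n :=
    { C with
      length := len
      length_pos := fun b => hpos _ (mem_clusters.2 ⟨_, (R.edgeEquiv.symm b).2, rfl⟩)
      pos := pos
      pos_sub_pos := by
        refine R.forall_dart (fun v => ?_) (fun d hd => ?_)
        · have h1 := R.sum_filter_cluster hval (fun A => displacement n (ℓ A) A) v.2
          change pos v.1 - pos (p v.1) = len (C.edgeOf (R.dart v)) • ((1 : ℝ) ⊗ₜ[ℤ] sl (R.dart v))
          rw [hlen, hdown]
          simp only [pos]
          rw [h1, displacement]
          abel
        · change pos d.fst - pos d.snd = len (C.edgeOf d.symm) • ((1 : ℝ) ⊗ₜ[ℤ] sl d.symm)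
          have h1 : C.edgeOf d.symm = C.edgeOf d := Subtype.ext d.edge_symm
          rw [h1, hsymm, TensorProduct.tmul_neg, smul_neg]
          rw [← neg_sub]
          exact congrArg Neg.neg hd }
  refine ⟨Γ, p, δ, R, fun v => ?_, hzero, ?_⟩
  · change len (R.edgeEquiv v) = _
    simp only [len, Equiv.symm_apply_apply]
    rfl
  · change h₀ + _ = h₀
    rw [R.sum_filter_cluster_root hval, add_zero]

/-- Every point of the fan of laminar families, with a position of the root, comes from a curve. -/
theorem IsLaminar.exists_curve (hE : 3 ≤ Fintype.card E) (hn : ∑ e, n e = 0)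
    {F : Finset (Finset E)} (hF : IsLaminar e₀ F) {ℓ : Finset E → ℝ} (hpos : ∀ A ∈ F, 0 < ℓ A)
    (hzero : ∀ A, A ∉ F → ℓ A = 0) (h₀ : ℝ ⊗[ℤ] N) :
    ∃ (Γ : Curve n) (p : _) (δ : _), EncodedBy Γ e₀ p δ ℓ h₀ := by
  obtain ⟨k, G, ε, p, δ, R, hval, rfl⟩ := hF.exists_tree hE
  exact exists_curve_of_rooting hn R hval hpos hzero h₀

end Realization

/-! ### Laminar families with one cluster less than a maximal one -/

section FourValent

variable {V E : Type*} [Fintype V] [Fintype E] [DecidableEq V] [DecidableEq E]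
  {G : SimpleGraph V} {ρ : V} {p : V → V} {δ : V → ℕ} {ε : E → V} {e₀ : E}

/-- The sets of ends beyond the edges and ends at a vertex that do not point to the root. -/
noncomputable def branches (ρ : V) (p : V → V) (ε : E → V) (e₀ : E) (v : V) : Finset (Finset E) :=
  (children ρ p v).image (cluster p ε e₀) ∪ (directEnds ε e₀ v).image ({·})

theorem mem_branches {v : V} {b : Finset E} : b ∈ branches ρ p ε e₀ v ↔
    (∃ w ∈ children ρ p v, cluster p ε e₀ w = b) ∨ ∃ e ∈ directEnds ε e₀ v, {e} = b := by
  simp only [branches, Finset.mem_union, Finset.mem_image]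

namespace Rooting

variable (R : Rooting G ρ p δ)
include R

theorem mem_cluster_iff_branches {v : V} {e : E} :
    e ∈ cluster p ε e₀ v ↔ ∃ b ∈ branches ρ p ε e₀ v, e ∈ b := by
  rw [R.cluster_eq, Finset.mem_union, Finset.mem_biUnion]
  constructor
  · rintro (h | ⟨w, hw, h⟩)
    · exact ⟨{e}, mem_branches.2 (Or.inr ⟨e, h, rfl⟩), Finset.mem_singleton_self e⟩
    · exact ⟨_, mem_branches.2 (Or.inl ⟨w, hw, rfl⟩), h⟩
  · rintro ⟨b, hb, h⟩
    rcases mem_branches.1 hb with ⟨w, hw, rfl⟩ | ⟨e', he', rfl⟩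
    · exact Or.inr ⟨w, hw, h⟩
    · rw [Finset.mem_singleton.1 h]
      exact Or.inl he'

theorem branch_subset {v : V} {b : Finset E} (hb : b ∈ branches ρ p ε e₀ v) :
    b ⊆ cluster p ε e₀ v := fun _ he => R.mem_cluster_iff_branches.2 ⟨b, hb, he⟩

theorem branches_disjoint {v : V} {b b' : Finset E} (hb : b ∈ branches ρ p ε e₀ v)
    (hb' : b' ∈ branches ρ p ε e₀ v) (hne : b ≠ b') : Disjoint b b' := by
  rcases mem_branches.1 hb with ⟨w, hw, rfl⟩ | ⟨e, he, rfl⟩ <;>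
    rcases mem_branches.1 hb' with ⟨w', hw', rfl⟩ | ⟨e', he', rfl⟩
  · exact R.disjoint_of_children hw hw' fun h => hne (h ▸ rfl)
  · exact (Finset.disjoint_of_subset_left (Finset.singleton_subset_iff.2 he')
      (R.disjoint_directEnds hw)).symm
  · exact Finset.disjoint_of_subset_left (Finset.singleton_subset_iff.2 he)
      (R.disjoint_directEnds hw')
  · rw [Finset.disjoint_singleton]
    exact fun h => hne (h ▸ rfl)

variable (hval : ∀ v, 2 ≤ (children ρ p v).card + (directEnds ε e₀ v).card)
include hval

theorem branch_nonempty {v : V} {b : Finset E} (hb : b ∈ branches ρ p ε e₀ v) : b.Nonempty := by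
  rcases mem_branches.1 hb with ⟨w, hw, rfl⟩ | ⟨e, he, rfl⟩
  · exact R.cluster_nonempty hval w
  · exact Finset.singleton_nonempty e

theorem card_branches (v : V) : (branches ρ p ε e₀ v).card =
    (children ρ p v).card + (directEnds ε e₀ v).card := by
  rw [branches, Finset.card_union_of_disjoint,
    Finset.card_image_of_injective _ (R.cluster_injective hval),
    Finset.card_image_of_injective _ Finset.singleton_injective]
  rw [Finset.disjoint_left]
  intro b hb hb'
  obtain ⟨w, hw, rfl⟩ := Finset.mem_image.1 hb
  obtain ⟨e, he, h⟩ := Finset.mem_image.1 hb'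
  have h1 := R.two_le_card_cluster hval w
  rw [← h, Finset.card_singleton] at h1
  omega

/-- In a tree that has one edge less than a trivalent one, one vertex is four-valent and all others
are trivalent. -/
theorem exists_fourValent (hc : (clusters ρ p ε e₀).card + 4 = Fintype.card E) :
    ∃ v, (branches ρ p ε e₀ v).card = 3 ∧ ∀ w, w ≠ v → (branches ρ p ε e₀ w).card = 2 := by
  simp only [R.card_branches hval]
  have h1 := R.card_clusters hval
  let x : V → ℕ := fun v => (children ρ p v).card + (directEnds ε e₀ v).card
  have h2 : ∑ v, x v + 2 = _ := R.sum_branches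
  change ∃ v, x v = 3 ∧ ∀ w, w ≠ v → x w = 2
  have hx : ∀ v, 2 ≤ x v := hval
  have h3 : ∑ v, (x v - 2) = 1 := by
    have h4 : ∑ v, x v = ∑ v, (x v - 2) + ∑ _v : V, 2 := by
      rw [← Finset.sum_add_distrib]
      exact Finset.sum_congr rfl fun v _ => (Nat.sub_add_cancel (hx v)).symm
    rw [Finset.sum_const, Finset.card_univ, smul_eq_mul] at h4
    omega
  obtain ⟨v, -, hv⟩ := Finset.exists_ne_zero_of_sum_ne_zero (h3.trans_ne one_ne_zero)
  rw [← Finset.add_sum_erase _ _ (Finset.mem_univ v)] at h3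
  refine ⟨v, ?_, fun w hw => ?_⟩
  · omega
  · have h5 : ∑ w ∈ Finset.univ.erase v, (x w - 2) = 0 := by omega
    have h6 := Finset.sum_eq_zero_iff.1 h5 w (Finset.mem_erase.2 ⟨hw, Finset.mem_univ w⟩)
    have h7 := hx w
    omega

/-- A cluster that can be added to the clusters of a tree is the union of at least two, but not
all, branches at some vertex. -/
theorem exists_branches_of_insert {A : Finset E} (hA : A ∉ clusters ρ p ε e₀)
    (hlam : IsLaminar e₀ (insert A (clusters ρ p ε e₀))) :
    ∃ v, A ⊆ cluster p ε e₀ v ∧ (∀ b ∈ branches ρ p ε e₀ v, b ⊆ A ∨ Disjoint b A) ∧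
      2 ≤ ((branches ρ p ε e₀ v).filter (· ⊆ A)).card ∧
      ((branches ρ p ε e₀ v).filter (· ⊆ A)).card < (branches ρ p ε e₀ v).card := by
  have hAc := hlam.1 A (Finset.mem_insert_self _ _)
  obtain ⟨v, hv, hmin⟩ := Finset.exists_min_image
    (Finset.univ.filter fun v => A ⊆ cluster p ε e₀ v) (fun v => (cluster p ε e₀ v).card)
    ⟨ρ, by simpa [R.cluster_root] using hAc.2.subset⟩
  simp only [Finset.mem_filter, Finset.mem_univ, true_and] at hv hmin
  have hdich : ∀ b ∈ branches ρ p ε e₀ v, b ⊆ A ∨ Disjoint b A := by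
    intro b hb
    rcases mem_branches.1 hb with ⟨w, hw, rfl⟩ | ⟨e, he, rfl⟩
    · have hwc : cluster p ε e₀ w ∈ clusters ρ p ε e₀ :=
        mem_clusters.2 ⟨w, (mem_children.1 hw).1, rfl⟩
      rcases hlam.2 A (Finset.mem_insert_self _ _) _ (Finset.mem_insert_of_mem hwc) with h | h | h
      · have h1 := hmin w h
        have h2 := R.card_cluster_lt_of_child hval hw
        omega
      · exact Or.inl h
      · exact Or.inr h.symm
    · by_cases h : e ∈ A
      · exact Or.inl (Finset.singleton_subset_iff.2 h)
      · exact Or.inr (Finset.disjoint_singleton_left.2 h)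
  have hmemA : ∀ e ∈ A, ∃ b ∈ (branches ρ p ε e₀ v).filter (· ⊆ A), e ∈ b := by
    intro e he
    obtain ⟨b, hb, heb⟩ := R.mem_cluster_iff_branches.1 (hv he)
    refine ⟨b, Finset.mem_filter.2 ⟨hb, (hdich b hb).resolve_right fun h => ?_⟩, heb⟩
    exact Finset.disjoint_left.1 h heb he
  refine ⟨v, hv, hdich, ?_, ?_⟩
  · by_contra! hlt
    obtain ⟨e, he⟩ := Finset.card_pos.1 (by have := hAc.1; omega : 0 < A.card)
    obtain ⟨b, hb, -⟩ := hmemA e he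
    obtain ⟨b', hb'⟩ := Finset.card_eq_one.1 (by
      have := Finset.card_pos.2 ⟨b, hb⟩
      omega : ((branches ρ p ε e₀ v).filter (· ⊆ A)).card = 1)
    rw [hb', Finset.mem_singleton] at hb
    subst hb
    have hb := Finset.mem_filter.1 (hb'.symm ▸ Finset.mem_singleton_self b :
      b ∈ (branches ρ p ε e₀ v).filter (· ⊆ A))
    have hAb : A = b := by
      apply Finset.Subset.antisymm
      · intro e he
        obtain ⟨b', h1, h2⟩ := hmemA e he
        rw [hb', Finset.mem_singleton] at h1
        exact h1 ▸ h2
      · exact hb.2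
    have hb := hb.1
    rcases mem_branches.1 hb with ⟨w, hw, h⟩ | ⟨e, he, h⟩
    · exact hA (hAb ▸ mem_clusters.2 ⟨w, (mem_children.1 hw).1, h⟩)
    · have := hAc.1
      rw [hAb, ← h, Finset.card_singleton] at this
      omega
  · refine Finset.card_lt_card ((Finset.filter_subset _ _).ssubset_of_ne fun heq => ?_)
    have hAv : A = cluster p ε e₀ v := by
      refine hv.antisymm fun e he => ?_
      obtain ⟨b, hb, heb⟩ := R.mem_cluster_iff_branches.1 he
      rw [← heq] at hb
      exact (Finset.mem_filter.1 hb).2 heb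
    by_cases h : v = ρ
    · rw [h, R.cluster_root] at hAv
      exact hAc.2.ne hAv
    · exact hA (hAv ▸ mem_clusters.2 ⟨v, h, rfl⟩)

/-- The union of all but one branches at a vertex of valency at least four can be added to the
clusters of a tree. -/
theorem isLaminar_insert_sdiff {v : V} (hv : 3 ≤ (branches ρ p ε e₀ v).card) {b : Finset E}
    (hb : b ∈ branches ρ p ε e₀ v) :
    cluster p ε e₀ v \ b ∉ clusters ρ p ε e₀ ∧
      IsLaminar e₀ (insert (cluster p ε e₀ v \ b) (clusters ρ p ε e₀)) := by
  set A := cluster p ε e₀ v \ b with hA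
  have hbA : ∀ b' ∈ branches ρ p ε e₀ v, b' ≠ b → b' ⊆ A := fun b' hb' hne => by
    rw [hA, Finset.subset_sdiff]
    exact ⟨R.branch_subset hb', R.branches_disjoint hb' hb hne⟩
  obtain ⟨b₁, h₁, b₂, h₂, h12⟩ := Finset.one_lt_card.1 (by
    rw [Finset.card_erase_of_mem hb]; omega : 1 < ((branches ρ p ε e₀ v).erase b).card)
  obtain ⟨hb1, h₁⟩ := Finset.mem_erase.1 h₁
  obtain ⟨hb2, h₂⟩ := Finset.mem_erase.1 h₂
  have hd := R.branches_disjoint h₁ h₂ h12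
  have hssub : A ⊂ cluster p ε e₀ v := by
    refine Finset.sdiff_subset.ssubset_of_ne fun h => ?_
    obtain ⟨e, he⟩ := R.branch_nonempty hval hb
    have := R.branch_subset hb he
    rw [← h] at this
    exact (Finset.mem_sdiff.1 this).2 he
  have hcard : 2 ≤ A.card := by
    have h3 := Finset.card_le_card (Finset.union_subset (hbA b₁ h₁ hb1) (hbA b₂ h₂ hb2))
    rw [Finset.card_union_of_disjoint hd] at h3
    have h4 := Finset.card_pos.2 (R.branch_nonempty hval h₁)
    have h5 := Finset.card_pos.2 (R.branch_nonempty hval h₂)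
    omega
  have hbelow : ∀ w, cluster p ε e₀ w ⊂ cluster p ε e₀ v →
      ∃ b' ∈ branches ρ p ε e₀ v, cluster p ε e₀ w ⊆ b' := by
    intro w hw
    obtain ⟨c, h3, h4, h5⟩ := R.exists_child ((R.ancestor_iff_subset hval).2 hw.subset)
      fun h => hw.ne (h ▸ rfl)
    exact ⟨_, mem_branches.2 (Or.inl ⟨c, mem_children.2 ⟨h3, h4⟩, rfl⟩),
      cluster_subset_of_ancestor h5⟩
  have hcomp : ∀ C ∈ clusters ρ p ε e₀, A ⊆ C ∨ C ⊆ A ∨ Disjoint A C := by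
    intro C hC
    obtain ⟨w, hw, rfl⟩ := mem_clusters.1 hC
    rcases R.cluster_laminar hval v w with h | h | h
    · exact Or.inl (hssub.subset.trans h)
    · rcases h.eq_or_ssubset with h | h
      · exact Or.inl (h ▸ hssub.subset)
      · obtain ⟨b', hb', hwb⟩ := hbelow w h
        by_cases hbb : b' = b
        · refine Or.inr (Or.inr (Finset.disjoint_of_subset_right (hbb ▸ hwb) ?_))
          exact Finset.sdiff_disjoint
        · exact Or.inr (Or.inl (hwb.trans (hbA b' hb' hbb)))
    · exact Or.inr (Or.inr (Finset.disjoint_of_subset_left hssub.subset h))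
  refine ⟨fun hmem => ?_, fun C hC => ?_, fun C hC D hD => ?_⟩
  · obtain ⟨w, hw, h⟩ := mem_clusters.1 hmem
    obtain ⟨b', hb', hwb⟩ := hbelow w (h ▸ hssub)
    rw [h] at hwb
    have heq : ∀ b'' ∈ branches ρ p ε e₀ v, b'' ≠ b → b'' = b' := by
      intro b'' h3 h4
      by_contra h5
      obtain ⟨e, he⟩ := R.branch_nonempty hval h3
      exact Finset.disjoint_left.1 (R.branches_disjoint h3 hb' h5) he (hwb (hbA b'' h3 h4 he))
    exact h12 ((heq b₁ h₁ hb1).trans (heq b₂ h₂ hb2).symm)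
  · rcases Finset.mem_insert.1 hC with rfl | hC
    · refine ⟨hcard, hssub.trans_subset ?_⟩
      rw [← R.cluster_root]
      exact cluster_subset_of_ancestor (R.root_ancestor v)
    · exact (R.isLaminar_clusters hval).1 C hC
  · rcases Finset.mem_insert.1 hC with hCA | hC <;> rcases Finset.mem_insert.1 hD with hDA | hD
    · exact Or.inl (hCA.trans hDA.symm).subset
    · rw [hCA]
      exact hcomp D hD
    · rw [hDA]
      rcases hcomp C hC with h | h | h
      · exact Or.inr (Or.inl h)
      · exact Or.inl h
      · exact Or.inr (Or.inr h.symm)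
    · exact (R.isLaminar_clusters hval).2 C hC D hD

end Rooting

open Classical in
/-- The simplicial complex of the laminar families. -/
noncomputable def laminarFamilies (e₀ : E) : Finset (Finset (Finset E)) :=
  Finset.univ.filter (IsLaminar e₀)

theorem mem_laminarFamilies {F : Finset (Finset E)} :
    F ∈ laminarFamilies e₀ ↔ IsLaminar e₀ F := by
  simp [laminarFamilies]

/-- A laminar family with one member less than a maximal one can be enlarged in exactly three ways,
by the unions of two of the three branches `b₁`, `b₂`, `b₃` of the four-valent vertex. -/
theorem IsLaminar.exists_three_resolutions (hE : 3 ≤ Fintype.card E) {τ : Finset (Finset E)}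
    (hτ : IsLaminar e₀ τ) (hc : τ.card + 4 = Fintype.card E) :
    ∃ b₁ b₂ b₃ : Finset E, Disjoint b₁ b₂ ∧ Disjoint b₁ b₃ ∧ Disjoint b₂ b₃ ∧
      (∀ b ∈ ({b₁, b₂, b₃} : Finset (Finset E)), b ∈ τ ∨ ∃ e, b = {e}) ∧
      (b₁ ∪ b₂ ∪ b₃ ∈ τ ∨ b₁ ∪ b₂ ∪ b₃ = Finset.univ.erase e₀) ∧
      ∀ {M : Type*} [AddCommMonoid M] (f : Finset E → M),
        ∑ A with A ∉ τ ∧ insert A τ ∈ laminarFamilies e₀, f A =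
          f (b₂ ∪ b₃) + f (b₁ ∪ b₃) + f (b₁ ∪ b₂) := by
  obtain ⟨k, G, ε, p, δ, R, hval, rfl⟩ := hτ.exists_tree hE
  obtain ⟨v, hv, hother⟩ := R.exists_fourValent hval hc
  obtain ⟨b₁, b₂, b₃, h12, h13, h23, hb⟩ := Finset.card_eq_three.1 hv
  have hm₁ : b₁ ∈ branches (ε e₀) p ε e₀ v := by simp [hb]
  have hm₂ : b₂ ∈ branches (ε e₀) p ε e₀ v := by simp [hb]
  have hm₃ : b₃ ∈ branches (ε e₀) p ε e₀ v := by simp [hb]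
  have d12 := R.branches_disjoint hm₁ hm₂ h12
  have d13 := R.branches_disjoint hm₁ hm₃ h13
  have d23 := R.branches_disjoint hm₂ hm₃ h23
  have hcl : cluster p ε e₀ v = b₁ ∪ b₂ ∪ b₃ := by
    ext e
    rw [R.mem_cluster_iff_branches, hb]
    simp
  refine ⟨b₁, b₂, b₃, d12, d13, d23, ?_, ?_, ?_⟩
  · rw [← hb]
    intro b hb
    rcases mem_branches.1 hb with ⟨w, hw, rfl⟩ | ⟨e, he, rfl⟩
    · exact Or.inl (mem_clusters.2 ⟨w, (mem_children.1 hw).1, rfl⟩)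
    · exact Or.inr ⟨e, rfl⟩
  · rw [← hcl]
    by_cases h : v = ε e₀
    · exact Or.inr (h ▸ R.cluster_root)
    · exact Or.inl (mem_clusters.2 ⟨v, h, rfl⟩)
  · intro M _ f
    have hset : Finset.univ.filter (fun A => A ∉ clusters (ε e₀) p ε e₀ ∧
        insert A (clusters (ε e₀) p ε e₀) ∈ laminarFamilies e₀) =
        (branches (ε e₀) p ε e₀ v).image (cluster p ε e₀ v \ ·) := by
      ext A
      simp only [Finset.mem_filter, Finset.mem_univ, true_and, mem_laminarFamilies,
        Finset.mem_image]
      constructor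
      · rintro ⟨h1, h2⟩
        obtain ⟨w, h3, h4, h5, h6⟩ := R.exists_branches_of_insert hval h1 h2
        have hwv : w = v := by
          by_contra h
          have := hother w h
          omega
        subst hwv
        -- exactly one of the three branches is not contained in `A`
        have h7 : ((branches (ε e₀) p ε e₀ w).filter (¬ · ⊆ A)).card = 1 := by
          have := Finset.card_filter_add_card_filter_not (s := branches (ε e₀) p ε e₀ w) (· ⊆ A)
          omega
        obtain ⟨b, h8⟩ := Finset.card_eq_one.1 h7
        have h9 := Finset.mem_filter.1 (h8 ▸ Finset.mem_singleton_self b)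
        refine ⟨b, h9.1, ?_⟩
        ext e
        rw [Finset.mem_sdiff]
        constructor
        · rintro ⟨h10, h11⟩
          obtain ⟨b', hb', he⟩ := R.mem_cluster_iff_branches.1 h10
          by_contra h12
          have h13 : b' ∈ (branches (ε e₀) p ε e₀ w).filter (¬ · ⊆ A) :=
            Finset.mem_filter.2 ⟨hb', fun h => h12 (h he)⟩
          rw [h8, Finset.mem_singleton] at h13
          exact h11 (h13 ▸ he)
        · exact fun h10 => ⟨h3 h10, fun h11 =>
            Finset.disjoint_left.1 ((h4 b h9.1).resolve_left h9.2) h11 h10⟩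
      · rintro ⟨b, hb, rfl⟩
        exact R.isLaminar_insert_sdiff hval hv.ge hb
    rw [hset, Finset.sum_image, hb, Finset.sum_insert (by simp [h12, h13]),
      Finset.sum_insert (by simp [h23]), Finset.sum_singleton, hcl, ← add_assoc]
    · have e1 : (b₁ ∪ b₂ ∪ b₃) \ b₁ = b₂ ∪ b₃ := by
        rw [Finset.union_assoc, Finset.union_sdiff_cancel_left]
        exact Finset.disjoint_union_right.2 ⟨d12, d13⟩
      have e2 : (b₁ ∪ b₂ ∪ b₃) \ b₂ = b₁ ∪ b₃ := by
        rw [Finset.union_comm b₁ b₂, Finset.union_assoc, Finset.union_sdiff_cancel_left]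
        exact Finset.disjoint_union_right.2 ⟨d12.symm, d23⟩
      have e3 : (b₁ ∪ b₂ ∪ b₃) \ b₃ = b₁ ∪ b₂ := by
        rw [Finset.union_sdiff_cancel_right]
        exact Finset.disjoint_union_left.2 ⟨d13, d23⟩
      rw [e1, e2, e3]
    · intro b hb b' hb' h
      have h1 := congrArg (cluster p ε e₀ v \ ·) h
      simpa [Finset.sdiff_sdiff_eq_self (R.branch_subset hb),
        Finset.sdiff_sdiff_eq_self (R.branch_subset hb')] using h1

end FourValent

/-! ### Evaluation in coordinates -/

section LatticeDet

open Module

/-- The lattice determinant can be computed in arbitrary bases. -/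
theorem latticeDet_eq {A B ι : Type*} [AddCommGroup A] [AddCommGroup B] [Module.Free ℤ A]
    [Module.Finite ℤ A] [Module.Free ℤ B] [Module.Finite ℤ B] [Fintype ι] [DecidableEq ι]
    (a : Basis ι ℤ A) (b : Basis ι ℤ B) (f : A →ₗ[ℤ] B) :
    latticeDet f = (b.det fun i => f (a i)).natAbs := by
  have hA := finrank_eq_card_basis a
  have hB := finrank_eq_card_basis b
  have h : finrank ℤ A = finrank ℤ B := hA.trans hB.symm
  rw [latticeDet, dif_pos h]
  set a' := finBasisOfFinrankEq ℤ A h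
  set b' := finBasis ℤ B
  let e : Fin (finrank ℤ B) ≃ ι := Fintype.equivOfCardEq (by simp [hB])
  have h1 : (b'.det fun i => f (a' i)) = b'.det (b.reindex e.symm) *
      ((b.reindex e.symm).det fun i => f (a' i)) := by
    rw [Basis.det_apply, Basis.det_apply, Basis.det_apply, ← Matrix.det_mul,
      Basis.toMatrix_mul_toMatrix]
  have h2 : ((b.reindex e.symm).det fun i => f (a' i)) =
      ((b.reindex e.symm).det fun i => f ((a.reindex e.symm) i)) *
        (a.reindex e.symm).det a' := by
    rw [Basis.det_apply, Basis.det_apply, Basis.det_apply, ← Matrix.det_mul]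
    congr 1
    have := LinearMap.toMatrix_comp a' (a.reindex e.symm) (b.reindex e.symm) f LinearMap.id
    ext i j
    have h3 := congrFun (congrFun this i) j
    simp only [LinearMap.comp_id, LinearMap.toMatrix_apply] at h3
    rw [Basis.toMatrix_apply, h3]
    rw [Matrix.mul_apply, Matrix.mul_apply]
    simp [Basis.toMatrix_apply, LinearMap.toMatrix_apply]
  have h3 : (LinearMap.toMatrix a' b' f).det = b'.det fun i => f (a' i) := by
    rw [Basis.det_apply]
    congr 1
    ext i j
    rw [LinearMap.toMatrix_apply, Basis.toMatrix_apply]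
  rw [h3, h1, h2, Int.natAbs_mul, Int.natAbs_mul,
    Int.isUnit_iff_natAbs_eq.1 (Basis.isUnit_det b' (b.reindex e.symm)),
    Int.isUnit_iff_natAbs_eq.1 (Basis.isUnit_det (a.reindex e.symm) a'), one_mul, mul_one,
    Basis.det_reindex]
  congr 2
  ext i
  simp

theorem latticeDet_ne_zero_iff {A B ι : Type*} [AddCommGroup A] [AddCommGroup B] [Module.Free ℤ A]
    [Module.Finite ℤ A] [Module.Free ℤ B] [Module.Finite ℤ B] [Fintype ι] [DecidableEq ι]
    (a : Basis ι ℤ A) (b : Basis ι ℤ B) (f : A →ₗ[ℤ] B) :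
    latticeDet f ≠ 0 ↔ Function.Injective f := by
  have hdet : (b.det fun i => f (a i)) = (LinearMap.toMatrix a b f).det := by
    rw [Basis.det_apply]
    congr 1
    ext i j
    rw [LinearMap.toMatrix_apply, Basis.toMatrix_apply]
  rw [latticeDet_eq a b f, Int.natAbs_ne_zero, hdet, Ne, ← Matrix.exists_mulVec_eq_zero_iff,
    injective_iff_map_eq_zero, not_exists]
  constructor
  · intro h x hx
    by_contra hne
    apply h (a.repr x)
    refine ⟨fun h0 => hne ?_, ?_⟩
    · apply a.repr.injective
      ext i
      rw [congrFun h0 i, map_zero]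
      rfl
    · rw [LinearMap.toMatrix_mulVec_repr, hx, map_zero]
      rfl
  · rintro h v ⟨hv, hv0⟩
    apply hv
    have h1 := LinearMap.toMatrix_mulVec_repr a b f (a.equivFun.symm v)
    have h2 : (a.repr (a.equivFun.symm v) : ι → ℤ) = v := a.equivFun.apply_symm_apply v
    rw [h2, hv0] at h1
    have h3 : f (a.equivFun.symm v) = 0 := by
      apply b.repr.injective
      ext i
      rw [← h1, map_zero]
      rfl
    have h4 := h _ h3
    rw [← h2, h4, map_zero]
    rfl

end LatticeDet

section Evaluation

set_option linter.unusedSectionVars false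

open Module

variable {E N : Type*} [Fintype E] [DecidableEq E] [AddCommGroup N] {n : E → N} (𝒮 : Slopes n)

/-- The projection of `N` to the quotient lattice of an end. -/
def toQ (e : E) : N →ₗ[ℤ] 𝒮.Q e := (𝒮.L e).mkQ ∘ₗ (Submodule.span ℤ {n e}).mkQ

/-- The effect on the evaluations of an edge of unit length with cluster `A`: the ends beyond the
edge are moved by its slope. -/
def clusterVector (A : Finset E) (e : E) : 𝒮.Q e :=
  if e ∈ A then toQ 𝒮 e (∑ e' ∈ A, n e') else 0

/-- The evaluation map in coordinates, for a family of clusters: it maps the lengths of the edges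
and the position of the root to the evaluations of the ends. -/
noncomputable def coordEv {I : Type*} [Fintype I] (g : I → Finset E) :
    ((I → ℤ) × N) →ₗ[ℤ] (∀ e, 𝒮.Q e) :=
  (Fintype.linearCombination ℤ fun i => clusterVector 𝒮 (g i)).coprod (LinearMap.pi (toQ 𝒮))

theorem coordEv_apply {I : Type*} [Fintype I] (g : I → Finset E) (x : (I → ℤ) × N) (e : E) :
    coordEv 𝒮 g x e = (∑ i, x.1 i • clusterVector 𝒮 (g i) e) + toQ 𝒮 e x.2 := by
  rw [coordEv, LinearMap.coprod_apply, Fintype.linearCombination_apply, Pi.add_apply,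
    Finset.sum_apply]
  rfl

/-- The real vector space in which the evaluations take place. -/
abbrev EvSpace : Type _ := ∀ e, ℝ ⊗[ℤ] 𝒮.Q e

/-- The real points of `clusterVector`. -/
noncomputable def realClusterVector (A : Finset E) : EvSpace 𝒮 :=
  fun e => (1 : ℝ) ⊗ₜ clusterVector 𝒮 A e

/-- The evaluations of the contracted curve at a point. -/
noncomputable def pointEv : ℝ ⊗[ℤ] N →ₗ[ℝ] EvSpace 𝒮 :=
  LinearMap.pi fun e => (toQ 𝒮 e).baseChange ℝ

/-- The reduction of the evaluations modulo the directions of the constraints. -/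
noncomputable def reduce : (∀ e, ℝ ⊗[ℤ] (N ⧸ Submodule.span ℤ {n e})) →ₗ[ℝ] EvSpace 𝒮 :=
  LinearMap.pi fun e => ((𝒮.L e).mkQ.baseChange ℝ) ∘ₗ LinearMap.proj e

theorem reduce_surjective : Function.Surjective (reduce 𝒮) := by
  intro y
  have h : ∀ e, Function.Surjective ((𝒮.L e).mkQ.baseChange ℝ) := fun e => by
    rw [LinearMap.baseChange_eq_ltensor]
    exact LinearMap.lTensor_surjective _ (Submodule.mkQ_surjective _)
  choose x hx using fun e => h e (y e)
  exact ⟨x, funext hx⟩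

theorem realL_eq_ker (e : E) : 𝒮.realL e = LinearMap.ker ((𝒮.L e).mkQ.baseChange ℝ) := by
  have h : Function.Exact (𝒮.L e).subtype (𝒮.L e).mkQ := by
    rw [LinearMap.exact_iff, Submodule.ker_mkQ, Submodule.range_subtype]
  have h1 := lTensor_exact ℝ h (Submodule.mkQ_surjective _)
  ext x
  rw [Slopes.realL, LinearMap.mem_range, LinearMap.mem_ker, LinearMap.baseChange_eq_ltensor,
    LinearMap.baseChange_eq_ltensor]
  exact (h1 x).symm

theorem Constraints.HasSlopes.exists_solves_iff {𝒮 : Slopes n} {𝓛 : Constraints n}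
    (h : 𝓛.HasSlopes 𝒮) :
    ∃ q : EvSpace 𝒮, ∀ Γ : Curve n, Γ.Solves 𝓛 ↔ reduce 𝒮 Γ.ev = q := by
  choose p hp using fun e => (h e).1
  refine ⟨reduce 𝒮 p, fun Γ => ?_⟩
  rw [funext_iff]
  refine forall_congr' fun e => ?_
  rw [← AffineSubspace.vsub_right_mem_direction_iff_mem (hp e), (h e).2, realL_eq_ker,
    LinearMap.mem_ker, vsub_eq_sub, map_sub, sub_eq_zero]
  rfl

theorem Slopes.solves_through_iff (p : ∀ e, ℝ ⊗[ℤ] (N ⧸ Submodule.span ℤ {n e})) (Γ : Curve n) :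
    Γ.Solves (𝒮.through p) ↔ reduce 𝒮 Γ.ev = reduce 𝒮 p := by
  rw [funext_iff]
  refine forall_congr' fun e => ?_
  rw [Slopes.through, AffineSubspace.mem_mk', realL_eq_ker,
    LinearMap.mem_ker, vsub_eq_sub, map_sub, sub_eq_zero]
  rfl

/-- The evaluations of a curve in terms of its encoding. -/
theorem EncodedBy.reduce_ev {e₀ : E} {Γ : Curve n} {p δ} {ℓ : Finset E → ℝ} {h₀ : ℝ ⊗[ℤ] N}
    (h : EncodedBy Γ e₀ p δ ℓ h₀) : reduce 𝒮 Γ.ev = pointEv 𝒮 h₀ +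
      ∑ A ∈ clusters (Γ.endVertex e₀) p Γ.endVertex e₀, ℓ A • realClusterVector 𝒮 A := by
  funext e
  have h1 : reduce 𝒮 Γ.ev e = (toQ 𝒮 e).baseChange ℝ (Γ.pos (Γ.endVertex e)) := by
    rw [toQ, LinearMap.baseChange_comp]
    rfl
  rw [h1, h.pos_endVertex, map_add, map_sum, Pi.add_apply, Finset.sum_apply]
  congr 1
  rw [Finset.sum_filter]
  refine Finset.sum_congr rfl fun A _ => ?_
  rw [Pi.smul_apply, realClusterVector, clusterVector]
  split_ifs with hA
  · rw [displacement, map_smul, LinearMap.baseChange_tmul]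
  · rw [TensorProduct.tmul_zero, smul_zero]

end Evaluation

/-! ### The multiplicity in coordinates -/

section Multiplicity

set_option linter.unusedSectionVars false

open Module

variable {E N : Type*} [Fintype E] [DecidableEq E] [AddCommGroup N] {n : E → N} (𝒮 : Slopes n)
  {e₀ : E}

theorem ParamType.mem_coneLattice_iff (C : ParamType n) {p : Fin C.numVertices → _} {δ}
    (R : Rooting C.graph (C.endVertex e₀) p δ)
    (x : (C.graph.edgeSet → ℤ) × (Fin C.numVertices → N)) :
    x ∈ C.coneLattice ↔ ∀ v : {v // v ≠ C.endVertex e₀},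
      x.2 v.1 - x.2 (p v.1) = x.1 (R.edgeEquiv v) • ∑ e ∈ cluster p C.endVertex e₀ v.1, n e := by
  have key : ∀ v, C.edgeOf (R.dart v) = R.edgeEquiv v := R.dart_edge
  constructor
  · intro hx v
    have h := hx (R.dart v)
    rw [key, C.slope_dart R] at h
    exact h
  · refine fun h => R.forall_dart (fun v => ?_) (fun d hd => ?_)
    · rw [key, C.slope_dart R]
      exact h v
    · have h1 : C.edgeOf d.symm = C.edgeOf d := Subtype.ext d.edge_symm
      rw [h1, C.slope_symm, smul_neg, ← hd, neg_sub]
      rfl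

/-- The lattice of the cone of a combinatorial type is the lattice of the lengths of its bounded
edges, indexed by their clusters, and of the positions of the root. -/
theorem ParamType.exists_coneLattice_equiv (C : ParamType n) {p : Fin C.numVertices → _} {δ}
    (R : Rooting C.graph (C.endVertex e₀) p δ) :
    ∃ ψ : C.coneLattice ≃ₗ[ℤ]
        ((clusters (C.endVertex e₀) p C.endVertex e₀ → ℤ) × N),
      C.ev 𝒮 = coordEv 𝒮 (fun A : clusters (C.endVertex e₀) p C.endVertex e₀ => A.1) ∘ₗ
        ψ.toLinearMap := by
  classical
  have hval := C.two_le_branches R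
  have hinj := R.cluster_injective hval
  set F := clusters (C.endVertex e₀) p C.endVertex e₀ with hF
  have hvtx : ∀ A : F, ∃ v : {v // v ≠ C.endVertex e₀}, cluster p C.endVertex e₀ v.1 = A.1 :=
    fun A => by
      obtain ⟨v, hv, h⟩ := mem_clusters.1 A.2
      exact ⟨⟨v, hv⟩, h⟩
  choose vtx hvtx using hvtx
  have hmem : ∀ v : {v // v ≠ C.endVertex e₀}, cluster p C.endVertex e₀ v.1 ∈ F := fun v =>
    mem_clusters.2 ⟨v.1, v.2, rfl⟩
  have hvtx' : ∀ v, vtx ⟨_, hmem v⟩ = v := fun v => Subtype.ext (hinj (hvtx _))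
  -- the displacement along the edge with a given cluster
  let s : (F → ℤ) → Finset E → N := fun y A => if hA : A ∈ F then y ⟨A, hA⟩ • ∑ e ∈ A, n e else 0
  let f : C.coneLattice →ₗ[ℤ] ((F → ℤ) × N) :=
    { toFun := fun x => (fun A => x.1.1 (R.edgeEquiv (vtx A)), x.1.2 (C.endVertex e₀))
      map_add' := fun _ _ => rfl
      map_smul' := fun _ _ => rfl }
  have hstep : ∀ x : C.coneLattice, ∀ v, v ≠ C.endVertex e₀ →
      x.1.2 v = x.1.2 (p v) + s (f x).1 (cluster p C.endVertex e₀ v) := by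
    intro x v hv
    have h := (C.mem_coneLattice_iff R x.1).1 x.2 ⟨v, hv⟩
    have h1 : s (f x).1 (cluster p C.endVertex e₀ v) =
        x.1.1 (R.edgeEquiv ⟨v, hv⟩) • ∑ e ∈ cluster p C.endVertex e₀ v, n e := by
      simp only [s, f, LinearMap.coe_mk, AddHom.coe_mk]
      rw [dif_pos (hmem ⟨v, hv⟩), hvtx' ⟨v, hv⟩]
    rw [h1, ← h, add_sub_cancel]
  have hbij : Function.Bijective f := by
    constructor
    · rw [injective_iff_map_eq_zero]
      intro x hx
      have h1 : (f x).1 = 0 := by rw [hx]; rfl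
      have h2 : x.1.2 (C.endVertex e₀) = 0 := congrArg Prod.snd hx
      have h3 : ∀ v, x.1.2 v = 0 := fun v => by
        have h4 := R.eq_add_sum hval (hstep x) v
        rw [h4, h2, h1, zero_add]
        refine Finset.sum_eq_zero fun A _ => ?_
        simp [s]
      refine Subtype.ext (Prod.ext (funext fun b => ?_) (funext h3))
      have h4 := congrFun h1 ⟨_, hmem (R.edgeEquiv.symm b)⟩
      simp only [f, LinearMap.coe_mk, AddHom.coe_mk, hvtx', Equiv.apply_symm_apply] at h4
      exact h4
    · rintro ⟨y, h⟩
      refine ⟨⟨(fun b => y ⟨_, hmem (R.edgeEquiv.symm b)⟩, fun v => h +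
        ∑ A ∈ clusters (C.endVertex e₀) p C.endVertex e₀ with cluster p C.endVertex e₀ v ⊆ A,
          s y A), ?_⟩, ?_⟩
      · rw [C.mem_coneLattice_iff R]
        intro v
        simp only [Equiv.symm_apply_apply]
        rw [R.sum_filter_cluster hval _ v.2]
        simp only [s]
        rw [dif_pos (hmem v)]
        abel
      · refine Prod.ext (funext fun A => ?_) ?_
        · simp only [f, LinearMap.coe_mk, AddHom.coe_mk, Equiv.symm_apply_apply, hvtx]
        · simp only [f, LinearMap.coe_mk, AddHom.coe_mk]
          rw [R.sum_filter_cluster_root hval, add_zero]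
  refine ⟨LinearEquiv.ofBijective f hbij, LinearMap.ext fun x => funext fun e => ?_⟩
  have h1 : C.ev 𝒮 x e = toQ 𝒮 e (x.1.2 (C.endVertex e)) := rfl
  rw [h1, R.eq_add_sum hval (hstep x), R.sum_filter_end hval rfl, map_add, map_sum,
    LinearMap.comp_apply, coordEv_apply, add_comm]
  congr 1
  rw [Finset.sum_filter, ← Finset.sum_coe_sort]
  refine Finset.sum_congr rfl fun A _ => ?_
  rw [clusterVector]
  have h2 : s (f x).1 A.1 = (f x).1 A • ∑ e ∈ A.1, n e := by
    simp only [s]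
    rw [dif_pos A.2]
  split_ifs with h
  · rw [h2, map_smul]
    rfl
  · rw [smul_zero]

variable [Module.Free ℤ N] [Module.Finite ℤ N]

/-- The weight of a laminar family: the lattice determinant of the evaluation map. -/
noncomputable def weight (F : Finset (Finset E)) : ℕ := latticeDet (coordEv 𝒮 fun A : F => A.1)

theorem ParamType.mult_eq_weight (C : ParamType n) {p : Fin C.numVertices → _} {δ}
    (R : Rooting C.graph (C.endVertex e₀) p δ) :
    C.mult 𝒮 = weight 𝒮 (clusters (C.endVertex e₀) p C.endVertex e₀) := by
  obtain ⟨ψ, hψ⟩ := C.exists_coneLattice_equiv 𝒮 R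
  rw [ParamType.mult, hψ, latticeDet_comp_equiv, weight]

theorem ParamType.injective_ev_iff (C : ParamType n) {p : Fin C.numVertices → _} {δ}
    (R : Rooting C.graph (C.endVertex e₀) p δ) :
    Function.Injective (C.ev 𝒮) ↔ Function.Injective (coordEv 𝒮
      fun A : clusters (C.endVertex e₀) p C.endVertex e₀ => A.1) := by
  obtain ⟨ψ, hψ⟩ := C.exists_coneLattice_equiv 𝒮 R
  rw [hψ, LinearMap.coe_comp]
  exact Function.Injective.of_comp_iff' _ ψ.bijective

/-- The basis of the evaluation space that comes from bases of the lattices. -/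
noncomputable def evBasis : Basis (Σ e, Free.ChooseBasisIndex ℤ (𝒮.Q e)) ℤ (∀ e, 𝒮.Q e) :=
  Pi.basis fun e => Free.chooseBasis ℤ (𝒮.Q e)

/-- The real extension of `evBasis`. -/
noncomputable def realEvBasis : Basis (Σ e, Free.ChooseBasisIndex ℤ (𝒮.Q e)) ℝ (EvSpace 𝒮) :=
  Pi.basis fun e => (Free.chooseBasis ℤ (𝒮.Q e)).baseChange ℝ

/-- The columns of the evaluation map in the real vector space: the vectors of the clusters, and
the evaluations of the vectors of a basis of `N`. -/
noncomputable def columns {I : Type*} (g : I → Finset E) :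
    I ⊕ Free.ChooseBasisIndex ℤ N → EvSpace 𝒮 :=
  Sum.elim (fun i => realClusterVector 𝒮 (g i))
    fun j => pointEv 𝒮 ((1 : ℝ) ⊗ₜ Free.chooseBasis ℤ N j)

theorem abs_det_columns {I : Type*} [Fintype I] [DecidableEq I] (g : I → Finset E)
    (κ : (Σ e, Free.ChooseBasisIndex ℤ (𝒮.Q e)) ≃ I ⊕ Free.ChooseBasisIndex ℤ N) :
    |((realEvBasis 𝒮).reindex κ).det (columns 𝒮 g)| = latticeDet (coordEv 𝒮 g) := by
  classical
  let a := (Pi.basisFun ℤ I).prod (Free.chooseBasis ℤ N)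
  rw [latticeDet_eq a ((evBasis 𝒮).reindex κ), Nat.cast_natAbs, Int.cast_abs]
  congr 1
  rw [Basis.det_apply, Basis.det_apply, Int.cast_det]
  congr 1
  ext k i
  rw [Matrix.map_apply, Basis.toMatrix_apply, Basis.toMatrix_apply, Basis.repr_reindex_apply,
    Basis.repr_reindex_apply, realEvBasis, evBasis, Pi.basis_repr, Pi.basis_repr]
  have key : columns 𝒮 g i (κ.symm k).1 = (1 : ℝ) ⊗ₜ coordEv 𝒮 g (a i) (κ.symm k).1 := by
    rw [coordEv_apply]
    rcases i with i | j
    · simp [columns, a, realClusterVector, Pi.single_apply]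
    · simp [columns, a, pointEv]
  rw [key, Basis.baseChange_repr_tmul]
  simp

theorem latticeDet_coordEv_comp {I J : Type*} [Fintype I] [Fintype J] (σ : J ≃ I)
    (g : I → Finset E) : latticeDet (coordEv 𝒮 (g ∘ σ)) = latticeDet (coordEv 𝒮 g) := by
  rw [← latticeDet_comp_equiv (coordEv 𝒮 g)
    ((LinearEquiv.funCongrLeft ℤ ℤ σ.symm).prodCongr (LinearEquiv.refl ℤ N))]
  congr 1
  refine LinearMap.ext fun x => funext fun e => ?_
  rw [LinearMap.comp_apply, coordEv_apply, coordEv_apply]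
  congr 1
  refine Fintype.sum_equiv σ _ _ fun j => ?_
  simp [LinearEquiv.funCongrLeft, LinearMap.funLeft]

end Multiplicity

/-! ### The balancing condition of the fan of laminar families -/

section Balancing

open Module

set_option linter.unusedSectionVars false

variable {E N : Type*} [Fintype E] [DecidableEq E] [AddCommGroup N] {n : E → N} (𝒮 : Slopes n)
  {e₀ : E}

/-- The evaluation space modulo the translations of curves. -/
abbrev EvQuotient : Type _ := EvSpace 𝒮 ⧸ LinearMap.range (pointEv 𝒮)

/-- The vector of a cluster in the evaluation space modulo translations. -/
noncomputable def clusterRay (A : Finset E) : EvQuotient 𝒮 :=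
  (LinearMap.range (pointEv 𝒮)).mkQ (realClusterVector 𝒮 A)

theorem toQ_self (e : E) : toQ 𝒮 e (n e) = 0 := by
  have h : (Submodule.span ℤ {n e}).mkQ (n e) = 0 := by
    rw [Submodule.mkQ_apply, Submodule.Quotient.mk_eq_zero]
    exact Submodule.mem_span_singleton_self _
  rw [toQ, LinearMap.comp_apply, h, map_zero]

theorem clusterVector_singleton (e : E) : clusterVector 𝒮 {e} = 0 := by
  funext e'
  rw [clusterVector]
  split_ifs with h
  · obtain rfl := Finset.mem_singleton.1 h
    rw [Finset.sum_singleton, toQ_self]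
    rfl
  · rfl

theorem clusterVector_root (hn : ∑ e, n e = 0) :
    clusterVector 𝒮 (Finset.univ.erase e₀) = fun e => toQ 𝒮 e (- n e₀) := by
  funext e
  have h := Finset.sum_erase_add Finset.univ n (Finset.mem_univ e₀)
  rw [hn] at h
  rw [clusterVector, eq_neg_of_add_eq_zero_left h]
  split_ifs with he
  · rfl
  · have : e = e₀ := by simpa using he
    rw [this, map_neg, toQ_self, neg_zero]

theorem clusterVector_three {b₁ b₂ b₃ : Finset E} (h12 : Disjoint b₁ b₂) (h13 : Disjoint b₁ b₃)
    (h23 : Disjoint b₂ b₃) :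
    clusterVector 𝒮 (b₂ ∪ b₃) + clusterVector 𝒮 (b₁ ∪ b₃) + clusterVector 𝒮 (b₁ ∪ b₂) =
      clusterVector 𝒮 (b₁ ∪ b₂ ∪ b₃) + clusterVector 𝒮 b₁ + clusterVector 𝒮 b₂ +
        clusterVector 𝒮 b₃ := by
  have h123 : Disjoint (b₁ ∪ b₂) b₃ := Finset.disjoint_union_left.2 ⟨h13, h23⟩
  funext e
  simp only [Pi.add_apply, clusterVector, Finset.mem_union, Finset.sum_union h12,
    Finset.sum_union h13, Finset.sum_union h23, Finset.sum_union h123, map_add]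
  by_cases h1 : e ∈ b₁
  · have h2 := Finset.disjoint_left.1 h12 h1
    have h3 := Finset.disjoint_left.1 h13 h1
    simp only [h1, h2, h3, or_false, if_true, if_false]
    abel
  · by_cases h2 : e ∈ b₂
    · have h3 := Finset.disjoint_left.1 h23 h2
      simp only [h1, h2, h3, or_true, or_false, if_true, if_false]
      abel
    · by_cases h3 : e ∈ b₃
      · simp only [h1, h2, h3, or_true, or_false, if_true, if_false]
        abel
      · simp only [h1, h2, h3, or_false, if_false]
        abel

/-- The real points of the evaluation lattice, modulo translations. -/
noncomputable def toEvQuotient : (∀ e, 𝒮.Q e) →+ EvQuotient 𝒮 :=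
  (LinearMap.range (pointEv 𝒮)).mkQ.toAddMonoidHom.comp
    { toFun := fun w e => (1 : ℝ) ⊗ₜ w e
      map_zero' := funext fun _ => TensorProduct.tmul_zero _ _
      map_add' := fun _ _ => funext fun _ => TensorProduct.tmul_add _ _ _ }

theorem toEvQuotient_clusterVector (A : Finset E) :
    toEvQuotient 𝒮 (clusterVector 𝒮 A) = clusterRay 𝒮 A := rfl

theorem clusterRay_singleton (e : E) : clusterRay 𝒮 {e} = 0 := by
  rw [← toEvQuotient_clusterVector, clusterVector_singleton, map_zero]

/-- The slopes of all ends other than `e₀` sum to `- n e₀`. Moving the root in this direction does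
not change the evaluation at `e₀`. -/
theorem clusterRay_root (hn : ∑ e, n e = 0) : clusterRay 𝒮 (Finset.univ.erase e₀) = 0 := by
  rw [← toEvQuotient_clusterVector, clusterVector_root 𝒮 hn]
  change (LinearMap.range (pointEv 𝒮)).mkQ _ = 0
  rw [Submodule.mkQ_apply, Submodule.Quotient.mk_eq_zero]
  exact ⟨(1 : ℝ) ⊗ₜ (- n e₀), funext fun e => LinearMap.baseChange_tmul _ _ _⟩

/-- The balancing condition: the vectors of the clusters by which a laminar family of codimension
one can be enlarged sum to an element of the span of the family. -/
theorem IsLaminar.balancing (hE : 3 ≤ Fintype.card E) (hn : ∑ e, n e = 0)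
    {τ : Finset (Finset E)} (hτ : IsLaminar e₀ τ) (hc : τ.card + 4 = Fintype.card E) :
    ∑ A with A ∉ τ ∧ insert A τ ∈ laminarFamilies e₀, clusterRay 𝒮 A ∈
      Submodule.span ℝ (clusterRay 𝒮 '' τ) := by
  obtain ⟨b₁, b₂, b₃, h12, h13, h23, hb, hb123, hsum⟩ := hτ.exists_three_resolutions hE hc
  have hmem : ∀ A ∈ τ, clusterRay 𝒮 A ∈ Submodule.span ℝ (clusterRay 𝒮 '' τ) := fun A hA =>
    Submodule.subset_span ⟨A, hA, rfl⟩
  have hbr : ∀ b ∈ ({b₁, b₂, b₃} : Finset (Finset E)),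
      clusterRay 𝒮 b ∈ Submodule.span ℝ (clusterRay 𝒮 '' τ) := by
    intro b hbm
    rcases hb b hbm with h | ⟨e, rfl⟩
    · exact hmem b h
    · rw [clusterRay_singleton]
      exact Submodule.zero_mem _
  rw [hsum]
  have h := congrArg (toEvQuotient 𝒮) (clusterVector_three 𝒮 h12 h13 h23)
  simp only [map_add, toEvQuotient_clusterVector] at h
  rw [h]
  refine Submodule.add_mem _ (Submodule.add_mem _ (Submodule.add_mem _ ?_ (hbr b₁ (by simp)))
    (hbr b₂ (by simp))) (hbr b₃ (by simp))
  rcases hb123 with h | h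
  · exact hmem _ h
  · rw [h, clusterRay_root 𝒮 hn]
    exact Submodule.zero_mem _

variable [Module.Free ℤ N] [Module.Finite ℤ N]

theorem exists_indexEquiv {I : Type*} [Fintype I] (hI : Fintype.card I + 3 = Fintype.card E)
    (hdim : (∑ e, 𝒮.corank e) + 3 = Fintype.card E + finrank ℤ N) :
    Nonempty ((Σ e, Free.ChooseBasisIndex ℤ (𝒮.Q e)) ≃ I ⊕ Free.ChooseBasisIndex ℤ N) := by
  refine ⟨Fintype.equivOfCardEq ?_⟩
  rw [Fintype.card_sigma, Fintype.card_sum, ← finrank_eq_card_chooseBasisIndex]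
  simp only [← finrank_eq_card_chooseBasisIndex]
  change ∑ e, 𝒮.corank e = _
  omega

theorem finrank_evSpace : finrank ℝ (EvSpace 𝒮) = ∑ e, 𝒮.corank e := by
  rw [finrank_pi_fintype]
  exact Finset.sum_congr rfl fun e _ => finrank_baseChange

theorem finrank_evQuotient (hinj : Function.Injective (pointEv 𝒮))
    (hdim : (∑ e, 𝒮.corank e) + 3 = Fintype.card E + finrank ℤ N) :
    finrank ℝ (EvQuotient 𝒮) + 3 = Fintype.card E := by
  have h1 := Submodule.finrank_quotient_add_finrank (LinearMap.range (pointEv 𝒮))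
  rw [LinearMap.finrank_range_of_inj hinj, finrank_evSpace, finrank_baseChange] at h1
  change finrank ℝ (EvQuotient 𝒮) + _ = _ at h1
  omega

theorem range_pointEv : LinearMap.range (pointEv 𝒮) = Submodule.span ℝ (Set.range
    fun j => pointEv 𝒮 ((1 : ℝ) ⊗ₜ Free.chooseBasis ℤ N j)) := by
  rw [LinearMap.range_eq_map, ← ((Free.chooseBasis ℤ N).baseChange ℝ).span_eq, Submodule.map_span,
    ← Set.range_comp]
  congr 2
  funext j
  simp

/-- For a family of codimension one there is a linear form that vanishes on its span and whose value
on the vector of a further cluster is, up to sign, the weight of the enlarged family: the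
determinant in which the column of the further cluster is the variable. -/
theorem exists_weight_form {τ : Finset (Finset E)} (hc : τ.card + 4 = Fintype.card E)
    (hdim : (∑ e, 𝒮.corank e) + 3 = Fintype.card E + finrank ℤ N) :
    ∃ φ : EvQuotient 𝒮 →ₗ[ℝ] ℝ, (∀ B ∈ τ, φ (clusterRay 𝒮 B) = 0) ∧
      ∀ A ∉ τ, |φ (clusterRay 𝒮 A)| = weight 𝒮 (insert A τ) := by
  classical
  obtain ⟨κ⟩ := exists_indexEquiv 𝒮 (I := Option τ) (by simp; omega) hdim
  let g : Finset E → Option τ → Finset E := fun A o => o.elim A fun B => B.1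
  let b := (realEvBasis 𝒮).reindex κ
  let Φ : EvSpace 𝒮 →ₗ[ℝ] ℝ :=
    b.det.toMultilinearMap.toLinearMap (columns 𝒮 (g ∅)) (Sum.inl none)
  have hΦ : ∀ x, Φ x = b.det (Function.update (columns 𝒮 (g ∅)) (Sum.inl none) x) := fun _ => rfl
  -- the determinant vanishes when the variable column equals another column
  have hzero : ∀ i, i ≠ Sum.inl none → Φ (columns 𝒮 (g ∅) i) = 0 := by
    intro i hi
    rw [hΦ]
    refine b.det.map_eq_zero_of_eq _ (i := Sum.inl none) (j := i) ?_ hi.symm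
    rw [Function.update_self, Function.update_of_ne hi]
  have hker : LinearMap.range (pointEv 𝒮) ≤ LinearMap.ker Φ := by
    rw [range_pointEv, Submodule.span_le]
    rintro _ ⟨j, rfl⟩
    exact hzero (Sum.inr j) (by simp)
  have hlift : ∀ A, Submodule.liftQ _ Φ hker (clusterRay 𝒮 A) = Φ (realClusterVector 𝒮 A) :=
    fun A => Submodule.liftQ_apply _ _ _
  refine ⟨Submodule.liftQ _ Φ hker, fun B hB => ?_, fun A hA => ?_⟩
  · rw [hlift]
    exact hzero (Sum.inl (some ⟨B, hB⟩)) (by simp)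
  · have h1 : Function.update (columns 𝒮 (g ∅)) (Sum.inl none) (realClusterVector 𝒮 A) =
        columns 𝒮 (g A) := by
      funext i
      rcases i with (_ | B) | j
      · simp [columns, g]
      · rw [Function.update_of_ne (by simp)]
        rfl
      · rw [Function.update_of_ne (by simp)]
        rfl
    rw [hlift, hΦ, h1, abs_det_columns, weight,
      ← latticeDet_coordEv_comp 𝒮 (Finset.subtypeInsertEquivOption hA).symm]
    congr 3
    funext o
    rcases o with _ | B <;> rfl

theorem injective_coordEv_iff {F : Finset (Finset E)} (hc : F.card + 3 = Fintype.card E)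
    (hdim : (∑ e, 𝒮.corank e) + 3 = Fintype.card E + finrank ℤ N) :
    Function.Injective (coordEv 𝒮 fun A : F => A.1) ↔
      LinearIndependent ℝ (columns 𝒮 fun A : F => A.1) := by
  classical
  obtain ⟨κ⟩ := exists_indexEquiv 𝒮 (I := F) (by simpa using hc) hdim
  rw [← latticeDet_ne_zero_iff ((Pi.basisFun ℤ F).prod (Free.chooseBasis ℤ N))
    ((evBasis 𝒮).reindex κ)]
  have h1 := abs_det_columns 𝒮 (fun A : F => A.1) κ
  have h2 : LinearIndependent ℝ (columns 𝒮 fun A : F => A.1) ↔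
      IsUnit (((realEvBasis 𝒮).reindex κ).det (columns 𝒮 fun A : F => A.1)) := by
    rw [← Basis.is_basis_iff_det]
    refine ⟨fun h => ⟨h, ?_⟩, fun h => h.1⟩
    exact h.span_eq_top_of_card_eq_finrank'
      (finrank_eq_card_basis ((realEvBasis 𝒮).reindex κ)).symm
  rw [h2, isUnit_iff_ne_zero, ← abs_ne_zero, h1, Nat.cast_ne_zero]

theorem injective_pointEv_of_columns {I : Type*} [Fintype I] {g : I → Finset E}
    (h : LinearIndependent ℝ (columns 𝒮 g)) : Function.Injective (pointEv 𝒮) := by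
  have h1 := h.comp Sum.inr Sum.inr_injective
  rw [Fintype.linearIndependent_iff] at h1
  rw [injective_iff_map_eq_zero]
  intro y hy
  let b := (Free.chooseBasis ℤ N).baseChange ℝ
  have h2 := h1 (b.repr y) (by
    rw [← hy]
    conv_rhs => rw [← b.sum_repr y, map_sum]
    exact Finset.sum_congr rfl fun j _ => by simp [b, columns])
  apply b.repr.injective
  ext j
  rw [h2 j, map_zero]
  rfl

theorem isBase_of_columns {F : Finset (Finset E)} (hc : F.card + 3 = Fintype.card E)
    (hdim : (∑ e, 𝒮.corank e) + 3 = Fintype.card E + finrank ℤ N)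
    (h : LinearIndependent ℝ (columns 𝒮 fun A : F => A.1)) : IsBase (clusterRay 𝒮) F := by
  have hrank := finrank_evQuotient 𝒮 (injective_pointEv_of_columns 𝒮 h) hdim
  refine ⟨?_, by omega⟩
  rw [linearIndepOn_finset_iff]
  intro c hsum A hA
  have hmem : ∑ A ∈ F, c A • realClusterVector 𝒮 A ∈ LinearMap.range (pointEv 𝒮) := by
    rw [← Submodule.Quotient.mk_eq_zero, ← Submodule.mkQ_apply, map_sum, ← hsum]
    exact Finset.sum_congr rfl fun A _ => map_smul _ _ _
  obtain ⟨y, hy⟩ := hmem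
  let b := (Free.chooseBasis ℤ N).baseChange ℝ
  rw [Fintype.linearIndependent_iff] at h
  have h1 := h (Sum.elim (fun A => c A.1) fun j => - b.repr y j) (by
    have h2 : ∑ j, b.repr y j • pointEv 𝒮 ((1 : ℝ) ⊗ₜ Free.chooseBasis ℤ N j) =
        pointEv 𝒮 y := by
      conv_rhs => rw [← b.sum_repr y, map_sum]
      exact Finset.sum_congr rfl fun j _ => by simp [b]
    rw [Fintype.sum_sum_type]
    simp only [Sum.elim_inl, Sum.elim_inr, columns, neg_smul, Finset.sum_neg_distrib]
    rw [h2, hy, ← Finset.sum_coe_sort F fun A => c A • realClusterVector 𝒮 A, add_neg_cancel])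
  exact h1 (Sum.inl ⟨A, hA⟩)

end Balancing

/-! ### Solutions and their count -/

section Solutions

open Module

set_option linter.unusedSectionVars false

variable {E N : Type*} [Fintype E] [DecidableEq E] [AddCommGroup N] [Module.Free ℤ N]
  [Module.Finite ℤ N] {n : E → N} {𝒮 : Slopes n} {e₀ : E}

theorem EncodedBy.isLaminar {Γ : Curve n} {p δ} {ℓ : Finset E → ℝ} {h₀ : ℝ ⊗[ℤ] N}
    (h : EncodedBy Γ e₀ p δ ℓ h₀) :
    IsLaminar e₀ (clusters (Γ.endVertex e₀) p Γ.endVertex e₀) :=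
  h.rooting.isLaminar_clusters h.branches

/-- Every point of the image of a cone is the evaluation of a curve with the clusters of this
cone. -/
theorem IsLaminar.exists_curve_reduce_ev (hE : 3 ≤ Fintype.card E) (hn : ∑ e, n e = 0)
    {F : Finset (Finset E)} (hF : IsLaminar e₀ F) {q : EvSpace 𝒮}
    (hq : OpenCone (clusterRay 𝒮) F ((LinearMap.range (pointEv 𝒮)).mkQ q)) :
    ∃ (Γ : Curve n) (p : _) (δ : _) (ℓ : Finset E → ℝ) (h₀ : ℝ ⊗[ℤ] N),
      EncodedBy Γ e₀ p δ ℓ h₀ ∧ clusters (Γ.endVertex e₀) p Γ.endVertex e₀ = F ∧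
      reduce 𝒮 Γ.ev = q := by
  classical
  obtain ⟨c, hc, hsum⟩ := hq
  have hmem : q - ∑ A ∈ F, c A • realClusterVector 𝒮 A ∈ LinearMap.range (pointEv 𝒮) := by
    rw [← Submodule.Quotient.mk_eq_zero, ← Submodule.mkQ_apply, map_sub, ← hsum, map_sum,
      sub_eq_zero]
    exact Finset.sum_congr rfl fun A _ => (map_smul _ _ _).symm
  obtain ⟨h₀, hh₀⟩ := hmem
  let ℓ : Finset E → ℝ := fun A => if A ∈ F then c A else 0
  have hℓ : ∀ A ∈ F, ℓ A = c A := fun A hA => if_pos hA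
  obtain ⟨Γ, p, δ, h⟩ := hF.exists_curve hE hn (ℓ := ℓ) (n := n)
    (fun A hA => (hℓ A hA).symm ▸ hc A hA) (fun A hA => if_neg hA) h₀
  have hFc : clusters (Γ.endVertex e₀) p Γ.endVertex e₀ = F := by
    ext A
    rw [h.mem_clusters_iff]
    refine ⟨fun hA => by_contra fun hA' => hA (if_neg hA'), fun hA => ?_⟩
    rw [hℓ A hA]
    exact (hc A hA).ne'
  refine ⟨Γ, p, δ, ℓ, h₀, h, hFc, ?_⟩
  have hsum' : ∑ A ∈ F, ℓ A • realClusterVector 𝒮 A = ∑ A ∈ F, c A • realClusterVector 𝒮 A :=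
    Finset.sum_congr rfl fun A hA => by rw [hℓ A hA]
  rw [h.reduce_ev, hFc, hh₀, hsum', sub_add_cancel]

/-- Modulo translations, the evaluations of a curve lie in the cone of its clusters. -/
theorem EncodedBy.openCone {Γ : Curve n} {p δ} {ℓ : Finset E → ℝ} {h₀ : ℝ ⊗[ℤ] N}
    (h : EncodedBy Γ e₀ p δ ℓ h₀) :
    OpenCone (clusterRay 𝒮) (clusters (Γ.endVertex e₀) p Γ.endVertex e₀)
      ((LinearMap.range (pointEv 𝒮)).mkQ (reduce 𝒮 Γ.ev)) := by
  refine ⟨ℓ, fun A hA => h.pos_of_mem hA, ?_⟩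
  have h1 : (LinearMap.range (pointEv 𝒮)).mkQ (pointEv 𝒮 h₀) = 0 := by
    rw [Submodule.mkQ_apply, Submodule.Quotient.mk_eq_zero]
    exact LinearMap.mem_range_self _ _
  rw [h.reduce_ev, map_add, h1, zero_add, map_sum]
  exact Finset.sum_congr rfl fun A _ => (map_smul _ _ _).symm

/-- For a solution of generic constraints the evaluation map is given by a square matrix with
independent columns. -/
theorem EncodedBy.columns_of_generic
    (hdim : (∑ e, 𝒮.corank e) + 3 = Fintype.card E + finrank ℤ N)
    {𝓛 : Constraints n} (hgen : 𝓛.IsGeneric 𝒮) {Γ : Curve n} (hΓ : Γ.Solves 𝓛)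
    {p δ} {ℓ : Finset E → ℝ} {h₀ : ℝ ⊗[ℤ] N} (h : EncodedBy Γ e₀ p δ ℓ h₀) :
    (clusters (Γ.endVertex e₀) p Γ.endVertex e₀).card + 3 = Fintype.card E ∧
      LinearIndependent ℝ
        (columns 𝒮 fun A : clusters (Γ.endVertex e₀) p Γ.endVertex e₀ => A.1) := by
  obtain ⟨htri, hinj⟩ := hgen Γ hΓ
  have hc := (Γ.isTrivalent_iff h.rooting).1 htri
  refine ⟨hc, ?_⟩
  rw [← injective_coordEv_iff 𝒮 hc hdim]
  exact (Γ.toParamType.injective_ev_iff 𝒮 h.rooting).1 hinj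

/-- If some translation leaves all evaluations unchanged, generic constraints have no solutions. -/
theorem injective_pointEv_of_solves
    (hdim : (∑ e, 𝒮.corank e) + 3 = Fintype.card E + finrank ℤ N)
    {𝓛 : Constraints n} (hgen : 𝓛.IsGeneric 𝒮) {Γ : Curve n} (hΓ : Γ.Solves 𝓛) (e₀ : E) :
    Function.Injective (pointEv 𝒮) := by
  obtain ⟨p, δ, ℓ, h₀, h⟩ := exists_encodedBy Γ e₀
  exact injective_pointEv_of_columns 𝒮 (h.columns_of_generic hdim hgen hΓ).2

theorem Constraints.IsGeneric.fanGeneric (hE : 3 ≤ Fintype.card E) (hn : ∑ e, n e = 0)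
    (hdim : (∑ e, 𝒮.corank e) + 3 = Fintype.card E + finrank ℤ N)
    {𝓛 : Constraints n} (hgen : 𝓛.IsGeneric 𝒮) {q : EvSpace 𝒮}
    (hq : ∀ Γ : Curve n, Γ.Solves 𝓛 ↔ reduce 𝒮 Γ.ev = q) :
    FanGeneric (clusterRay 𝒮) (laminarFamilies e₀) ((LinearMap.range (pointEv 𝒮)).mkQ q) := by
  intro F hF hoc
  obtain ⟨Γ, p, δ, ℓ, h₀, h, rfl, hev⟩ :=
    (mem_laminarFamilies.1 hF).exists_curve_reduce_ev hE hn hoc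
  obtain ⟨hc, hli⟩ := h.columns_of_generic hdim hgen ((hq Γ).2 hev)
  exact isBase_of_columns 𝒮 hc hdim hli

/-- The solutions of generic constraints correspond to the cones of the fan of laminar families
that contain the given point. -/
theorem exists_bijOn_solutions (hE : 3 ≤ Fintype.card E) (hn : ∑ e, n e = 0)
    (hdim : (∑ e, 𝒮.corank e) + 3 = Fintype.card E + finrank ℤ N)
    {𝓛 : Constraints n} (hgen : 𝓛.IsGeneric 𝒮) {q : EvSpace 𝒮}
    (hq : ∀ Γ : Curve n, Γ.Solves 𝓛 ↔ reduce 𝒮 Γ.ev = q) (e₀ : E) :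
    ∃ Ψ : Finset (Finset E) → Moduli n,
      Set.BijOn Ψ {F | IsLaminar e₀ F ∧
        OpenCone (clusterRay 𝒮) F ((LinearMap.range (pointEv 𝒮)).mkQ q)} (solutions 𝓛) ∧
      ∀ F, IsLaminar e₀ F →
        OpenCone (clusterRay 𝒮) F ((LinearMap.range (pointEv 𝒮)).mkQ q) →
        Moduli.mult 𝒮 (Ψ F) = weight 𝒮 F := by
  classical
  have hchoice : ∀ F : Finset (Finset E), ∃ x : Moduli n, IsLaminar e₀ F →
      OpenCone (clusterRay 𝒮) F ((LinearMap.range (pointEv 𝒮)).mkQ q) →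
      ∃ (Γ : Curve n) (p : _) (δ : _) (ℓ : Finset E → ℝ) (h₀ : ℝ ⊗[ℤ] N),
        EncodedBy Γ e₀ p δ ℓ h₀ ∧ clusters (Γ.endVertex e₀) p Γ.endVertex e₀ = F ∧
        reduce 𝒮 Γ.ev = q ∧ ⟦Γ⟧ = x := by
    intro F
    by_cases hF : IsLaminar e₀ F ∧
        OpenCone (clusterRay 𝒮) F ((LinearMap.range (pointEv 𝒮)).mkQ q)
    · obtain ⟨Γ, p, δ, ℓ, h₀, h1, h2, h3⟩ := hF.1.exists_curve_reduce_ev hE hn hF.2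
      exact ⟨⟦Γ⟧, fun _ _ => ⟨Γ, p, δ, ℓ, h₀, h1, h2, h3, rfl⟩⟩
    · obtain ⟨Γ, -⟩ := IsLaminar.exists_curve (e₀ := e₀) hE hn (F := ∅) (ℓ := 0) (n := n)
        ⟨by simp, by simp⟩ (by simp) (by simp) 0
      exact ⟨⟦Γ⟧, fun h1 h2 => absurd ⟨h1, h2⟩ hF⟩
  choose Ψ hΨ using hchoice
  refine ⟨Ψ, ⟨?_, ?_, ?_⟩, ?_⟩
  · rintro F ⟨hF, hoc⟩
    obtain ⟨Γ, p, δ, ℓ, h₀, -, -, h3, h4⟩ := hΨ F hF hoc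
    exact ⟨Γ, h4, (hq Γ).2 h3⟩
  · rintro F ⟨hF, hoc⟩ F' ⟨hF', hoc'⟩ heq
    obtain ⟨Γ, p, δ, ℓ, h₀, h1, h2, -, h4⟩ := hΨ F hF hoc
    obtain ⟨Γ', p', δ', ℓ', h₀', h1', h2', -, h4'⟩ := hΨ F' hF' hoc'
    obtain ⟨φ⟩ : Nonempty (CurveIso Γ Γ') := Quotient.exact (h4.trans (heq.trans h4'.symm))
    have hℓ := (h1.eq_of_iso h1' φ).1
    rw [← h2, ← h2']
    ext A
    rw [h1.mem_clusters_iff, h1'.mem_clusters_iff, hℓ]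
  · rintro x ⟨Γ, rfl, hΓ⟩
    obtain ⟨p, δ, ℓ, h₀, h⟩ := exists_encodedBy Γ e₀
    have hev := (hq Γ).1 hΓ
    have hoc := h.openCone (𝒮 := 𝒮)
    rw [hev] at hoc
    refine ⟨_, ⟨h.isLaminar, hoc⟩, ?_⟩
    obtain ⟨Γ', p', δ', ℓ', h₀', h1', h2', h3', h4'⟩ := hΨ _ h.isLaminar hoc
    rw [← h4']
    -- by independence, the two curves have the same lengths and the same root position
    obtain ⟨hc, hli⟩ := h.columns_of_generic hdim hgen hΓ
    have hb := isBase_of_columns 𝒮 hc hdim hli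
    have hinj := injective_pointEv_of_columns 𝒮 hli
    have e1 := h.reduce_ev 𝒮
    have e2 := h1'.reduce_ev 𝒮
    rw [hev] at e1
    rw [h3', h2'] at e2
    have hpt : ∀ y, (LinearMap.range (pointEv 𝒮)).mkQ (pointEv 𝒮 y) = 0 := fun y => by
      rw [Submodule.mkQ_apply, Submodule.Quotient.mk_eq_zero]
      exact LinearMap.mem_range_self _ _
    have hmk := congrArg (LinearMap.range (pointEv 𝒮)).mkQ (e2.symm.trans e1)
    simp only [map_add, hpt, zero_add, map_sum, map_smul] at hmk
    have hcoef := coeff_eq_of_linearIndepOn hb.1 hmk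
    have hℓ : ℓ' = ℓ := by
      funext A
      by_cases hA : A ∈ clusters (Γ.endVertex e₀) p Γ.endVertex e₀
      · exact hcoef A hA
      · rw [h.eq_zero A hA, h1'.eq_zero A (h2' ▸ hA)]
    have hh : h₀' = h₀ := by
      apply hinj
      rw [hℓ] at e2
      exact add_right_cancel (e2.symm.trans e1)
    subst hℓ hh
    exact Quotient.sound (h1'.nonempty_iso h)
  · intro F hF hoc
    obtain ⟨Γ, p, δ, ℓ, h₀, h1, h2, -, h4⟩ := hΨ F hF hoc
    rw [← h4, ← h2]
    exact Γ.toParamType.mult_eq_weight 𝒮 h1.rooting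

theorem finite_solutions (hE : 3 ≤ Fintype.card E) (hn : ∑ e, n e = 0)
    (hdim : (∑ e, 𝒮.corank e) + 3 = Fintype.card E + finrank ℤ N)
    {𝓛 : Constraints n} (hs : 𝓛.HasSlopes 𝒮) (hgen : 𝓛.IsGeneric 𝒮) : (solutions 𝓛).Finite := by
  obtain ⟨e₀⟩ : Nonempty E := Fintype.card_pos_iff.1 (by omega)
  obtain ⟨q, hq⟩ := hs.exists_solves_iff
  obtain ⟨Ψ, hbij, -⟩ := exists_bijOn_solutions hE hn hdim hgen hq e₀
  rw [← hbij.image_eq]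
  exact (Set.toFinite _).image Ψ

theorem count_eq_degreeAt (hE : 3 ≤ Fintype.card E) (hn : ∑ e, n e = 0)
    (hdim : (∑ e, 𝒮.corank e) + 3 = Fintype.card E + finrank ℤ N)
    {𝓛 : Constraints n} (hgen : 𝓛.IsGeneric 𝒮) {q : EvSpace 𝒮}
    (hq : ∀ Γ : Curve n, Γ.Solves 𝓛 ↔ reduce 𝒮 Γ.ev = q) (e₀ : E) :
    (count 𝒮 𝓛 : ℝ) = degreeAt (clusterRay 𝒮) (laminarFamilies e₀) (fun F => weight 𝒮 F)
      ((LinearMap.range (pointEv 𝒮)).mkQ q) := by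
  classical
  have hfan := hgen.fanGeneric (e₀ := e₀) hE hn hdim hq
  obtain ⟨Ψ, hbij, hmult⟩ := exists_bijOn_solutions hE hn hdim hgen hq e₀
  set x := (LinearMap.range (pointEv 𝒮)).mkQ q
  let S : Finset (Finset (Finset E)) :=
    (laminarFamilies e₀).filter fun F => OpenCone (clusterRay 𝒮) F x
  have hS : {F | IsLaminar e₀ F ∧ OpenCone (clusterRay 𝒮) F x} = (S : Set (Finset (Finset E))) := by
    ext F
    simp [S, mem_laminarFamilies]
  have h1 : count 𝒮 𝓛 = ∑ F ∈ S, weight 𝒮 F := by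
    rw [count, ← finsum_mem_eq_of_bijOn (f := fun F => weight 𝒮 F) Ψ hbij
      fun F hF => (hmult F hF.1 hF.2).symm, hS, finsum_mem_coe_finset]
  rw [h1, degreeAt, Nat.cast_sum, ← Finset.sum_filter, Finset.filter_filter]
  refine Finset.sum_congr (Finset.filter_congr fun F hF => ?_) fun _ _ => rfl
  exact ⟨fun h => ⟨hfan F hF h, h⟩, fun h => h.2⟩

/-- The count of the solutions is the same for any two generic families of constraints. -/
theorem count_eq_of_generic (hE : 3 ≤ Fintype.card E) (hn : ∑ e, n e = 0)
    (hdim : (∑ e, 𝒮.corank e) + 3 = Fintype.card E + finrank ℤ N)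
    {𝓛 𝓛' : Constraints n} (hs : 𝓛.HasSlopes 𝒮) (hs' : 𝓛'.HasSlopes 𝒮)
    (hgen : 𝓛.IsGeneric 𝒮) (hgen' : 𝓛'.IsGeneric 𝒮) : count 𝒮 𝓛 = count 𝒮 𝓛' := by
  classical
  obtain ⟨e₀⟩ : Nonempty E := Fintype.card_pos_iff.1 (by omega)
  obtain ⟨q, hq⟩ := hs.exists_solves_iff
  obtain ⟨q', hq'⟩ := hs'.exists_solves_iff
  by_cases hinj : Function.Injective (pointEv 𝒮)
  · have hrank := finrank_evQuotient 𝒮 hinj hdim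
    have key : (count 𝒮 𝓛 : ℝ) = count 𝒮 𝓛' := by
      rw [count_eq_degreeAt hE hn hdim hgen hq e₀, count_eq_degreeAt hE hn hdim hgen' hq' e₀]
      refine degreeAt_eq (fun F hF τ hτ => ?_) (fun F hF => ?_) (fun τ hτ hc => ?_)
        (hgen.fanGeneric hE hn hdim hq) (hgen'.fanGeneric hE hn hdim hq')
      · exact mem_laminarFamilies.2 ((mem_laminarFamilies.1 hF).mono hτ)
      · obtain ⟨k, G, ε, p, δ, R, hval, rfl⟩ := (mem_laminarFamilies.1 hF).exists_tree hE
        have := R.card_clusters_le hval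
        omega
      · have hc' : τ.card + 4 = Fintype.card E := by omega
        obtain ⟨φ, hφ, hφw⟩ := exists_weight_form 𝒮 hc' hdim
        refine ⟨φ, hφ, fun A hA _ => hφw A hA, ?_⟩
        have hbal := (mem_laminarFamilies.1 hτ).balancing 𝒮 hE hn hc'
        have hle : Submodule.span ℝ (clusterRay 𝒮 '' τ) ≤ LinearMap.ker φ := by
          rw [Submodule.span_le]
          rintro _ ⟨B, hB, rfl⟩
          exact hφ B hB
        rw [← map_sum]
        exact hle hbal
    exact_mod_cast key
  · have hempty : ∀ 𝓛 : Constraints n, 𝓛.IsGeneric 𝒮 → count 𝒮 𝓛 = 0 := by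
      intro 𝓛 hgen
      have : solutions 𝓛 = ∅ := by
        rw [Set.eq_empty_iff_forall_notMem]
        rintro x ⟨Γ, -, hΓ⟩
        exact hinj (injective_pointEv_of_solves hdim hgen hΓ e₀)
      rw [count, this, finsum_mem_empty]
    rw [hempty 𝓛 hgen, hempty 𝓛' hgen']

/-- The linear span of the evaluations of the curves whose family of clusters is `F`. -/
noncomputable def coneSpan (𝒮 : Slopes n) (F : Finset (Finset E)) : Submodule ℝ (EvSpace 𝒮) :=
  Submodule.span ℝ (realClusterVector 𝒮 '' F) ⊔ LinearMap.range (pointEv 𝒮)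

theorem coneSpan_eq_span_columns (F : Finset (Finset E)) :
    coneSpan 𝒮 F = Submodule.span ℝ (Set.range (columns 𝒮 fun A : F => A.1)) := by
  rw [columns, Set.Sum.elim_range, Submodule.span_union, coneSpan, range_pointEv]
  congr 2
  ext
  simp

/-- Constraints through a point outside of the proper subspaces spanned by cones are generic. -/
theorem isGeneric_through
    (hdim : (∑ e, 𝒮.corank e) + 3 = Fintype.card E + finrank ℤ N) (e₀ : E)
    {x : ∀ e, ℝ ⊗[ℤ] (N ⧸ Submodule.span ℤ {n e})}
    (hx : ∀ F : Finset (Finset E), reduce 𝒮 x ∈ coneSpan 𝒮 F → coneSpan 𝒮 F = ⊤) :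
    (𝒮.through x).IsGeneric 𝒮 := by
  intro Γ hΓ
  obtain ⟨p, δ, ℓ, h₀, h⟩ := exists_encodedBy Γ e₀
  have hev := (𝒮.solves_through_iff x Γ).1 hΓ
  set F := clusters (Γ.endVertex e₀) p Γ.endVertex e₀ with hF
  have hmem : reduce 𝒮 x ∈ coneSpan 𝒮 F := by
    rw [← hev, h.reduce_ev, add_comm]
    exact Submodule.add_mem_sup (Submodule.sum_mem _ fun A hA => Submodule.smul_mem _ _
      (Submodule.subset_span ⟨A, hA, rfl⟩)) (LinearMap.mem_range_self _ _)
  have htop := hx F hmem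
  rw [coneSpan_eq_span_columns] at htop
  have hle := h.rooting.card_clusters_le h.branches
  rw [← hF] at hle
  have hcard : Fintype.card (F ⊕ Free.ChooseBasisIndex ℤ N) = F.card + finrank ℤ N := by
    rw [Fintype.card_sum, Fintype.card_coe, finrank_eq_card_chooseBasisIndex]
  -- the columns span, so that there are at least as many as the dimension of the target
  have hge := finrank_range_le_card (R := ℝ) (columns 𝒮 fun A : F => A.1)
  rw [Set.finrank, htop, finrank_top, finrank_evSpace, hcard] at hge
  have hc : F.card + 3 = Fintype.card E := by omega
  refine ⟨(Γ.isTrivalent_iff h.rooting).2 hc, ?_⟩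
  rw [Γ.toParamType.injective_ev_iff 𝒮 h.rooting, injective_coordEv_iff 𝒮 hc hdim]
  refine linearIndependent_of_top_le_span_of_card_eq_finrank htop.ge ?_
  rw [hcard, finrank_evSpace]
  omega

end Solutions

end TropicalCount

theorem mainTheorem3 {E N : Type*} [Fintype E] [AddCommGroup N] [Module.Free ℤ N]
    [Module.Finite ℤ N] (hr : 2 ≤ Module.finrank ℤ N) (hE : 3 ≤ Fintype.card E)
    (n : E → N) (hn : ∑ e, n e = 0) (𝒮 : Slopes n)
    (hdim : (∑ e, 𝒮.corank e) + 3 = Fintype.card E + Module.finrank ℤ N) :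
    (∃ B : Finset (Submodule ℝ (∀ e, ℝ ⊗[ℤ] (N ⧸ Submodule.span ℤ {n e}))),
      (∀ W ∈ B, W ≠ ⊤) ∧
      ∀ p, (∀ W ∈ B, p ∉ W) → (𝒮.through p).IsGeneric 𝒮) ∧
    (∀ 𝓛 : Constraints n, 𝓛.HasSlopes 𝒮 → 𝓛.IsGeneric 𝒮 →
      (solutions 𝓛).Finite ∧ ∀ Γ : Curve n, Γ.Solves 𝓛 → Γ.IsTrivalent) ∧
    (∀ 𝓛 𝓛' : Constraints n, 𝓛.HasSlopes 𝒮 → 𝓛'.HasSlopes 𝒮 →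
      𝓛.IsGeneric 𝒮 → 𝓛'.IsGeneric 𝒮 → count 𝒮 𝓛 = count 𝒮 𝓛') := by
  classical
  obtain ⟨e₀⟩ : Nonempty E := Fintype.card_pos_iff.1 (by omega)
  refine ⟨?_, fun 𝓛 hs hgen => ⟨finite_solutions hE hn hdim hs hgen, fun Γ hΓ => (hgen Γ hΓ).1⟩,
    fun 𝓛 𝓛' hs hs' hgen hgen' => count_eq_of_generic hE hn hdim hs hs' hgen hgen'⟩
  let W : Finset (Finset E) → Submodule ℝ (∀ e, ℝ ⊗[ℤ] (N ⧸ Submodule.span ℤ {n e})) :=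
    fun F => (coneSpan 𝒮 F).comap (reduce 𝒮)
  refine ⟨(Finset.univ.image W).filter (· ≠ ⊤), fun V hV => (Finset.mem_filter.1 hV).2,
    fun x hx => isGeneric_through hdim e₀ fun F hF => ?_⟩
  have hW : W F = ⊤ := by
    by_contra hne
    exact hx (W F) (Finset.mem_filter.2 ⟨Finset.mem_image_of_mem W (Finset.mem_univ F), hne⟩) hF
  rw [eq_top_iff]
  intro y _
  obtain ⟨z, rfl⟩ := reduce_surjective 𝒮 y
  have hz : z ∈ W F := hW ▸ Submodule.mem_top
  exact hz
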